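/- All logarithms without a base are base $2$. **Hard distribution.** Fix positive integers $m$ and $n_0\ge 2$ and put $k=\lceil m\log^2 n_0\rceil$. For an integer $n$ let $n'=n'(n)$ be $\sqrt n/(k\log^2 n_0)$ rounded down to an even integer, and $\gamma=kn'$. Define recursively a pairing of $\{1,\dots,2n\}$ and a distribution $\mathcal D^n_{m,n_0}$ on $n$-element sets $A\subseteq\{1,\dots,2n\}$ that contain exactly one element of each pair: * If $\sqrt n<k\log^3 n_0$, the pairs are $\{2i-1,2i\}$, $1\le i\le n$, and $A$ contains one element of each pair, chosen by independent fair coins. * If $\sqrt n\ge k\log^3 n_0$, the pairs are $\{i,2n+1-i\}$ for $1\le i\le n-\gamma$ (the shell), together with $k$ shifted copies of the pairing for size $n'$, placed back-to-back on $\{n-\gamma+1,\dots,n+\gamma\}$ (the core). To draw $A$: choose $j\in\{1,\dots,k\}$ uniformly; choose a uniformly random set $S\subseteq\{1,\dots,n-\gamma\}$ of $\frac n2-n'(j-\frac12)$ elements; put $S$ into $A$, and $2n+1-i$ for every $i\in\{1,\dots,n-\gamma\}\setminus S$; and, independently, put $k$ independent samples of $\mathcal D^{n'}_{m,n_0}$,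 shifted, back-to-back into the core. **Communication problem.** Let $n$ be even. Draw $A$ from $\mathcal D^n_{m,n}$ and, independently, a uniformly random half of the $n$ pairs. Alice receives the elements of $A$ in these pairs, Bob receives the other elements of $A$. A deterministic protocol with $t$ messages of at most $m$ bits each lets the players (either of whom may begin) alternately send $t$ bit strings of length at most $m$, each a function of the sender's input and the earlier messages; its output is a bit determined by the transcript. Its error is the probability, over $A$ and the random partition, that the output differs from the least significant bit of the median of $A$, the median being the $n/2$-th smallest element of $A$. **Theorem.** There is an absolute constant $c$ such that for every $\varepsilon<1/2$ there is an $N=N(\varepsilon)$ with the following property. Let $n\ge N$ be even, $m\ge\log n$ and $t\ge 0$ integers. If some deterministic protocol with $t$ messages of at most $m$ bits each has error at most $\varepsilon$, then $$m^{2^{t+1}-2}>\frac{n}{(\log n)^{9\cdot 2^t-2}}\qquad\text{and}\qquad t\ge\log\log_m n-c .$$ -/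

import Mathlib

noncomputable section

namespace MedianCC

/-! ### Parameters of the recursive construction

All logarithms are to base two.  The real quantities are rounded so that the sizes are
integers and every recursive size is even. -/

/-- The branching factor `k = ⌈m log² n₀⌉`. -/
def branching (m n₀ : ℕ) : ℕ := ⌈(m : ℝ) * Real.logb 2 n₀ ^ 2⌉₊

/-- The size `n'` of a subproblem of an instance of size `n`:
`√n / (k log² n₀)`, rounded down to an even integer. -/
def subSize (m n₀ n : ℕ) : ℕ :=
  2 * ⌊√(n : ℝ) / (2 * branching m n₀ * Real.logb 2 n₀ ^ 2)⌋₊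

/-- The number `γ = k n'` of pairs of the core. -/
def coreSize (m n₀ n : ℕ) : ℕ := branching m n₀ * subSize m n₀ n

/-- An instance of size `n` is subdivided iff `√n ≥ k log³ n₀`.
(The clause `0 < k` holds automatically for `m ≥ 1` and `n₀ ≥ 2`.) -/
def Recurses (m n₀ n : ℕ) : Prop :=
  0 < branching m n₀ ∧ branching m n₀ * Real.logb 2 n₀ ^ 3 ≤ √(n : ℝ)

theorem coreSize_le (m n₀ n : ℕ) : 2 * coreSize m n₀ n ≤ n := by
  rcases Nat.eq_zero_or_pos (coreSize m n₀ n) with h | h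
  · omega
  have hk : 0 < branching m n₀ := Nat.pos_of_mul_pos_right h
  have hs : 0 < subSize m n₀ n := Nat.pos_of_mul_pos_left h
  have h2 : 2 ≤ coreSize m n₀ n := by
    have : 2 ≤ subSize m n₀ n := by unfold subSize at *; omega
    exact this.trans (Nat.le_mul_of_pos_left _ hk)
  have hn₀ : 2 ≤ n₀ := by
    by_contra hlt
    have : n₀ = 0 ∨ n₀ = 1 := by omega
    rcases this with rfl | rfl <;> simp [branching] at hk
  have hL : 1 ≤ Real.logb 2 n₀ := by
    rw [Real.le_logb_iff_rpow_le (by norm_num) (by positivity)]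
    simpa using (by exact_mod_cast hn₀ : (2 : ℝ) ≤ n₀)
  have hL2 : 1 ≤ Real.logb 2 n₀ ^ 2 := one_le_pow₀ hL
  have hkR : (1 : ℝ) ≤ branching m n₀ := by exact_mod_cast hk
  have hle : (coreSize m n₀ n : ℝ) ≤ √(n : ℝ) := by
    unfold coreSize subSize
    push_cast
    have hfl := Nat.floor_le (a := √(n : ℝ) / (2 * branching m n₀ * Real.logb 2 n₀ ^ 2))
      (by positivity)
    rw [le_div_iff₀ (by positivity)] at hfl
    have hpos : (0 : ℝ) ≤ ⌊√(n : ℝ) / (2 * branching m n₀ * Real.logb 2 n₀ ^ 2)⌋₊ *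
      (2 * branching m n₀) := by positivity
    nlinarith
  have hsq : coreSize m n₀ n ^ 2 ≤ n := by
    have := (Real.le_sqrt' (by exact_mod_cast h)).1 hle
    exact_mod_cast this
  nlinarith

theorem subSize_lt {m n₀ n : ℕ} (h : Recurses m n₀ n) : subSize m n₀ n < n := by
  obtain ⟨hk, hle⟩ := h
  have hn₀ : 2 ≤ n₀ := by
    by_contra hlt
    have : n₀ = 0 ∨ n₀ = 1 := by omega
    rcases this with rfl | rfl <;> simp [branching] at hk
  have hL : 0 < Real.logb 2 n₀ := Real.logb_pos (by norm_num) (by exact_mod_cast hn₀)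
  have hn : 0 < n := by
    have : 0 < √(n : ℝ) := lt_of_lt_of_le (by positivity) hle
    exact_mod_cast Real.sqrt_pos.1 this
  have h1 : subSize m n₀ n ≤ coreSize m n₀ n := Nat.le_mul_of_pos_left _ hk
  have h2 := coreSize_le m n₀ n
  omega

/-! ### The pairing of `{1, …, 2n}` -/

open Classical in
/-- The recursive pairing.  In the base case consecutive elements are paired.  Otherwise
`i` and `2n+1-i` are paired for `1 ≤ i ≤ n-γ` (the shell), and `k` copies of the pairing of
size `n'` are placed back-to-back on `{n-γ+1, …, n+γ}` (the core). -/
def pairing (m n₀ n : ℕ) : Finset (ℕ × ℕ) :=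
  if _h : Recurses m n₀ n then
    (Finset.Icc 1 (n - coreSize m n₀ n)).image (fun i => (i, 2 * n + 1 - i)) ∪
      (Finset.range (branching m n₀)).biUnion fun j =>
        (pairing m n₀ (subSize m n₀ n)).image fun p =>
          (n - coreSize m n₀ n + 2 * subSize m n₀ n * j + p.1,
            n - coreSize m n₀ n + 2 * subSize m n₀ n * j + p.2)
  else
    (Finset.range n).image fun i => (2 * i + 1, 2 * i + 2)
termination_by n
decreasing_by exact subSize_lt _h

/-! ### The hard distribution -/

/-- The law of `k` independent samples from `p`. -/
def iid {α : Type} (p : PMF α) : (k : ℕ) → PMF (Fin k → α)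
  | 0 => PMF.pure Fin.elim0
  | k + 1 => p.bind fun a => (iid p k).map fun v => (Fin.cons a v : Fin (k + 1) → α)

/-- The number `n/2 - n' (j + 1/2)` of shell elements below `n` that selects the `j`-th
subproblem, where `j` is counted from zero. -/
def lowCount (m n₀ n j : ℕ) : ℕ :=
  n / 2 - (subSize m n₀ n * j + subSize m n₀ n / 2)

theorem lowSets_nonempty (m n₀ n j : ℕ) :
    (Finset.powersetCard (lowCount m n₀ n j)
      (Finset.Icc 1 (n - coreSize m n₀ n))).Nonempty := by
  rw [Finset.powersetCard_nonempty, Nat.card_Icc]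
  have := coreSize_le m n₀ n
  unfold lowCount
  omega

open Classical in
/-- The hard distribution on `n`-element subsets of `{1, …, 2n}`.  In the base case one
element of each pair `{2i+1, 2i+2}` is chosen by an independent fair coin.  Otherwise:
choose `j` uniformly from the `k` subproblems; choose a uniformly random set `S` of
`n/2 - n' (j + 1/2)` elements of `{1, …, n-γ}`, and take `S` together with `2n+1-i` for
every `i ∈ {1, …, n-γ} \ S`; and independently place `k` independent recursive instances of
size `n'` back-to-back in the core. -/
def hardDist (m n₀ n : ℕ) : PMF (Finset ℕ) :=
  if h : Recurses m n₀ n then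
    (PMF.uniformOfFinset (Finset.range (branching m n₀))
        ⟨0, Finset.mem_range.2 h.1⟩).bind fun j =>
      (PMF.uniformOfFinset
          (Finset.powersetCard (lowCount m n₀ n j) (Finset.Icc 1 (n - coreSize m n₀ n)))
          (lowSets_nonempty m n₀ n j)).bind fun S =>
        (iid (hardDist m n₀ (subSize m n₀ n)) (branching m n₀)).map fun B =>
          S ∪ (Finset.Icc 1 (n - coreSize m n₀ n) \ S).image (fun i => 2 * n + 1 - i) ∪
            Finset.univ.biUnion fun i : Fin (branching m n₀) =>
              (B i).image fun a => n - coreSize m n₀ n + 2 * subSize m n₀ n * i + a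
  else
    (PMF.uniformOfFintype (Fin n → Bool)).map fun b =>
      Finset.univ.image fun i : Fin n => 2 * (i : ℕ) + 1 + (b i).toNat
termination_by n
decreasing_by exact subSize_lt h

theorem halves_nonempty (P : Finset (ℕ × ℕ)) :
    (Finset.powersetCard (P.card / 2) P).Nonempty := by
  rw [Finset.powersetCard_nonempty]
  exact Nat.div_le_self _ _

/-- The random partition: the set of the pairs that go to Alice is a uniformly random half
of all the pairs. -/
def splitDist (m n : ℕ) : PMF (Finset (ℕ × ℕ)) :=
  PMF.uniformOfFinset (Finset.powersetCard ((pairing m n n).card / 2) (pairing m n n))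
    (halves_nonempty _)

/-- The random input: a set `A` from the hard distribution with `n₀ = n`, and independently
the set of the pairs that go to Alice. -/
def inputDist (m n : ℕ) : PMF (Finset ℕ × Finset (ℕ × ℕ)) :=
  (hardDist m n n).bind fun A => (splitDist m n).map fun P => (A, P)

open Classical in
/-- Alice's input: the elements of `A` that lie in her pairs. -/
def aliceInput (A : Finset ℕ) (P : Finset (ℕ × ℕ)) : Finset ℕ :=
  A.filter fun a => ∃ p ∈ P, a = p.1 ∨ a = p.2

/-- Bob's input: the remaining elements of `A`. -/
def bobInput (A : Finset ℕ) (P : Finset (ℕ × ℕ)) : Finset ℕ := A \ aliceInput A P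

/-- The median of a set of even size `n`: its `n/2`-th order statistic
(`Nat.nth` counts from zero). -/
def median (A : Finset ℕ) : ℕ := Nat.nth (fun a => a ∈ A) (A.card / 2 - 1)

/-- The least significant bit of the median. -/
def medianBit (A : Finset ℕ) : Bool := (median A).testBit 0

/-! ### Protocols -/

inductive Player
  | alice
  | bob

/-- A message of at most `m` bits. -/
abbrev Message (m : ℕ) : Type := {l : List Bool // l.length ≤ m}

/-- Deterministic two-party protocols in which `t` messages of at most `m` bits are sent in
turn, beginning with the indicated player.  A message depends on the sender's input and on
the earlier messages; the output is determined by the transcript (it labels the leaf of the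
protocol tree). -/
inductive Protocol (X Y : Type) (m : ℕ) : Player → ℕ → Type
  | output (p : Player) (b : Bool) : Protocol X Y m p 0
  | alice {t : ℕ} (msg : X → Message m) (next : Message m → Protocol X Y m Player.bob t) :
      Protocol X Y m Player.alice (t + 1)
  | bob {t : ℕ} (msg : Y → Message m) (next : Message m → Protocol X Y m Player.alice t) :
      Protocol X Y m Player.bob (t + 1)

/-- The output of the protocol on input `(x, y)`. -/
def Protocol.run {X Y : Type} {m : ℕ} {p : Player} {t : ℕ}
    (π : Protocol X Y m p t) (x : X) (y : Y) : Bool :=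
  match π with
  | .output _ b => b
  | .alice msg next => (next (msg x)).run x y
  | .bob msg next => (next (msg y)).run x y

/-- The probability, over the random set and the random partition, that the protocol does not
output the least significant bit of the median. -/
def errorProb (n : ℕ) {m : ℕ} {p : Player} {t : ℕ}
    (π : Protocol (Finset ℕ) (Finset ℕ) m p t) : ℝ :=
  ((inputDist m n).toOuterMeasure
    {ω | π.run (aliceInput ω.1 ω.2) (bobInput ω.1 ω.2) ≠ medianBit ω.1}).toReal

end MedianCC

end

noncomputable section

namespace MedianCC

open Finset

/-! ### Hypergeometric estimates -/

/-! The proof is a round elimination. The shell decides which of the `k` blocks of the core contains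
the median, and the answer is the answer of that block (`medianBit_assemble`). The first message is
shorter than `k` by a factor of about `log² n`, so it says little about an average block. Hence the
listener can replace it by a sample drawn without knowing the speaker's part of the selected block.
What remains is a protocol for a single instance of size `n'` with one message fewer, begun by the
listener. When no message is left, the answer is a fair coin (`prob_medianBit`).

Three estimates carry the elimination.

(a) `sum_influence_le` bounds the total dependence of a message on independent blocks. It uses
exponential moments where mutual information and Pinsker's inequality would be usual.

(b) `eliminate_block` samples the message from its law given the listener's input. The speaker then
samples the other blocks given that message and the own block. Both samples are derandomized. The
sampled message travels with the listener's first message, so alphabets multiply and after `t`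
rounds have about `t (m + 1)` bits; this is harmless because `t` is only of order `log log n`.

(c) The speaker also sees part of the shell, whose law depends on the selected block. Changing the
block changes the size of the random shell set by at most `γ ≤ √n / log² n`, while the number of its
elements among the listener's shell positions fluctuates on the scale `√n`. So the speaker's part
hardly changes in law (`subsetAvg_add_diff`, `shellClose_of_balanced`). This needs both players to
own a constant fraction of the shell, which a random half of the pairs provides by Chebyshev's
inequality (`unbalanced_le`).

The losses of all levels add up to `O((t + 1)² / log n)`. If the claimed inequality between `m` and
`n` failed, the instance could be subdivided `t` times (`deep_of_sizeBound_le`) and `2 ^ t ≤ log n`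
would hold, so the error would be close to one half. -/

theorem sum_powersetCard_succ {α : Type*} [DecidableEq α] (U : Finset α) (s : ℕ)
    (φ : Finset α → α → ℝ) :
    ∑ T ∈ powersetCard (s + 1) U, ∑ e ∈ T, φ (T.erase e) e =
      ∑ S ∈ powersetCard s U, ∑ e ∈ U \ S, φ S e := by
  rw [Finset.sum_sigma', Finset.sum_sigma']
  refine Finset.sum_bij' (fun x _ => ⟨x.1.erase x.2, x.2⟩) (fun x _ => ⟨insert x.2 x.1, x.2⟩)
    ?_ ?_ ?_ ?_ ?_
  · rintro ⟨T, e⟩ h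
    simp only [mem_sigma, mem_powersetCard, mem_sdiff] at h ⊢
    exact ⟨⟨(erase_subset _ _).trans h.1.1, by rw [card_erase_of_mem h.2, h.1.2]; rfl⟩,
      h.1.1 h.2, by simp⟩
  · rintro ⟨S, e⟩ h
    simp only [mem_sigma, mem_powersetCard, mem_sdiff] at h ⊢
    exact ⟨⟨insert_subset h.2.1 h.1.1, by rw [card_insert_of_notMem h.2.2, h.1.2]⟩, by simp⟩
  · rintro ⟨T, e⟩ h
    simp only [mem_sigma] at h
    simp [insert_erase h.2]
  · rintro ⟨S, e⟩ h
    simp only [mem_sigma, mem_sdiff] at h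
    simp [erase_insert h.2.2]
  · rintro ⟨T, e⟩ h
    rfl

/-- The number of `s`-subsets of `U` containing a given element. -/
theorem card_powersetCard_mem {α : Type*} [DecidableEq α] (U : Finset α) (s : ℕ) {e : α}
    (he : e ∈ U) :
    (U.card : ℝ) * ((powersetCard s U).filter fun S => e ∈ S).card =
      s * (powersetCard s U).card := by
  have h1 : ((powersetCard s U).filter fun S => e ∈ S) =
      (powersetCard s U).filter fun S => {e} ⊆ S := by
    simp
  have hU : 1 ≤ U.card := card_pos.2 ⟨e, he⟩
  rcases Nat.eq_zero_or_pos s with rfl | hs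
  · simp
  · rw [h1, card_filter_powersetCard_subset _ _ _ (by simpa using he) (by rw [card_singleton]; exact hs),
      card_powersetCard, card_singleton]
    obtain ⟨N, hN⟩ := Nat.exists_eq_add_of_le' hU
    obtain ⟨r, rfl⟩ := Nat.exists_eq_add_of_le' hs
    rw [hN]
    have := Nat.add_one_mul_choose_eq N r
    simp only [Nat.add_sub_cancel]
    rw [mul_comm ((r+1 : ℕ) : ℝ)]
    exact_mod_cast this

/-- Membership of two elements in a random `s`-subset is negatively correlated. -/
theorem card_powersetCard_mem_mem {α : Type*} [DecidableEq α] (U : Finset α) (s : ℕ) {e f : α}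
    (he : e ∈ U) (hf : f ∈ U) (hne : e ≠ f) :
    (U.card : ℝ) ^ 2 * ((powersetCard s U).filter fun S => e ∈ S ∧ f ∈ S).card ≤
      s ^ 2 * (powersetCard s U).card := by
  have h1 : ((powersetCard s U).filter fun S => e ∈ S ∧ f ∈ S) =
      (powersetCard s U).filter fun S => {e, f} ⊆ S := by
    congr 1; ext S; simp [insert_subset_iff]
  have hc : ({e, f} : Finset α).card = 2 := card_pair hne
  have hU : 2 ≤ U.card := hc ▸ card_le_card (by simp [insert_subset_iff, he, hf])
  rcases lt_or_ge s 2 with hs | hs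
  · have : ((powersetCard s U).filter fun S => e ∈ S ∧ f ∈ S) = ∅ := by
      rw [h1, filter_eq_empty_iff]
      intro S hS hsub
      have := card_le_card hsub
      rw [hc, (mem_powersetCard.1 hS).2] at this
      omega
    rw [this]; simp; positivity
  rcases lt_or_ge U.card s with hlt | hle
  · rw [powersetCard_eq_empty.2 hlt]; simp
  · rw [h1, card_filter_powersetCard_subset _ _ _ (by simp [insert_subset_iff, he, hf])
      (by omega), card_powersetCard, hc]
    obtain ⟨N, hN⟩ := Nat.exists_eq_add_of_le' hU
    obtain ⟨r, rfl⟩ := Nat.exists_eq_add_of_le' hs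
    rw [hN] at hle ⊢
    have e1 := Nat.add_one_mul_choose_eq (N + 1) (r + 1)
    have e2 := Nat.add_one_mul_choose_eq N r
    simp only [Nat.add_sub_cancel]
    have e1' : ((N : ℝ) + 2) * (N + 1).choose (r + 1) = (N + 2).choose (r + 2) * (r + 2) := by
      exact_mod_cast e1
    have e2' : ((N : ℝ) + 1) * N.choose r = (N + 1).choose (r + 1) * (r + 1) := by
      exact_mod_cast e2
    have hNr : (r : ℝ) ≤ N := by exact_mod_cast (by omega : r ≤ N)
    push_cast
    have hr0 : (0 : ℝ) ≤ r := by positivity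
    have hN1 : (0 : ℝ) < N + 1 := by positivity
    have key : ((N : ℝ) + 2) * (((N : ℝ) + 1) * N.choose r) =
        (N + 2).choose (r + 2) * (r + 2) * (r + 1) := by
      rw [e2', ← mul_assoc, e1']
    rw [← mul_le_mul_iff_of_pos_left hN1]
    have hC : (0 : ℝ) ≤ (N + 2).choose (r + 2) := by positivity
    -- This amounts to `r ≤ N`. With `|U| = N + 2` and `s = r + 2` it reads `(s - 1) / (|U| - 1) ≤ s
    -- / |U|`, which is the negative correlation.
    have h3 : ((N : ℝ) + 2) * (r + 1) ≤ (N + 1) * (r + 2) := by nlinarith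
    calc ((N : ℝ) + 1) * (((N : ℝ) + 2) ^ 2 * N.choose r)
        = (N + 2) * (((N : ℝ) + 2) * (((N : ℝ) + 1) * N.choose r)) := by ring
      _ = (((N : ℝ) + 2) * (r + 1)) * ((N + 2).choose (r + 2) * (r + 2)) := by rw [key]; ring
      _ ≤ ((N + 1) * (r + 2)) * ((N + 2).choose (r + 2) * (r + 2)) := by gcongr
      _ = _ := by ring

/-- The variance of the hypergeometric distribution. -/
theorem hypergeometric_variance {α : Type*} [DecidableEq α] (U W : Finset α) (hW : W ⊆ U)
    (s : ℕ) (hs : s ≤ U.card) :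
    ∑ S ∈ powersetCard s U, (((S ∩ W).card : ℝ) - s * W.card / U.card) ^ 2 ≤
      W.card * (powersetCard s U).card := by
  rcases Nat.eq_zero_or_pos U.card with h0 | hpos
  · have : U = ∅ := card_eq_zero.1 h0
    subst this
    have : W = ∅ := subset_empty.1 hW
    subst this
    simp
  have hN : (0 : ℝ) < U.card := by exact_mod_cast hpos
  set c : ℝ := ((powersetCard s U).card : ℝ) with hc
  set p : ℝ := s / U.card with hp
  have hp0 : 0 ≤ p := by positivity
  have hp1 : p ≤ 1 := by
    rw [hp, div_le_one hN]; exact_mod_cast hs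
  have hc0 : 0 ≤ c := by positivity
  have hind : ∀ S : Finset α, ((S ∩ W).card : ℝ) - s * W.card / U.card =
      ∑ e ∈ W, ((if e ∈ S then (1 : ℝ) else 0) - p) := by
    intro S
    rw [sum_sub_distrib, sum_const, nsmul_eq_mul, ← sum_filter, sum_const, nsmul_eq_mul, mul_one,
      filter_mem_eq_inter, inter_comm, hp]
    ring
  have h1 : ∀ e ∈ U, ∑ S ∈ powersetCard s U, (if e ∈ S then (1 : ℝ) else 0) = p * c := by
    intro e he
    rw [← sum_filter, sum_const, nsmul_eq_mul, mul_one, hp, div_mul_eq_mul_div, eq_div_iff hN.ne',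
      mul_comm, card_powersetCard_mem U s he]
  have h2 : ∀ e ∈ U, ∀ f ∈ U, e ≠ f → ∑ S ∈ powersetCard s U,
      ((if e ∈ S then (1 : ℝ) else 0) * (if f ∈ S then (1 : ℝ) else 0)) ≤ p ^ 2 * c := by
    intro e he f hf hne
    have : ∀ S : Finset α, ((if e ∈ S then (1 : ℝ) else 0) * (if f ∈ S then (1 : ℝ) else 0)) =
      if e ∈ S ∧ f ∈ S then 1 else 0 := by
      intro S; split_ifs <;> simp_all
    simp_rw [this]
    rw [← sum_filter, sum_const, nsmul_eq_mul, mul_one, hp, div_pow, div_mul_eq_mul_div,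
      le_div_iff₀ (by positivity), mul_comm]
    exact card_powersetCard_mem_mem U s he hf hne
  -- Off the diagonal the covariances are nonpositive, so only the `|W|` diagonal terms, each at
  -- most `c`, survive.
  have hcov : ∀ e ∈ W, ∀ f ∈ W, ∑ S ∈ powersetCard s U,
      (((if e ∈ S then (1 : ℝ) else 0) - p) * ((if f ∈ S then (1 : ℝ) else 0) - p)) ≤
      if e = f then c else 0 := by
    intro e he f hf
    have hexp : ∑ S ∈ powersetCard s U,
      (((if e ∈ S then (1 : ℝ) else 0) - p) * ((if f ∈ S then (1 : ℝ) else 0) - p)) =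
      ∑ S ∈ powersetCard s U,
        ((if e ∈ S then (1 : ℝ) else 0) * (if f ∈ S then (1 : ℝ) else 0)) - p ^ 2 * c := by
      have : ∀ S : Finset α,
        (((if e ∈ S then (1 : ℝ) else 0) - p) * ((if f ∈ S then (1 : ℝ) else 0) - p)) =
        ((if e ∈ S then (1 : ℝ) else 0) * (if f ∈ S then (1 : ℝ) else 0)) -
          p * (if e ∈ S then (1 : ℝ) else 0) - p * (if f ∈ S then (1 : ℝ) else 0) + p ^ 2 := by
        intro S; ring
      simp_rw [this]
      rw [sum_add_distrib, sum_sub_distrib, sum_sub_distrib, ← mul_sum, ← mul_sum,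
        h1 e (hW he), h1 f (hW hf), sum_const, nsmul_eq_mul, ← hc]
      ring
    rw [hexp]
    split_ifs with hef
    · subst hef
      have : ∀ S : Finset α, ((if e ∈ S then (1 : ℝ) else 0) * (if e ∈ S then (1 : ℝ) else 0)) =
          (if e ∈ S then (1 : ℝ) else 0) := by intro S; split_ifs <;> simp
      simp_rw [this]
      rw [h1 e (hW he)]
      nlinarith [mul_nonneg (sq_nonneg p) hc0, mul_le_mul_of_nonneg_right hp1 hc0]
    · linarith [h2 e (hW he) f (hW hf) hef]
  calc ∑ S ∈ powersetCard s U, (((S ∩ W).card : ℝ) - s * W.card / U.card) ^ 2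
      = ∑ S ∈ powersetCard s U, ∑ e ∈ W, ∑ f ∈ W,
        (((if e ∈ S then (1 : ℝ) else 0) - p) * ((if f ∈ S then (1 : ℝ) else 0) - p)) := by
        refine sum_congr rfl fun S _ => ?_
        rw [hind, sq, sum_mul_sum]
    _ = ∑ e ∈ W, ∑ f ∈ W, ∑ S ∈ powersetCard s U,
        (((if e ∈ S then (1 : ℝ) else 0) - p) * ((if f ∈ S then (1 : ℝ) else 0) - p)) := by
        rw [sum_comm]
        exact sum_congr rfl fun e _ => sum_comm
    _ ≤ ∑ e ∈ W, ∑ f ∈ W, (if e = f then c else 0) :=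
        sum_le_sum fun e he => sum_le_sum fun f hf => hcov e he f hf
    _ = W.card * c := by simp +contextual [sum_ite_eq]

/-- Follows from the variance by `|d| ≤ d² / (2θ) + θ / 2` with `θ = √|U|`, which plays the role of
Cauchy–Schwarz. -/
theorem hypergeometric_abs_deviation {α : Type*} [DecidableEq α] (U W : Finset α) (hW : W ⊆ U)
    (s : ℕ) (hs : s ≤ U.card) :
    ∑ S ∈ powersetCard s U, |((S ∩ W).card : ℝ) - s * W.card / U.card| ≤
      √(U.card) * (powersetCard s U).card := by
  rcases Nat.eq_zero_or_pos U.card with h0 | hpos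
  · have : U = ∅ := card_eq_zero.1 h0
    subst this
    have : W = ∅ := subset_empty.1 hW
    subst this
    simp
  have hθ : 0 < √(U.card : ℝ) := Real.sqrt_pos.2 (by exact_mod_cast hpos)
  have hθ2 : √(U.card : ℝ) ^ 2 = U.card := Real.sq_sqrt (by positivity)
  set θ := √(U.card : ℝ)
  have hpt : ∀ d : ℝ, |d| ≤ d ^ 2 / (2 * θ) + θ / 2 := by
    intro d
    rw [← sq_abs d, div_add_div _ _ (by positivity) (by positivity), le_div_iff₀ (by positivity)]
    nlinarith [sq_nonneg (|d| - θ)]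
  have hWU : (W.card : ℝ) ≤ U.card := by exact_mod_cast card_le_card hW
  calc _ ≤ ∑ S ∈ powersetCard s U,
        ((((S ∩ W).card : ℝ) - s * W.card / U.card) ^ 2 / (2 * θ) + θ / 2) :=
        sum_le_sum fun S _ => hpt _
    _ ≤ (W.card * (powersetCard s U).card) / (2 * θ) + (powersetCard s U).card * (θ / 2) := by
        rw [sum_add_distrib, ← sum_div, sum_const, nsmul_eq_mul]
        gcongr
        exact hypergeometric_variance U W hW s hs
    _ ≤ (θ ^ 2 * (powersetCard s U).card) / (2 * θ) + (powersetCard s U).card * (θ / 2) := by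
        rw [hθ2]; gcongr
    _ = _ := by field_simp; ring

/-- The average of `c` over the `s`-subsets of `U`. -/
def subsetAvg {α : Type*} (U : Finset α) (s : ℕ) (c : Finset α → ℝ) : ℝ :=
  (∑ S ∈ powersetCard s U, c S) / (powersetCard s U).card

/-- One more element in a random subset `S` of `U` hardly changes the law of the part of `S`
outside of a large set `W`. -/
theorem subsetAvg_succ_diff {α : Type*} [DecidableEq α] (U W : Finset α) (hW : W ⊆ U)
    (s : ℕ) (hs : s + 1 ≤ U.card) (hWpos : 0 < W.card) (c : Finset α → ℝ)
    (h0 : ∀ S, 0 ≤ c S) (h1 : ∀ S, c S ≤ 1) :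
    subsetAvg U s (fun S => c (S \ W)) ≤ subsetAvg U (s + 1) (fun S => c (S \ W)) +
      U.card / W.card * √(U.card) * (1 / (s + 1) + 1 / (U.card - s)) := by
  set N : ℝ := (U.card : ℝ) with hN
  set w : ℝ := (W.card : ℝ) with hw
  have hwp : 0 < w := Nat.cast_pos.2 hWpos
  have hNp : 0 < N := by
    have : 0 < U.card := by omega
    exact Nat.cast_pos.2 this
  have hsN : (s : ℝ) + 1 ≤ N := by
    have : ((s + 1 : ℕ) : ℝ) ≤ (U.card : ℝ) := Nat.cast_le.2 hs
    rwa [Nat.cast_succ] at this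
  have hNs : 0 < N - s := by linarith
  have hCs : (0 : ℝ) < (powersetCard s U).card := by
    rw [card_powersetCard]; exact_mod_cast Nat.choose_pos (by omega)
  have hCs1 : (0 : ℝ) < (powersetCard (s + 1) U).card := by
    rw [card_powersetCard]; exact_mod_cast Nat.choose_pos hs
  have hCC : ((powersetCard (s + 1) U).card : ℝ) * (s + 1) = (powersetCard s U).card * (N - s) := by
    have := Nat.choose_succ_right_eq U.card s
    rw [card_powersetCard, card_powersetCard, hN, ← Nat.cast_sub (by omega)]
    exact_mod_cast this
  -- double counting
  have hdc : ∑ T ∈ powersetCard (s + 1) U, c (T \ W) * ((T ∩ W).card : ℝ) =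
      ∑ S ∈ powersetCard s U, c (S \ W) * (w - ((S ∩ W).card : ℝ)) := by
    -- Only `e ∈ W` is counted: adding such an element does not change the set outside of `W`.
    have := sum_powersetCard_succ U s fun S e => if e ∈ W then c (S \ W) else 0
    calc _ = ∑ T ∈ powersetCard (s + 1) U, ∑ e ∈ T,
          (if e ∈ W then c (T.erase e \ W) else 0) := by
          refine sum_congr rfl fun T _ => ?_
          rw [← sum_filter, filter_mem_eq_inter, mul_comm, ← nsmul_eq_mul, ← sum_const]
          refine sum_congr rfl fun e he => ?_
          congr 1
          ext a
          simp only [mem_inter, mem_sdiff, mem_erase] at he ⊢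
          constructor
          · rintro ⟨h, h'⟩; exact ⟨⟨by rintro rfl; exact h' he.2, h⟩, h'⟩
          · rintro ⟨⟨_, h⟩, h'⟩; exact ⟨h, h'⟩
      _ = _ := this
      _ = _ := by
          refine sum_congr rfl fun S hS => ?_
          rw [← sum_filter, filter_mem_eq_inter, sum_const, nsmul_eq_mul, mul_comm]
          congr 1
          have e1 : (U \ S) ∩ W = W \ S := by
            ext a; simp only [mem_inter, mem_sdiff]
            constructor
            · rintro ⟨⟨_, h⟩, h'⟩; exact ⟨h', h⟩
            · rintro ⟨h, h'⟩; exact ⟨⟨hW h, h'⟩, h⟩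
          have e2 := card_sdiff_add_card_inter W S
          rw [e1, hw, inter_comm S W, ← e2]
          push_cast; ring
  set X : ℝ := ∑ S ∈ powersetCard s U, c (S \ W) with hX
  set Y : ℝ := ∑ T ∈ powersetCard (s + 1) U, c (T \ W) with hY
  -- On both sides of `hdc` the count in `W` is replaced by its mean, at an average cost of at most
  -- `√N` per set.
  have b1 : |∑ T ∈ powersetCard (s + 1) U,
      c (T \ W) * (((T ∩ W).card : ℝ) - ((s + 1 : ℕ) : ℝ) * w / N)| ≤
      √N * (powersetCard (s + 1) U).card := by
    refine (abs_sum_le_sum_abs _ _).trans (le_trans ?_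
      (hypergeometric_abs_deviation U W hW (s + 1) hs))
    refine sum_le_sum fun T _ => ?_
    rw [abs_mul, abs_of_nonneg (h0 _)]
    exact mul_le_of_le_one_left (abs_nonneg _) (h1 _)
  have b2 : |∑ S ∈ powersetCard s U,
      c (S \ W) * (((S ∩ W).card : ℝ) - (s : ℝ) * w / N)| ≤
      √N * (powersetCard s U).card := by
    refine (abs_sum_le_sum_abs _ _).trans (le_trans ?_
      (hypergeometric_abs_deviation U W hW s (by omega)))
    refine sum_le_sum fun T _ => ?_
    rw [abs_mul, abs_of_nonneg (h0 _)]
    exact mul_le_of_le_one_left (abs_nonneg _) (h1 _)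
  have e1 : ∑ T ∈ powersetCard (s + 1) U,
      c (T \ W) * (((T ∩ W).card : ℝ) - ((s + 1 : ℕ) : ℝ) * w / N) =
      ∑ T ∈ powersetCard (s + 1) U, c (T \ W) * ((T ∩ W).card : ℝ) - Y * ((s + 1) * w / N) := by
    rw [hY, sum_mul, ← sum_sub_distrib]
    refine sum_congr rfl fun T _ => ?_
    push_cast; ring
  have e2 : ∑ S ∈ powersetCard s U, c (S \ W) * (((S ∩ W).card : ℝ) - (s : ℝ) * w / N) =
      X * (w * (N - s) / N) - ∑ S ∈ powersetCard s U, c (S \ W) * (w - ((S ∩ W).card : ℝ)) := by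
    rw [hX, sum_mul, ← sum_sub_distrib]
    refine sum_congr rfl fun T _ => ?_
    field_simp; ring
  rw [e1, hdc] at b1
  rw [e2] at b2
  have hkey : X * (w * (N - s) / N) - Y * ((s + 1) * w / N) ≤
      √N * (powersetCard (s + 1) U).card + √N * (powersetCard s U).card := by
    have := (abs_le.1 b1).2
    have := (abs_le.1 b2).2
    linarith
  set Cs : ℝ := ((powersetCard s U).card : ℝ)
  set Ct : ℝ := ((powersetCard (s + 1) U).card : ℝ)
  have hCt : Ct = Cs * (N - s) / (s + 1) := by rw [← hCC]; field_simp
  unfold subsetAvg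
  change X / Cs ≤ Y / Ct + N / w * √N * (1 / (s + 1) + 1 / (N - s))
  have hsp : (0 : ℝ) < s + 1 := by positivity
  -- By `hCC`, mean times number of sets is the same for both sizes, so the weighted sums in `hkey`
  -- become a multiple of the difference of the averages.
  have h3 : X / Cs - Y / Ct = (X * (w * (N - s) / N) - Y * ((s + 1) * w / N)) *
      (N / (w * (N - s) * Cs)) := by
    rw [hCt]; field_simp
  have h4 : N / w * √N * (1 / (s + 1) + 1 / (N - s)) = (√N * Ct + √N * Cs) *
      (N / (w * (N - s) * Cs)) := by
    rw [hCt]; field_simp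
  have h5 : X / Cs - Y / Ct ≤ N / w * √N * (1 / (s + 1) + 1 / (N - s)) := by
    rw [h3, h4]
    gcongr
  linarith

/-- While the size stays between `|U| / 4` and `3 |U| / 4`, each added element costs at most `8 ·
√|U| · (4 / |U| + 4 / |U|) = 64 / √|U|`. A shift of the size by `o(√|U|)` is therefore invisible
outside of `W`. -/
theorem subsetAvg_add_diff {α : Type*} [DecidableEq α] (U W : Finset α) (hW : W ⊆ U)
    (hWU : U.card ≤ 8 * W.card) (hU : 0 < U.card) (c : Finset α → ℝ)
    (h0 : ∀ S, 0 ≤ c S) (h1 : ∀ S, c S ≤ 1) (s d : ℕ) (hs : U.card ≤ 4 * s)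
    (hsd : 4 * (s + d) ≤ 3 * U.card) :
    subsetAvg U s (fun S => c (S \ W)) ≤ subsetAvg U (s + d) (fun S => c (S \ W)) +
      d * (64 / √(U.card)) := by
  induction d with
  | zero => simp
  | succ d ih =>
    have ih := ih (by omega)
    have hstep := subsetAvg_succ_diff U W hW (s + d) (by omega) (by omega) c h0 h1
    have hNpos : (0 : ℝ) < U.card := Nat.cast_pos.2 hU
    have hwpos : (0 : ℝ) < W.card := Nat.cast_pos.2 (by omega)
    have hw : (U.card : ℝ) / W.card ≤ 8 := by
      rw [div_le_iff₀ hwpos]; exact_mod_cast hWU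
    have hsR : (U.card : ℝ) ≤ 4 * s := by exact_mod_cast hs
    have hsdR : 4 * ((s : ℝ) + (d + 1)) ≤ 3 * U.card := by exact_mod_cast hsd
    have a1 : (1 : ℝ) / ((s + d : ℕ) + 1) ≤ 4 / U.card := by
      rw [div_le_div_iff₀ (by positivity) hNpos]; push_cast; nlinarith [Nat.cast_nonneg (α := ℝ) d]
    have a2 : (1 : ℝ) / (U.card - (s + d : ℕ)) ≤ 4 / U.card := by
      rw [div_le_div_iff₀ (by push_cast; linarith) hNpos]; push_cast; linarith
    have hsq : √(U.card : ℝ) ^ 2 = U.card := Real.sq_sqrt hNpos.le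
    have hθ : 0 < √(U.card : ℝ) := Real.sqrt_pos.2 hNpos
    have hb : (U.card : ℝ) / W.card * √(U.card) *
        (1 / ((s + d : ℕ) + 1) + 1 / (U.card - (s + d : ℕ))) ≤ 64 / √(U.card) := by
      have hq : 0 ≤ (1 : ℝ) / ((s + d : ℕ) + 1) + 1 / (U.card - (s + d : ℕ)) := by
        have : (0 : ℝ) < U.card - (s + d : ℕ) := by push_cast; linarith
        positivity
      calc _ ≤ 8 * √(U.card) * (4 / U.card + 4 / U.card : ℝ) := by gcongr
        _ = 64 / √(U.card) := by
          rw [← add_div, mul_div_assoc', div_eq_div_iff hNpos.ne' hθ.ne']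
          nlinarith
    push_cast at hb hstep ⊢
    rw [show s + (d + 1) = s + d + 1 by ring]
    linarith

/-! ### Product weights -/

section Product

variable {k : ℕ} {Ω : Type} [Fintype Ω]

theorem sum_prod_eq_one (p : Fin k → Ω → ℝ) (hp : ∀ i, ∑ ω, p i ω = 1) :
    ∑ ζ : Fin k → Ω, ∏ i, p i (ζ i) = 1 := by
  classical
  rw [← Fintype.prod_sum]
  simp [hp]

/-- Averaging a function of all the coordinates but one. -/
theorem sum_prod_update_eq (p : Fin k → Ω → ℝ) (j : Fin k) (hp : ∑ ω, p j ω = 1)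
    (h : (Fin k → Ω) → ℝ) (ω : Ω) :
    ∑ ζ : Fin k → Ω, (∏ i, p i (ζ i)) * h (Function.update ζ j ω) =
      ∑ y : ({i // i ≠ j} → Ω), (∏ i : {i // i ≠ j}, p i (y i)) *
        h ((Equiv.piSplitAt j fun _ : Fin k => Ω).symm (ω, y)) := by
  classical
  let e := Equiv.piSplitAt j (fun _ : Fin k => Ω)
  have hprod : ∀ x, ∏ i, p i (e.symm x i) = p j x.1 * ∏ i : {i // i ≠ j}, p i (x.2 i) := by
    intro x
    rw [← Finset.mul_prod_erase _ _ (mem_univ j)]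
    congr 1
    · simp [e, Equiv.piSplitAt]
    · rw [Finset.prod_subtype (univ.erase j) (p := fun i => i ≠ j) (by simp)
        (fun i => p i (e.symm x i))]
      refine Finset.prod_congr rfl fun i _ => ?_
      simp [e, Equiv.piSplitAt, i.2]
  have hupd : ∀ x ω, Function.update (e.symm x) j ω = e.symm (ω, x.2) := by
    intro x ω
    ext i
    by_cases hi : i = j
    · subst hi; simp [e, Equiv.piSplitAt]
    · simp [e, Equiv.piSplitAt, hi]
  rw [← e.symm.sum_comp, Fintype.sum_prod_type]
  simp_rw [hprod, hupd]
  rw [Finset.sum_comm]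
  refine sum_congr rfl fun y _ => ?_
  rw [← sum_mul, ← sum_mul, hp, one_mul]

/-- The weight of a coordinate that is overwritten is irrelevant. -/
theorem sum_prod_update_congr (p p' : Fin k → Ω → ℝ) (j : Fin k) (hp : ∑ ω, p j ω = 1)
    (hp' : ∑ ω, p' j ω = 1) (hpp : ∀ i, i ≠ j → p i = p' i)
    (h : (Fin k → Ω) → ℝ) (ω : Ω) :
    ∑ ζ : Fin k → Ω, (∏ i, p i (ζ i)) * h (Function.update ζ j ω) =
      ∑ ζ : Fin k → Ω, (∏ i, p' i (ζ i)) * h (Function.update ζ j ω) := by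
  rw [sum_prod_update_eq p j hp, sum_prod_update_eq p' j hp']
  refine sum_congr rfl fun y _ => ?_
  congr 1
  exact prod_congr rfl fun i _ => by rw [hpp i i.2]

/-- Resampling one coordinate. -/
theorem sum_prod_update (p : Fin k → Ω → ℝ) (hp : ∀ i, ∑ ω, p i ω = 1) (j : Fin k)
    (h : (Fin k → Ω) → ℝ) :
    ∑ ζ : Fin k → Ω, (∏ i, p i (ζ i)) * h ζ =
      ∑ ω, p j ω * ∑ ζ : Fin k → Ω, (∏ i, p i (ζ i)) * h (Function.update ζ j ω) := by
  classical
  simp_rw [sum_prod_update_eq p j (hp j)]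
  let e := Equiv.piSplitAt j (fun _ : Fin k => Ω)
  rw [← e.symm.sum_comp, Fintype.sum_prod_type]
  refine sum_congr rfl fun ω _ => ?_
  rw [mul_sum]
  refine sum_congr rfl fun y _ => ?_
  rw [← mul_assoc]
  congr 1
  rw [← Finset.mul_prod_erase _ _ (mem_univ j)]
  congr 1
  · simp [e, Equiv.piSplitAt]
  · rw [Finset.prod_subtype (univ.erase j) (p := fun i => i ≠ j) (by simp)
      (fun i => p i (e.symm (ω, y) i))]
    refine Finset.prod_congr rfl fun i _ => ?_
    simp [e, Equiv.piSplitAt, i.2]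

/-- The marginal of a product weight. -/
theorem sum_prod_marginal (p : Fin k → Ω → ℝ) (hp : ∀ i, ∑ ω, p i ω = 1) (j : Fin k)
    (g : Ω → ℝ) :
    ∑ ζ : Fin k → Ω, (∏ i, p i (ζ i)) * g (ζ j) = ∑ ω, p j ω * g ω := by
  rw [sum_prod_update p hp j]
  refine sum_congr rfl fun ω _ => ?_
  simp only [Function.update_self]
  rw [← sum_mul, sum_prod_eq_one p hp, one_mul]

end Product

/-! ### A short message says little about most coordinates -/

/-- Hoeffding's lemma for a finitely supported centered variable. -/
theorem sum_exp_le {Ω : Type} [Fintype Ω] (p : Ω → ℝ) (hp0 : ∀ ω, 0 ≤ p ω) (hp : ∑ ω, p ω = 1)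
    (g : Ω → ℝ) (hg : ∀ ω, |g ω| ≤ 2) (hmean : ∑ ω, p ω * g ω = 0) (l : ℝ) :
    ∑ ω, p ω * Real.exp (l * g ω) ≤ Real.exp (2 * l ^ 2) := by
  -- The chord of `exp` between `2l` and `-2l`; for mean zero its average is `cosh (2l)`.
  have hpt : ∀ ω, Real.exp (l * g ω) ≤
      (1 + g ω / 2) / 2 * Real.exp (2 * l) + (1 - g ω / 2) / 2 * Real.exp (-(2 * l)) := by
    intro ω
    have hb := abs_le.1 (hg ω)
    have := convexOn_exp.2 (Set.mem_univ (2 * l)) (Set.mem_univ (-(2 * l)))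
      (show 0 ≤ (1 + g ω / 2) / 2 by linarith) (show 0 ≤ (1 - g ω / 2) / 2 by linarith) (by ring)
    simp only [smul_eq_mul] at this
    refine le_trans (le_of_eq ?_) this
    congr 1; ring
  calc _ ≤ ∑ ω, p ω * ((1 + g ω / 2) / 2 * Real.exp (2 * l) +
        (1 - g ω / 2) / 2 * Real.exp (-(2 * l))) :=
        sum_le_sum fun ω _ => mul_le_mul_of_nonneg_left (hpt ω) (hp0 ω)
    _ = (∑ ω, p ω) * Real.cosh (2 * l) +
        (∑ ω, p ω * g ω) * ((Real.exp (2 * l) - Real.exp (-(2 * l))) / 4) := by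
        rw [sum_mul, sum_mul, ← sum_add_distrib]
        refine sum_congr rfl fun ω _ => ?_
        rw [Real.cosh_eq]; ring
    _ = Real.cosh (2 * l) := by rw [hp, hmean]; ring
    _ ≤ Real.exp ((2 * l) ^ 2 / 2) := Real.cosh_le_exp_half_sq _
    _ = _ := by congr 1; ring

open Classical in
/-- The probability that `f` takes the value `v` when coordinate `j` is `ω`. -/
def condProb {k : ℕ} {Ω V : Type} [Fintype Ω] (p : Fin k → Ω → ℝ) (f : (Fin k → Ω) → V)
    (j : Fin k) (v : V) (ω : Ω) : ℝ :=
  ∑ ζ : Fin k → Ω, (∏ i, p i (ζ i)) * if f (Function.update ζ j ω) = v then 1 else 0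

/-- The average of `condProb`. -/
def avgProb {k : ℕ} {Ω V : Type} [Fintype Ω] (p : Fin k → Ω → ℝ) (f : (Fin k → Ω) → V)
    (j : Fin k) (v : V) : ℝ :=
  ∑ ω, p j ω * condProb p f j v ω

/-- The dependence of `f` on coordinate `j`. -/
def influence {k : ℕ} {Ω V : Type} [Fintype Ω] [Fintype V] (p : Fin k → Ω → ℝ)
    (f : (Fin k → Ω) → V) (j : Fin k) : ℝ :=
  ∑ ω, p j ω * ∑ v, |condProb p f j v ω - avgProb p f j v|

theorem condProb_nonneg {k : ℕ} {Ω V : Type} [Fintype Ω] (p : Fin k → Ω → ℝ)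
    (hp0 : ∀ i ω, 0 ≤ p i ω) (f : (Fin k → Ω) → V) (j : Fin k) (v : V) (ω : Ω) :
    0 ≤ condProb p f j v ω := by
  classical
  refine sum_nonneg fun ζ _ => mul_nonneg (prod_nonneg fun i _ => hp0 _ _) ?_
  split_ifs <;> norm_num

theorem sum_condProb {k : ℕ} {Ω V : Type} [Fintype Ω] [Fintype V] (p : Fin k → Ω → ℝ)
    (hp : ∀ i, ∑ ω, p i ω = 1) (f : (Fin k → Ω) → V) (j : Fin k) (ω : Ω) :
    ∑ v, condProb p f j v ω = 1 := by
  classical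
  unfold condProb
  rw [Finset.sum_comm]
  simp_rw [← mul_sum]
  simp [sum_prod_eq_one p hp]

theorem avgProb_nonneg {k : ℕ} {Ω V : Type} [Fintype Ω] (p : Fin k → Ω → ℝ)
    (hp0 : ∀ i ω, 0 ≤ p i ω) (f : (Fin k → Ω) → V) (j : Fin k) (v : V) :
    0 ≤ avgProb p f j v :=
  sum_nonneg fun ω _ => mul_nonneg (hp0 _ _) (condProb_nonneg p hp0 f j v ω)

theorem sum_avgProb {k : ℕ} {Ω V : Type} [Fintype Ω] [Fintype V] (p : Fin k → Ω → ℝ)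
    (hp : ∀ i, ∑ ω, p i ω = 1) (f : (Fin k → Ω) → V) (j : Fin k) :
    ∑ v, avgProb p f j v = 1 := by
  unfold avgProb
  rw [Finset.sum_comm]
  simp_rw [← mul_sum, sum_condProb p hp]
  simp [hp]

theorem influence_nonneg {k : ℕ} {Ω V : Type} [Fintype Ω] [Fintype V] (p : Fin k → Ω → ℝ)
    (hp0 : ∀ i ω, 0 ≤ p i ω) (f : (Fin k → Ω) → V) (j : Fin k) : 0 ≤ influence p f j :=
  sum_nonneg fun _ _ => mul_nonneg (hp0 _ _) (sum_nonneg fun _ _ => abs_nonneg _)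

theorem influence_le_two {k : ℕ} {Ω V : Type} [Fintype Ω] [Fintype V] (p : Fin k → Ω → ℝ)
    (hp0 : ∀ i ω, 0 ≤ p i ω) (hp : ∀ i, ∑ ω, p i ω = 1) (f : (Fin k → Ω) → V) (j : Fin k) :
    influence p f j ≤ 2 := by
  have : ∀ ω, ∑ v, |condProb p f j v ω - avgProb p f j v| ≤ 2 := by
    intro ω
    calc _ ≤ ∑ v, (condProb p f j v ω + avgProb p f j v) := by
          refine sum_le_sum fun v _ => ?_
          have h1 := condProb_nonneg p hp0 f j v ω
          have h2 := avgProb_nonneg p hp0 f j v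
          rw [abs_le]; constructor <;> linarith
      _ = 2 := by rw [sum_add_distrib, sum_condProb p hp, sum_avgProb p hp]; norm_num
  calc _ ≤ ∑ ω, p j ω * 2 :=
        sum_le_sum fun ω _ => mul_le_mul_of_nonneg_left (this ω) (hp0 _ _)
    _ = 2 := by rw [← sum_mul, hp]; ring

/-- The influence of `j` is the mean of `g j (f ζ) (ζ j)`, where `g` is a centred sign. For a fixed
value `v` the variables `g j v (ζ j)` are independent and centred, so the exponential moment of
their sum is at most `exp (2 l² k)`. Letting `v` be the actual message costs a union over `V`, that
is, `log |V|`. -/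
theorem sum_influence_le {k : ℕ} {Ω V : Type} [Fintype Ω] [Fintype V] [Nonempty V]
    (p : Fin k → Ω → ℝ) (hp0 : ∀ i ω, 0 ≤ p i ω) (hp : ∀ i, ∑ ω, p i ω = 1)
    (f : (Fin k → Ω) → V) (l : ℝ) :
    l * ∑ j, influence p f j ≤ Real.log (Fintype.card V) + 2 * l ^ 2 * k := by
  classical
  let σ : Fin k → V → Ω → ℝ := fun j v ω =>
    if 0 ≤ condProb p f j v ω - avgProb p f j v then 1 else -1
  let σb : Fin k → V → ℝ := fun j v => ∑ ω, p j ω * σ j v ω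
  let g : Fin k → V → Ω → ℝ := fun j v ω => σ j v ω - σb j v
  have hσ : ∀ j v ω, |σ j v ω| ≤ 1 := by
    intro j v ω; simp only [σ]; split_ifs <;> simp
  have hσb : ∀ j v, |σb j v| ≤ 1 := by
    intro j v
    refine (abs_sum_le_sum_abs _ _).trans ?_
    rw [← hp j]
    refine sum_le_sum fun ω _ => ?_
    rw [abs_mul, abs_of_nonneg (hp0 _ _)]
    exact mul_le_of_le_one_right (hp0 _ _) (hσ _ _ _)
  have hg : ∀ j v ω, |g j v ω| ≤ 2 := fun j v ω =>
    (abs_sub _ _).trans (by linarith [hσ j v ω, hσb j v])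
  have hgm : ∀ j v, ∑ ω, p j ω * g j v ω = 0 := by
    intro j v
    simp only [g, mul_sub, sum_sub_distrib]
    rw [← sum_mul, hp, one_mul]
    exact sub_self _
  have hinf : ∀ j, influence p f j = ∑ ζ : Fin k → Ω, (∏ i, p i (ζ i)) * g j (f ζ) (ζ j) := by
    intro j
    rw [sum_prod_update p hp j]
    have e1 : ∀ ω v, |condProb p f j v ω - avgProb p f j v| =
        σ j v ω * (condProb p f j v ω - avgProb p f j v) := by
      intro ω v
      simp only [σ]
      split_ifs with h
      · rw [abs_of_nonneg h, one_mul]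
      · rw [abs_of_neg (not_le.1 h)]; ring
    have e2 : ∀ ω, ∑ ζ : Fin k → Ω, (∏ i, p i (ζ i)) *
        g j (f (Function.update ζ j ω)) (Function.update ζ j ω j) =
        ∑ v, g j v ω * condProb p f j v ω := by
      intro ω
      simp only [Function.update_self, condProb, mul_sum]
      rw [Finset.sum_comm]
      refine sum_congr rfl fun ζ _ => ?_
      simp [mul_comm]
    simp_rw [e2]
    unfold influence
    simp_rw [e1]
    simp only [g, sub_mul, mul_sub, sum_sub_distrib]
    -- Centring the sign and centring `condProb` subtract the same amount: for each `v`, the product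
    -- of the two means.
    have e3 : ∑ ω, p j ω * ∑ v, σ j v ω * avgProb p f j v =
        ∑ ω, p j ω * ∑ v, σb j v * condProb p f j v ω := by
      simp only [mul_sum]
      rw [Finset.sum_comm]
      rw [Finset.sum_comm (s := univ) (t := univ) (f := fun ω v =>
        p j ω * (σb j v * condProb p f j v ω))]
      refine sum_congr rfl fun v _ => ?_
      have a : ∑ ω, p j ω * (σ j v ω * avgProb p f j v) = σb j v * avgProb p f j v := by
        simp only [σb]; rw [sum_mul]
        exact sum_congr rfl fun ω _ => by ring
      have b : ∑ ω, p j ω * (σb j v * condProb p f j v ω) = σb j v * avgProb p f j v := by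
        unfold avgProb; rw [mul_sum]
        exact sum_congr rfl fun ω _ => by ring
      rw [a, b]
    linarith
  have hmgf : ∀ v, ∑ ζ : Fin k → Ω, (∏ i, p i (ζ i)) * Real.exp (l * ∑ j, g j v (ζ j)) ≤
      Real.exp (2 * l ^ 2 * k) := by
    intro v
    have : ∀ ζ : Fin k → Ω, (∏ i, p i (ζ i)) * Real.exp (l * ∑ j, g j v (ζ j)) =
        ∏ i, (p i (ζ i) * Real.exp (l * g i v (ζ i))) := by
      intro ζ
      rw [prod_mul_distrib, mul_sum, Real.exp_sum]
    simp_rw [this]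
    rw [← Fintype.prod_sum (fun i ω => p i ω * Real.exp (l * g i v ω))]
    calc _ ≤ ∏ _i : Fin k, Real.exp (2 * l ^ 2) := by
          refine prod_le_prod (fun i _ => sum_nonneg fun ω _ =>
            mul_nonneg (hp0 _ _) (Real.exp_pos _).le) fun i _ => ?_
          exact sum_exp_le (p i) (hp0 i) (hp i) _ (hg i v) (hgm i v) l
      _ = _ := by
        rw [prod_const, card_univ, Fintype.card_fin, ← Real.exp_nat_mul]; congr 1; ring
  set c : ℝ := Real.log (Fintype.card V) + 2 * l ^ 2 * k with hc
  have hV : (0 : ℝ) < Fintype.card V := by exact_mod_cast Fintype.card_pos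
  -- The tangent bound `x ≤ c - 1 + exp (x - c)`, with the exponential of the actual message bounded
  -- by the sum over all `v`. The constant `c` makes the average of the last term at most one.
  have hpt : ∀ ζ : Fin k → Ω, l * ∑ j, g j (f ζ) (ζ j) ≤
      c - 1 + Real.exp (-c) * ∑ v, Real.exp (l * ∑ j, g j v (ζ j)) := by
    intro ζ
    have h1 := Real.add_one_le_exp (l * ∑ j, g j (f ζ) (ζ j) - c)
    have h2 : Real.exp (l * ∑ j, g j (f ζ) (ζ j)) ≤ ∑ v, Real.exp (l * ∑ j, g j v (ζ j)) :=
      single_le_sum (f := fun v => Real.exp (l * ∑ j, g j v (ζ j)))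
        (fun v _ => (Real.exp_pos _).le) (mem_univ _)
    have h3 : Real.exp (l * ∑ j, g j (f ζ) (ζ j) - c) ≤
        Real.exp (-c) * ∑ v, Real.exp (l * ∑ j, g j v (ζ j)) := by
      rw [sub_eq_add_neg, Real.exp_add, mul_comm]
      gcongr
    linarith
  have hP : ∀ ζ : Fin k → Ω, 0 ≤ ∏ i, p i (ζ i) := fun ζ => prod_nonneg fun i _ => hp0 _ _
  calc l * ∑ j, influence p f j
      = ∑ ζ : Fin k → Ω, (∏ i, p i (ζ i)) * (l * ∑ j, g j (f ζ) (ζ j)) := by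
        simp_rw [hinf]
        rw [Finset.sum_comm, mul_sum]
        refine sum_congr rfl fun ζ _ => ?_
        rw [← mul_sum]; ring
    _ ≤ ∑ ζ : Fin k → Ω, (∏ i, p i (ζ i)) *
        (c - 1 + Real.exp (-c) * ∑ v, Real.exp (l * ∑ j, g j v (ζ j))) :=
        sum_le_sum fun ζ _ => mul_le_mul_of_nonneg_left (hpt ζ) (hP ζ)
    _ = (c - 1) + Real.exp (-c) * ∑ v, ∑ ζ : Fin k → Ω, (∏ i, p i (ζ i)) *
        Real.exp (l * ∑ j, g j v (ζ j)) := by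
        simp only [mul_add, sum_add_distrib]
        rw [← sum_mul, sum_prod_eq_one p hp, one_mul, Finset.sum_comm, mul_sum]
        congr 1
        refine sum_congr rfl fun ζ _ => ?_
        rw [← mul_sum]; ring
    _ ≤ (c - 1) + Real.exp (-c) * ∑ _v : V, Real.exp (2 * l ^ 2 * k) := by
        gcongr with v; exact hmgf v
    _ = c := by
        rw [sum_const, card_univ, nsmul_eq_mul, hc, neg_add, Real.exp_add, Real.exp_neg,
          Real.exp_log hV, Real.exp_neg]
        field_simp; ring

/-- A message from an alphabet with `log |V| ≤ M` has small influence on average. -/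
theorem avg_influence_le {k : ℕ} (hk : 0 < k) {Ω V : Type} [Fintype Ω] [Fintype V] [Nonempty V]
    (p : Fin k → Ω → ℝ) (hp0 : ∀ i ω, 0 ≤ p i ω) (hp : ∀ i, ∑ ω, p i ω = 1)
    (f : (Fin k → Ω) → V) (δ : ℝ) (hδ : 0 < δ) (hV : 8 * Real.log (Fintype.card V) ≤ k * δ ^ 2) :
    (∑ j, influence p f j) / k ≤ δ := by
  -- For `l = δ / 4` both `log |V|` and `2 l² k` are at most `k δ² / 8`, which gives a total
  -- influence of at most `k δ`.
  have h := sum_influence_le p hp0 hp f (δ / 4)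
  have hkR : (0 : ℝ) < k := by exact_mod_cast hk
  rw [div_le_iff₀ hkR]
  nlinarith

/-! ### Functions computed by protocols -/

/-- `F x y` is computed by a protocol of `t` messages in which the owner of the first argument
speaks first. -/
def Realizable (m : ℕ) : ℕ → (X Y : Type) → (X → Y → Bool) → Prop
  | 0, _, _, F => ∃ b, ∀ x y, F x y = b
  | t + 1, X, Y, F => ∃ (msg : X → Message m) (next : Message m → Y → X → Bool),
      (∀ u, Realizable m t Y X (next u)) ∧ ∀ x y, F x y = next (msg x) y x

theorem Realizable.comap {m : ℕ} : ∀ {t : ℕ} {X Y X' Y' : Type} {F : X → Y → Bool}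
    (_ : Realizable m t X Y F) (f : X' → X) (g : Y' → Y),
    Realizable m t X' Y' fun x y => F (f x) (g y)
  | 0, _, _, _, _, _, h, f, g => by
    obtain ⟨b, hb⟩ := h
    exact ⟨b, fun x y => hb _ _⟩
  | t + 1, _, _, _, _, _, h, f, g => by
    obtain ⟨msg, next, hn, hF⟩ := h
    exact ⟨fun x => msg (f x), fun u y x => next u (g y) (f x),
      fun u => (hn u).comap g f, fun x y => hF _ _⟩

theorem Protocol.realizable {X Y : Type} {m t : ℕ} {p : Player} (π : Protocol X Y m p t) :
    (p = Player.alice → Realizable m t X Y fun x y => π.run x y) ∧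
      (p = Player.bob → Realizable m t Y X fun y x => π.run x y) := by
  induction π with
  | output p b => exact ⟨fun _ => ⟨b, fun _ _ => rfl⟩, fun _ => ⟨b, fun _ _ => rfl⟩⟩
  | alice msg next ih =>
    exact ⟨fun _ => ⟨msg, fun u y x => (next u).run x y, fun u => (ih u).2 rfl, fun _ _ => rfl⟩,
      fun h => by cases h⟩
  | bob msg next ih =>
    exact ⟨fun h => (by cases h),
      fun _ => ⟨msg, fun u x y => (next u).run x y, fun u => (ih u).1 rfl, fun _ _ => rfl⟩⟩

/-! ### Derandomization -/

/-- Private randomness can be replaced by the best choice. -/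
theorem exists_best_choice {Ω X Z : Type} [Fintype Ω] [Fintype Z] [Nonempty Z] (x : Ω → X)
    (K H : Ω → Z → ℝ) (hK0 : ∀ ω z, 0 ≤ K ω z) (hK1 : ∀ ω, ∑ z, K ω z ≤ 1)
    (hK : ∀ ω ω', x ω = x ω' → K ω = K ω') (hH : ∀ ω z, 0 ≤ H ω z) :
    ∃ g : X → Z, ∑ ω, ∑ z, K ω z * H ω z ≤ ∑ ω, H ω (g (x ω)) := by
  classical
  have hex : ∀ a : X, ∃ z : Z, ∀ z', ∑ ω ∈ univ.filter (fun ω => x ω = a), H ω z' ≤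
      ∑ ω ∈ univ.filter (fun ω => x ω = a), H ω z := by
    intro a
    obtain ⟨z, _, hz⟩ := exists_max_image (univ : Finset Z)
      (fun z => ∑ ω ∈ univ.filter (fun ω => x ω = a), H ω z) univ_nonempty
    exact ⟨z, fun z' => hz z' (mem_univ _)⟩
  choose g hg using hex
  refine ⟨g, ?_⟩
  have hfib : ∀ φ : Ω → ℝ, ∑ ω, φ ω =
      ∑ a ∈ univ.image x, ∑ ω ∈ univ.filter (fun ω => x ω = a), φ ω := fun φ =>
    (sum_fiberwise_of_maps_to (fun ω _ => mem_image_of_mem x (mem_univ ω)) φ).symm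
  rw [hfib, hfib fun ω => H ω (g (x ω))]
  refine sum_le_sum fun a ha => ?_
  obtain ⟨ω0, _, rfl⟩ := mem_image.1 ha
  have e1 : ∑ ω ∈ univ.filter (fun ω => x ω = x ω0), ∑ z, K ω z * H ω z =
      ∑ z, K ω0 z * ∑ ω ∈ univ.filter (fun ω => x ω = x ω0), H ω z := by
    rw [Finset.sum_comm]
    refine sum_congr rfl fun z _ => ?_
    rw [mul_sum]
    refine sum_congr rfl fun ω hω => ?_
    rw [hK ω ω0 (mem_filter.1 hω).2]
  have e2 : ∑ ω ∈ univ.filter (fun ω => x ω = x ω0), H ω (g (x ω)) =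
      ∑ ω ∈ univ.filter (fun ω => x ω = x ω0), H ω (g (x ω0)) :=
    sum_congr rfl fun ω hω => by rw [(mem_filter.1 hω).2]
  rw [e1, e2]
  calc _ ≤ ∑ z, K ω0 z * ∑ ω ∈ univ.filter (fun ω => x ω = x ω0), H ω (g (x ω0)) :=
        sum_le_sum fun z _ => mul_le_mul_of_nonneg_left (hg _ _) (hK0 _ _)
    _ ≤ _ := by
        rw [← sum_mul]
        exact mul_le_of_le_one_left (sum_nonneg fun _ _ => hH _ _) (hK1 _)

/-! ### Conditioning on the input of the other player -/

open Classical in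
/-- The weight `w` conditioned on the fibre of `y` through `η`. -/
def fiberKernel {Ω Y : Type} [Fintype Ω] (w : Ω → ℝ) (y : Ω → Y) (η ω : Ω) : ℝ :=
  if y ω = y η then w ω / ∑ ω', (if y ω' = y η then w ω' else 0) else 0

open Classical in
theorem sum_fiber_pos {Ω Y : Type} [Fintype Ω] {w : Ω → ℝ} (hw : ∀ ω, 0 < w ω) (y : Ω → Y)
    (η : Ω) : 0 < ∑ ω', (if y ω' = y η then w ω' else 0) := by
  refine lt_of_lt_of_le (hw η) ?_
  have := single_le_sum (s := univ) (f := fun ω' => if y ω' = y η then w ω' else 0)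
    (fun ω _ => by split_ifs; exacts [(hw _).le, le_rfl]) (mem_univ η)
  simpa using this

theorem fiberKernel_nonneg {Ω Y : Type} [Fintype Ω] {w : Ω → ℝ} (hw : ∀ ω, 0 < w ω) (y : Ω → Y)
    (η ω : Ω) : 0 ≤ fiberKernel w y η ω := by
  classical
  unfold fiberKernel
  split_ifs
  exacts [div_nonneg (hw _).le (sum_fiber_pos hw y η).le, le_rfl]

theorem sum_fiberKernel {Ω Y : Type} [Fintype Ω] {w : Ω → ℝ} (hw : ∀ ω, 0 < w ω) (y : Ω → Y)
    (η : Ω) : ∑ ω, fiberKernel w y η ω = 1 := by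
  classical
  have h := sum_fiber_pos hw y η
  have : ∀ ω, fiberKernel w y η ω = (if y ω = y η then w ω else 0) /
      ∑ ω', (if y ω' = y η then w ω' else 0) := by
    intro ω; unfold fiberKernel; split_ifs <;> simp
  simp_rw [this]
  rw [← sum_div, div_self h.ne']

/-- Detailed balance: within a common fibre both sides are `w η * w ω` divided by the mass of that
fibre. A sample and its resampling given the listener's input can thus be exchanged. -/
theorem fiberKernel_reversible {Ω Y : Type} [Fintype Ω] (w : Ω → ℝ) (y : Ω → Y)
    (η ω : Ω) : w η * fiberKernel w y η ω = w ω * fiberKernel w y ω η := by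
  classical
  unfold fiberKernel
  by_cases h : y ω = y η
  · rw [if_pos h, if_pos h.symm, h]; ring
  · rw [if_neg h, if_neg (Ne.symm h)]; ring

theorem fiberKernel_congr {Ω Y : Type} [Fintype Ω] (w : Ω → ℝ) (y : Ω → Y) {η η' : Ω}
    (h : y η = y η') : fiberKernel w y η = fiberKernel w y η' := by
  ext ω; unfold fiberKernel; rw [h]

theorem fiberKernel_ne_zero {Ω Y : Type} [Fintype Ω] {w : Ω → ℝ} {y : Ω → Y} {η ω : Ω}
    (h : fiberKernel w y η ω ≠ 0) : y ω = y η := by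
  by_contra hne
  exact h (by simp [fiberKernel, hne])

/-! ### Eliminating a message about independent blocks. -/

section Elimination

variable {m k t : ℕ} {Ω V X Y : Type} [Fintype Ω] [Fintype V]

/-- The weights of the blocks conditioned on the listener's inputs in `η`. -/
def blockKernel (w : Ω → ℝ) (y : Fin k → Ω → Y) (η : Fin k → Ω) (i : Fin k) (ω : Ω) : ℝ :=
  fiberKernel w (y i) (η i) ω

/-- Resampling every block given the listener's input preserves the product law, by reversibility.
The base point `η` then serves only to fix the listener's inputs, given which the blocks remain
independent. -/
theorem sum_prod_blockKernel (w : Ω → ℝ) (hw : ∀ ω, 0 < w ω) (y : Fin k → Ω → Y)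
    (φ : (Fin k → Ω) → ℝ) :
    ∑ ζ : Fin k → Ω, (∏ i, w (ζ i)) * φ ζ =
      ∑ η : Fin k → Ω, (∏ i, w (η i)) *
        ∑ ζ : Fin k → Ω, (∏ i, blockKernel w y η i (ζ i)) * φ ζ := by
  have hrev : ∀ η ζ : Fin k → Ω, (∏ i, w (η i)) * ∏ i, blockKernel w y η i (ζ i) =
      (∏ i, w (ζ i)) * ∏ i, blockKernel w y ζ i (η i) := by
    intro η ζ
    rw [← prod_mul_distrib, ← prod_mul_distrib]
    exact prod_congr rfl fun i _ => fiberKernel_reversible w (y i) _ _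
  have hone : ∀ ζ, ∑ η : Fin k → Ω, ∏ i, blockKernel w y ζ i (η i) = 1 := fun ζ =>
    sum_prod_eq_one _ fun i => sum_fiberKernel hw (y i) (ζ i)
  symm
  calc _ = ∑ η : Fin k → Ω, ∑ ζ : Fin k → Ω,
        (∏ i, w (ζ i)) * (∏ i, blockKernel w y ζ i (η i)) * φ ζ := by
        refine sum_congr rfl fun η _ => ?_
        rw [mul_sum]
        exact sum_congr rfl fun ζ _ => by rw [← mul_assoc, hrev]
    _ = _ := by
        rw [Finset.sum_comm]
        refine sum_congr rfl fun ζ _ => ?_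
        rw [← sum_mul, ← mul_sum, hone, mul_one]

open Classical in
/-- Elimination of the first message of a protocol for `k` independent blocks, when the answer
is that of block `j`: the listener of the first message can sample it given the own input, at
the cost of the influence of the block on the message. -/
theorem eliminate_block (w : Ω → ℝ) (hw : ∀ ω, 0 < w ω) (hw1 : ∑ ω, w ω = 1)
    (x : Fin k → Ω → X) (y : Fin k → Ω → Y) (b : Ω → Bool)
    (f : (Fin k → X) → V) (N : V → (Fin k → Y) → (Fin k → X) → Bool)
    (hN : ∀ v, Realizable m (t + 1) (Fin k → Y) (Fin k → X) (N v)) (j : Fin k) (B : ℝ)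
    (hB : ∀ (msg' : Y → V × Message m) (next' : V × Message m → X → Y → Bool),
      (∀ u, Realizable m t X Y (next' u)) →
      ∑ ω, w ω * (if next' (msg' (y j ω)) (x j ω) (y j ω) = b ω then 1 else 0) ≤ B) :
    ∑ ζ : Fin k → Ω, (∏ i, w (ζ i)) *
      (if N (f fun i => x i (ζ i)) (fun i => y i (ζ i)) (fun i => x i (ζ i)) = b (ζ j)
        then 1 else 0) ≤
    B + ∑ η : Fin k → Ω, (∏ i, w (η i)) *
      influence (blockKernel w y η) (fun ζ => f fun i => x i (ζ i)) j := by
  let p := blockKernel w y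
  have hp0 : ∀ η i ω, 0 ≤ p η i ω := fun η i ω => fiberKernel_nonneg hw _ _ _
  have hp1 : ∀ η i, ∑ ω, p η i ω = 1 := fun η i => sum_fiberKernel hw _ _
  let P : (Fin k → Ω) → (Fin k → Ω) → ℝ := fun η ζ => ∏ i, p η i (ζ i)
  have hP0 : ∀ η ζ, 0 ≤ P η ζ := fun η ζ => prod_nonneg fun i _ => hp0 _ _ _
  let f' : (Fin k → Ω) → V := fun ζ => f fun i => x i (ζ i)
  -- Success of the continuation after message `v`, when block `j` is `ω`, the listener's other
  -- blocks come from `η` and the speaker's other blocks from `ζ`.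
  let ψ : (Fin k → Ω) → Ω → (Fin k → Ω) → V → ℝ := fun η ω ζ v =>
    if N v (Function.update (fun i => y i (η i)) j (y j ω))
      (fun i => x i (Function.update ζ j ω i)) = b ω then 1 else 0
  have hψ0 : ∀ η ω ζ v, 0 ≤ ψ η ω ζ v := by
    intro η ω ζ v; simp only [ψ]; split_ifs <;> norm_num
  have hψ1 : ∀ η ω ζ v, ψ η ω ζ v ≤ 1 := by
    intro η ω ζ v; simp only [ψ]; split_ifs <;> norm_num
  have hψu : ∀ η ω ζ v, ψ η ω (Function.update ζ j ω) v = ψ η ω ζ v := by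
    intro η ω ζ v; simp only [ψ, Function.update_idem]
  -- `q` is the law of the message given block `j`. Its average `qb` depends on `η` only through the
  -- listener's inputs, so the listener can sample from it.
  let q : (Fin k → Ω) → V → Ω → ℝ := fun η v ω => condProb (p η) f' j v ω
  let qb : (Fin k → Ω) → V → ℝ := fun η v => avgProb (p η) f' j v
  have hq0 : ∀ η v ω, 0 ≤ q η v ω := fun η v ω => condProb_nonneg _ (hp0 η) _ _ _ _
  have hqb0 : ∀ η v, 0 ≤ qb η v := fun η v => avgProb_nonneg _ (hp0 η) _ _ _
  let ind : Ω → (Fin k → Ω) → V → ℝ := fun ω ζ v =>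
    if f' (Function.update ζ j ω) = v then 1 else 0
  have hind0 : ∀ ω ζ v, 0 ≤ ind ω ζ v := by
    intro ω ζ v; simp only [ind]; split_ifs <;> norm_num
  have hq : ∀ η v ω, q η v ω = ∑ ζ, P η ζ * ind ω ζ v := fun _ _ _ => rfl
  -- The conditional probability of success given the message and block `j`. Where `q` vanishes so
  -- does the numerator, and the default value `0` of the quotient does no harm.
  let R0 : (Fin k → Ω) → V → Ω → ℝ := fun η v ω =>
    (∑ ζ, P η ζ * (ind ω ζ v * ψ η ω ζ v)) / q η v ω
  have hnum : ∀ η v ω, ∑ ζ, P η ζ * (ind ω ζ v * ψ η ω ζ v) ≤ q η v ω := by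
    intro η v ω
    rw [hq]
    refine sum_le_sum fun ζ _ => mul_le_mul_of_nonneg_left ?_ (hP0 _ _)
    exact mul_le_of_le_one_right (hind0 _ _ _) (hψ1 _ _ _ _)
  have hnum0 : ∀ η v ω, 0 ≤ ∑ ζ, P η ζ * (ind ω ζ v * ψ η ω ζ v) := fun η v ω =>
    sum_nonneg fun ζ _ => mul_nonneg (hP0 _ _) (mul_nonneg (hind0 _ _ _) (hψ0 _ _ _ _))
  have hR0 : ∀ η v ω, 0 ≤ R0 η v ω := fun η v ω => div_nonneg (hnum0 _ _ _) (hq0 _ _ _)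
  have hR1 : ∀ η v ω, R0 η v ω ≤ 1 := fun η v ω => div_le_one_of_le₀ (hnum _ _ _) (hq0 _ _ _)
  have hqR : ∀ η v ω, ∑ ζ, P η ζ * (ind ω ζ v * ψ η ω ζ v) = q η v ω * R0 η v ω := by
    intro η v ω
    rcases (hq0 η v ω).eq_or_lt with h | h
    · have := le_antisymm (h ▸ hnum η v ω) (hnum0 η v ω)
      rw [this, ← h, zero_mul]
    · rw [mul_div_cancel₀ _ h.ne']
  -- first, condition on the inputs of the listener
  have hη : ∀ η : Fin k → Ω, ∑ ζ, P η ζ *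
      (if N (f fun i => x i (ζ i)) (fun i => y i (ζ i)) (fun i => x i (ζ i)) = b (ζ j)
        then 1 else 0) ≤
      ∑ ω, p η j ω * ∑ v, qb η v * R0 η v ω + influence (p η) f' j := by
    intro η
    have e1 : ∑ ζ, P η ζ *
      (if N (f fun i => x i (ζ i)) (fun i => y i (ζ i)) (fun i => x i (ζ i)) = b (ζ j)
        then 1 else 0) = ∑ ζ, P η ζ * ∑ v, (if f' ζ = v then 1 else 0) * ψ η (ζ j) ζ v := by
      refine sum_congr rfl fun ζ _ => ?_
      by_cases hz : P η ζ = 0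
      · rw [hz]; simp
      congr 1
      have hy : ∀ i, y i (ζ i) = y i (η i) := fun i =>
        fiberKernel_ne_zero (prod_ne_zero_iff.1 hz i (mem_univ i))
      simp only [ite_mul, one_mul, zero_mul, sum_ite_eq, mem_univ, if_true, ψ,
        Function.update_eq_self]
      have : Function.update (fun i => y i (η i)) j (y j (ζ j)) = fun i => y i (ζ i) := by
        ext i
        by_cases hi : i = j
        · subst hi; simp
        · simp [hi, hy]
      rw [this]
    have e2 : ∑ ζ, P η ζ * ∑ v, (if f' ζ = v then 1 else 0) * ψ η (ζ j) ζ v =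
        ∑ ω, p η j ω * ∑ v, q η v ω * R0 η v ω := by
      rw [sum_prod_update (p η) (hp1 η) j]
      refine sum_congr rfl fun ω _ => ?_
      congr 1
      simp_rw [mul_sum]
      rw [Finset.sum_comm]
      refine sum_congr rfl fun v _ => ?_
      rw [← hqR]
      refine sum_congr rfl fun ζ _ => ?_
      rw [Function.update_self, hψu]
    rw [e1, e2]
    unfold influence
    rw [← sum_add_distrib]
    refine sum_le_sum fun ω _ => ?_
    rw [← mul_add, ← sum_add_distrib]
    refine mul_le_mul_of_nonneg_left (sum_le_sum fun v _ => ?_) (hp0 _ _ _)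
    change q η v ω * R0 η v ω ≤ qb η v * R0 η v ω + |q η v ω - qb η v|
    -- As `R0` lies in `[0, 1]`, replacing the true law of the message by `qb` costs exactly the
    -- terms that make up the influence.
    have h1 : (q η v ω - qb η v) * R0 η v ω ≤ |q η v ω - qb η v| :=
      (mul_le_mul_of_nonneg_right (le_abs_self _) (hR0 _ _ _)).trans
        (mul_le_of_le_one_right (abs_nonneg _) (hR1 _ _ _))
    linarith
  -- the dependence on coordinate `j` of the base point
  have hpy : ∀ η η' : Fin k → Ω, (∀ i, y i (η i) = y i (η' i)) → p η = p η' := by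
    intro η η' h; ext i ω
    exact congrFun (fiberKernel_congr w (y i) (h i)) ω
  have hqbu : ∀ η ω ω' v, y j ω = y j ω' →
      qb (Function.update η j ω) v = qb (Function.update η j ω') v := by
    intro η ω ω' v h
    have : p (Function.update η j ω) = p (Function.update η j ω') := by
      apply hpy; intro i
      by_cases hi : i = j
      · subst hi; simpa using h
      · simp [hi]
    simp only [qb, this]
  have hψη : ∀ η τ ω ζ v, ψ (Function.update η j τ) ω ζ v = ψ η ω ζ v := by
    intro η τ ω ζ v
    simp only [ψ]
    have : Function.update (fun i => y i (Function.update η j τ i)) j (y j ω) =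
        Function.update (fun i => y i (η i)) j (y j ω) := by
      ext i
      by_cases hi : i = j
      · subst hi; simp
      · simp [hi]
    rw [this]
  have hoff : ∀ η τ i, i ≠ j → p (Function.update η j τ) i = p η i := by
    intro η τ i hi; ext ω; simp [p, blockKernel, hi]
  have hindu : ∀ ω ζ v, ind ω (Function.update ζ j ω) v = ind ω ζ v := by
    intro ω ζ v; simp only [ind, Function.update_idem]
  have hqu : ∀ η τ v ω, q (Function.update η j τ) v ω = q η v ω := by
    intro η τ v ω
    have := sum_prod_update_congr (p (Function.update η j τ)) (p η) j (hp1 _ _) (hp1 _ _)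
      (hoff η τ) (fun ζ => ind ω ζ v) ω
    simp only [hindu] at this
    exact this
  have hR0u : ∀ η τ v ω, R0 (Function.update η j τ) v ω = R0 η v ω := by
    intro η τ v ω
    have := sum_prod_update_congr (p (Function.update η j τ)) (p η) j (hp1 _ _) (hp1 _ _)
      (hoff η τ) (fun ζ => ind ω ζ v * ψ η ω ζ v) ω
    simp only [hindu, hψu] at this
    simp only [R0, hqu, hψη]
    congr 1
  -- second, average the input of the listener in block `j`
  have hswap : ∑ η : Fin k → Ω, (∏ i, w (η i)) * ∑ ω, p η j ω * ∑ v, qb η v * R0 η v ω =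
      ∑ η : Fin k → Ω, (∏ i, w (η i)) * ∑ ω, w ω *
        ∑ v, qb (Function.update η j ω) v * R0 η v ω := by
    rw [sum_prod_update (fun _ => w) (fun _ => hw1) j]
    simp_rw [mul_sum (s := (univ : Finset (Fin k → Ω)))]
    rw [Finset.sum_comm]
    refine sum_congr rfl fun η _ => ?_
    have e1 : ∀ τ ω, p (Function.update η j τ) j ω = fiberKernel w (y j) τ ω := by
      intro τ ω; simp [p, blockKernel]
    simp_rw [e1, hR0u]
    calc _ = (∏ i, w (η i)) * ∑ τ, ∑ ω, (w τ * fiberKernel w (y j) τ ω) *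
          ∑ v, qb (Function.update η j τ) v * R0 η v ω := by
          rw [mul_sum]
          refine sum_congr rfl fun τ _ => ?_
          rw [mul_left_comm]
          congr 1
          rw [mul_sum]
          exact sum_congr rfl fun ω _ => by ring
      _ = (∏ i, w (η i)) * ∑ τ, ∑ ω, (w ω * fiberKernel w (y j) ω τ) *
          ∑ v, qb (Function.update η j ω) v * R0 η v ω := by
          congr 1
          refine sum_congr rfl fun τ _ => sum_congr rfl fun ω _ => ?_
          -- Exchanging the base point `τ` of block `j` with the sample `ω` gives `ω` its
          -- unconditional law, and `τ` can be summed out. `qb` does not notice, since `τ` and `ω`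
          -- agree for the listener.
          rw [fiberKernel_reversible]
          by_cases hz : fiberKernel w (y j) ω τ = 0
          · simp [hz]
          · have hyy := fiberKernel_ne_zero hz
            congr 1
            exact sum_congr rfl fun v _ => by rw [hqbu η τ ω v hyy]
      _ = _ := by
          congr 1
          rw [Finset.sum_comm]
          refine sum_congr rfl fun ω _ => ?_
          rw [← sum_mul, ← mul_sum, sum_fiberKernel hw, mul_one]
  -- third, derandomize
  have hder : ∀ η : Fin k → Ω, ∑ ω, w ω * ∑ v, qb (Function.update η j ω) v * R0 η v ω ≤ B := by
    intro η
    have : Nonempty (Fin k → Ω) := ⟨η⟩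
    have : Nonempty V := ⟨f' η⟩
    let xx : (Fin k → Ω) → X → Fin k → X := fun ζ a => Function.update (fun i => x i (ζ i)) j a
    have hxx : ∀ ζ ω, xx ζ (x j ω) = fun i => x i (Function.update ζ j ω i) := by
      intro ζ ω; ext i
      by_cases hi : i = j
      · subst hi; simp [xx]
      · simp [xx, hi]
    have hind : ∀ ω ζ v, ind ω ζ v = if f (xx ζ (x j ω)) = v then 1 else 0 := by
      intro ω ζ v; rw [hxx]
    -- The posterior law of the other blocks given the message `v`. It depends on `ω` only through
    -- the speaker's input `x j ω`, so the speaker can sample from it.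
    let K : V → Ω → (Fin k → Ω) → ℝ := fun v ω ζ => P η ζ * ind ω ζ v / q η v ω
    have hKx : ∀ v ω ω', x j ω = x j ω' → K v ω = K v ω' := by
      intro v ω ω' h
      have h1 : ∀ ζ, ind ω ζ v = ind ω' ζ v := by intro ζ; rw [hind, hind, h]
      ext ζ
      simp only [K, hq, h1]
    have hK0 : ∀ v ω ζ, 0 ≤ K v ω ζ := fun v ω ζ =>
      div_nonneg (mul_nonneg (hP0 _ _) (hind0 _ _ _)) (hq0 _ _ _)
    have hK1 : ∀ v ω, ∑ ζ, K v ω ζ ≤ 1 := by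
      intro v ω
      simp only [K]
      rw [← sum_div, ← hq]
      exact div_self_le_one _
    have hRK : ∀ v ω, R0 η v ω = ∑ ζ, K v ω ζ * ψ η ω ζ v := by
      intro v ω
      simp only [R0, K]
      rw [sum_div]
      exact sum_congr rfl fun ζ _ => by ring
    have hg : ∀ v, ∃ g : X → (Fin k → Ω),
        ∑ ω, ∑ ζ, K v ω ζ * (w ω * qb (Function.update η j ω) v * ψ η ω ζ v) ≤
        ∑ ω, w ω * qb (Function.update η j ω) v * ψ η ω (g (x j ω)) v := fun v =>
      exists_best_choice (x j) (K v)
        (fun ω ζ => w ω * qb (Function.update η j ω) v * ψ η ω ζ v) (hK0 v) (hK1 v)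
        (hKx v) fun ω ζ => mul_nonneg (mul_nonneg (hw _).le (hqb0 _ _)) (hψ0 _ _ _ _)
    choose g hg using hg
    obtain ⟨h, hh⟩ := exists_best_choice (y j) (fun ω v => qb (Function.update η j ω) v)
      (fun ω v => w ω * ψ η ω (g v (x j ω)) v) (fun ω v => hqb0 _ _)
      (fun ω => (sum_avgProb _ (hp1 _) _ _).le)
      (fun ω ω' hyy => by ext v; exact hqbu η ω ω' v hyy)
      (fun ω v => mul_nonneg (hw _).le (hψ0 _ _ _ _))
    choose msg next hnext hNv using fun v => hN v
    -- The new protocol: `h` picks the eliminated message from the listener's input, and it is sent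
    -- together with the listener's own first message. The speaker then completes the input to `k`
    -- blocks by `g`; the listener's other blocks are fixed by `η`.
    have hfin := hB
      (fun a => (h a, msg (h a) (Function.update (fun i => y i (η i)) j a)))
      (fun u a c => next u.1 u.2 (xx (g u.1 a) a) (Function.update (fun i => y i (η i)) j c))
      (fun u => (hnext u.1 u.2).comap (fun a => xx (g u.1 a) a)
        fun c => Function.update (fun i => y i (η i)) j c)
    refine le_trans ?_ hfin
    calc _ = ∑ v, ∑ ω, ∑ ζ, K v ω ζ * (w ω * qb (Function.update η j ω) v * ψ η ω ζ v) := by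
          rw [Finset.sum_comm]
          refine sum_congr rfl fun ω _ => ?_
          rw [mul_sum]
          refine sum_congr rfl fun v _ => ?_
          rw [hRK, mul_sum, mul_sum]
          exact sum_congr rfl fun ζ _ => by ring
      _ ≤ ∑ v, ∑ ω, w ω * qb (Function.update η j ω) v * ψ η ω (g v (x j ω)) v :=
          sum_le_sum fun v _ => hg v
      _ = ∑ ω, ∑ v, qb (Function.update η j ω) v * (w ω * ψ η ω (g v (x j ω)) v) := by
          rw [Finset.sum_comm]
          exact sum_congr rfl fun ω _ => sum_congr rfl fun v _ => by ring
      _ ≤ _ := hh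
      _ = _ := by
          refine sum_congr rfl fun ω _ => ?_
          congr 1
          simp only [ψ]
          rw [hNv, hxx]
  rw [sum_prod_blockKernel w hw y]
  calc _ ≤ ∑ η : Fin k → Ω, (∏ i, w (η i)) *
        (∑ ω, p η j ω * ∑ v, qb η v * R0 η v ω + influence (p η) f' j) :=
        sum_le_sum fun η _ => mul_le_mul_of_nonneg_left (hη η) (prod_nonneg fun i _ => (hw _).le)
    _ = ∑ η : Fin k → Ω, (∏ i, w (η i)) * ∑ ω, w ω *
        ∑ v, qb (Function.update η j ω) v * R0 η v ω +
        ∑ η : Fin k → Ω, (∏ i, w (η i)) * influence (p η) f' j := by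
        simp_rw [mul_add]
        rw [sum_add_distrib, hswap]
    _ ≤ ∑ η : Fin k → Ω, (∏ i, w (η i)) * B +
        ∑ η : Fin k → Ω, (∏ i, w (η i)) * influence (p η) f' j := by
        gcongr with η
        · exact prod_nonneg fun i _ => (hw _).le
        · exact hder η
    _ = _ := by rw [← sum_mul, sum_prod_eq_one (fun _ => w) fun _ => hw1, one_mul]

end Elimination

/-! ### Probabilities of events under finitely supported laws -/

/-- The probability of an event, as a real number. -/
def prob {α : Type} (p : PMF α) (s : Set α) : ℝ := (p.toOuterMeasure s).toReal

theorem toOuterMeasure_le_one {α : Type} (p : PMF α) (s : Set α) : p.toOuterMeasure s ≤ 1 := by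
  rw [PMF.toOuterMeasure_apply, ← p.tsum_coe]
  exact ENNReal.tsum_le_tsum fun a => Set.indicator_le_self _ _ _

theorem prob_le_one {α : Type} (p : PMF α) (s : Set α) : prob p s ≤ 1 :=
  ENNReal.toReal_le_of_le_ofReal zero_le_one (by simpa using toOuterMeasure_le_one p s)

theorem prob_compl {α : Type} (p : PMF α) (s : Set α) : prob p sᶜ = 1 - prob p s := by
  have h : p.toOuterMeasure s + p.toOuterMeasure sᶜ = 1 := by
    rw [PMF.toOuterMeasure_apply, PMF.toOuterMeasure_apply, ← ENNReal.tsum_add, ← p.tsum_coe]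
    refine tsum_congr fun a => ?_
    exact congrFun (Set.indicator_self_add_compl s p) a
  have h1 : ∀ t, p.toOuterMeasure t ≠ ⊤ := fun t =>
    ne_top_of_le_ne_top ENNReal.one_ne_top (toOuterMeasure_le_one p t)
  have := congrArg ENNReal.toReal h
  rw [ENNReal.toReal_add (h1 _) (h1 _), ENNReal.toReal_one] at this
  unfold prob; linarith

theorem prob_map {α β : Type} (p : PMF α) (f : α → β) (s : Set β) :
    prob (p.map f) s = prob p (f ⁻¹' s) := by
  unfold prob; rw [PMF.toOuterMeasure_map_apply]

theorem prob_bind {α β : Type} (p : PMF α) (t : Finset α) (ht : ∀ a ∉ t, p a = 0)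
    (q : α → PMF β) (s : Set β) :
    prob (p.bind q) s = ∑ a ∈ t, (p a).toReal * prob (q a) s := by
  unfold prob
  rw [PMF.toOuterMeasure_bind_apply, tsum_eq_sum (s := t) (fun a ha => by simp [ht a ha]),
    ENNReal.toReal_sum]
  · simp [ENNReal.toReal_mul]
  · intro a _
    exact ENNReal.mul_ne_top (p.apply_ne_top a)
      (ne_top_of_le_ne_top ENNReal.one_ne_top (toOuterMeasure_le_one _ _))

theorem prob_bind_uniform {α β : Type} (t : Finset α) (ht : t.Nonempty)
    (q : α → PMF β) (s : Set β) :
    prob ((PMF.uniformOfFinset t ht).bind q) s = (∑ a ∈ t, prob (q a) s) / t.card := by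
  rw [prob_bind _ t fun a ha => PMF.uniformOfFinset_apply_of_notMem ht ha, sum_div]
  refine sum_congr rfl fun a ha => ?_
  rw [PMF.uniformOfFinset_apply_of_mem ht ha, ENNReal.toReal_inv, ENNReal.toReal_natCast]
  ring

theorem prob_pure {α : Type} (a : α) (s : Set α) [Decidable (a ∈ s)] :
    prob (PMF.pure a) s = if a ∈ s then 1 else 0 := by
  unfold prob
  rw [PMF.toOuterMeasure_pure_apply]
  split_ifs <;> simp

/-- Summing over the support of a finitely supported law. -/
theorem prob_bind_support {α β : Type} (p : PMF α) [Fintype p.support]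
    (q : α → PMF β) (s : Set β) :
    prob (p.bind q) s = ∑ a : p.support, (p a).toReal * prob (q a) s := by
  classical
  rw [prob_bind p p.support.toFinset (fun a ha => by
    simpa [PMF.mem_support_iff] using ha)]
  rw [← Finset.sum_coe_sort]
  refine Fintype.sum_equiv (Equiv.subtypeEquivRight fun a => Set.mem_toFinset) _ _ fun a => rfl

open Classical in
theorem prob_eq_sum_support {α : Type} (p : PMF α) [Fintype p.support] (s : Set α) :
    prob p s = ∑ a : p.support, (p a).toReal * if (a : α) ∈ s then 1 else 0 := by
  have := prob_bind_support p PMF.pure s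
  rw [PMF.bind_pure] at this
  simpa only [prob_pure] using this

theorem prob_pred {α : Type} (p : PMF α) [Fintype p.support] (P : α → Prop) [DecidablePred P] :
    prob p {a | P a} = ∑ a : p.support, (p a).toReal * if P a then 1 else 0 := by
  obtain ⟨s, hs⟩ : ∃ s : Set α, s = {a | P a} := ⟨_, rfl⟩
  rw [← hs, prob_eq_sum_support]
  refine sum_congr rfl fun a _ => ?_
  congr 1
  simp only [hs]
  rfl

theorem sum_support {α : Type} (p : PMF α) [Fintype p.support] :
    ∑ a : p.support, (p a).toReal = 1 := by
  classical
  have h := prob_eq_sum_support p Set.univ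
  have h0 : prob p Set.univ = 1 := by
    have := prob_compl p ∅
    rw [Set.compl_empty] at this
    rw [this]; simp [prob]
  rw [h0] at h
  simpa using h.symm

theorem support_toReal_pos {α : Type} (p : PMF α) (a : p.support) : 0 < (p a).toReal :=
  ENNReal.toReal_pos ((PMF.mem_support_iff p a).1 a.2) (p.apply_ne_top a)

open Classical in
theorem prob_iid {α : Type} (p : PMF α) [Fintype p.support] : ∀ (k : ℕ) (s : Set (Fin k → α)),
    prob (iid p k) s = ∑ ζ : Fin k → p.support, (∏ i, (p (ζ i)).toReal) *
      if (fun i => (ζ i : α)) ∈ s then 1 else 0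
  | 0, s => by
    have h : ∀ ζ : Fin 0 → p.support, (fun i : Fin 0 => (ζ i : α)) = Fin.elim0 :=
      fun ζ => Subsingleton.elim _ _
    rw [iid, prob_pure]
    simp_rw [h]
    simp
  | k + 1, s => by
    rw [iid, prob_bind_support]
    rw [← (Fin.consEquiv fun _ : Fin (k + 1) => p.support).sum_comp, Fintype.sum_prod_type]
    refine sum_congr rfl fun a _ => ?_
    rw [prob_map, prob_iid p k, mul_sum]
    refine sum_congr rfl fun ζ _ => ?_
    rw [← mul_assoc]
    congr 1
    · rw [Fin.prod_univ_succ]; simp [Fin.consEquiv]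
    · congr 1
      rw [Set.mem_preimage, eq_iff_iff]
      refine iff_of_eq (congrArg (· ∈ s) ?_)
      ext i
      refine Fin.cases ?_ (fun i => ?_) i <;> simp [Fin.consEquiv]

theorem mem_support_iid {α : Type} (p : PMF α) : ∀ (k : ℕ) (v : Fin k → α),
    v ∈ (iid p k).support → ∀ i, v i ∈ p.support
  | 0, _, _, i => i.elim0
  | k + 1, v, h, i => by
    rw [iid, PMF.mem_support_bind_iff] at h
    obtain ⟨a, ha, h⟩ := h
    rw [PMF.mem_support_map_iff] at h
    obtain ⟨u, hu, rfl⟩ := h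
    refine Fin.cases ?_ (fun i => ?_) i
    · simpa using ha
    · simpa using mem_support_iid p k u hu i

/-! ### The shape of the hard instances -/

section Shape

variable {m n₀ n : ℕ}

/-- The offset of block `i` of the core. -/
def blockShift (m n₀ n i : ℕ) : ℕ := n - coreSize m n₀ n + 2 * subSize m n₀ n * i

/-- The set determined by the shell set `S` and the blocks `B`. -/
def assemble (m n₀ n : ℕ) (S : Finset ℕ) (B : Fin (branching m n₀) → Finset ℕ) : Finset ℕ :=
  S ∪ (Icc 1 (n - coreSize m n₀ n) \ S).image (fun i => 2 * n + 1 - i) ∪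
    univ.biUnion fun i : Fin (branching m n₀) =>
      (B i).image fun a => blockShift m n₀ n i + a

theorem Recurses.branching_pos (h : Recurses m n₀ n) : 0 < branching m n₀ := h.1

theorem hardDist_of_recurses (h : Recurses m n₀ n) : hardDist m n₀ n =
    (PMF.uniformOfFinset (Finset.range (branching m n₀))
        (nonempty_range_iff.2 h.branching_pos.ne')).bind fun j =>
      (PMF.uniformOfFinset
          (Finset.powersetCard (lowCount m n₀ n j) (Finset.Icc 1 (n - coreSize m n₀ n)))
          (lowSets_nonempty m n₀ n j)).bind fun S =>
        (iid (hardDist m n₀ (subSize m n₀ n)) (branching m n₀)).map (assemble m n₀ n S) := by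
  rw [hardDist, dif_pos h]
  rfl

theorem blockShift_add_le (i : Fin (branching m n₀)) {a : ℕ} (ha : a ≤ 2 * subSize m n₀ n) :
    blockShift m n₀ n i + a ≤ n + coreSize m n₀ n := by
  have h1 := coreSize_le m n₀ n
  have h2 : subSize m n₀ n * (i + 1) ≤ coreSize m n₀ n := by
    unfold coreSize; rw [mul_comm]; exact Nat.mul_le_mul_right _ i.2
  unfold blockShift
  nlinarith [Nat.sub_add_cancel (show coreSize m n₀ n ≤ n by omega)]

theorem blockShift_lt {i j a : ℕ} (hij : i < j) (ha : a ≤ 2 * subSize m n₀ n) :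
    blockShift m n₀ n i + a ≤ blockShift m n₀ n j := by
  have : subSize m n₀ n * (i + 1) ≤ subSize m n₀ n * j := Nat.mul_le_mul_left _ hij
  unfold blockShift
  nlinarith

/-- Counting the elements of an assembled set with some property. -/
theorem card_assemble_filter {S : Finset ℕ} {B : Fin (branching m n₀) → Finset ℕ}
    (hS : S ⊆ Icc 1 (n - coreSize m n₀ n))
    (hB : ∀ i, B i ⊆ Icc 1 (2 * subSize m n₀ n)) (q : ℕ → Prop)
    [DecidablePred q] :
    ((assemble m n₀ n S B).filter q).card = (S.filter q).card +
      ((Icc 1 (n - coreSize m n₀ n) \ S).filter fun i => q (2 * n + 1 - i)).card +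
      ∑ i, ((B i).filter fun a => q (blockShift m n₀ n i + a)).card := by
  have hle := coreSize_le m n₀ n
  unfold assemble
  rw [filter_union, filter_union, card_union_of_disjoint, card_union_of_disjoint, filter_biUnion,
    card_biUnion]
  · congr 1
    · congr 1
      rw [filter_image, card_image_of_injOn]
      intro a ha b hb hab
      rw [mem_coe, mem_filter, mem_sdiff, mem_Icc] at ha hb
      simp only at hab
      omega
    · refine sum_congr rfl fun i _ => ?_
      rw [filter_image, card_image_of_injective]
      intro a b hab
      simpa using hab
  · intro i _ j _ hij
    rw [Function.onFun, Finset.disjoint_left]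
    intro a ha hb
    simp only [mem_filter, mem_image] at ha hb
    obtain ⟨⟨a, haB, rfl⟩, _⟩ := ha
    obtain ⟨⟨b, hbB, hab⟩, _⟩ := hb
    have h1 := mem_Icc.1 (hB i haB)
    have h2 := mem_Icc.1 (hB j hbB)
    rcases lt_or_gt_of_ne (Fin.val_ne_of_ne hij) with h | h
    · have := blockShift_lt (m := m) (n₀ := n₀) (n := n) h h1.2
      omega
    · have := blockShift_lt (m := m) (n₀ := n₀) (n := n) h h2.2
      omega
  · rw [Finset.disjoint_left]
    intro a ha hb
    simp only [mem_filter, mem_image, mem_sdiff] at ha hb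
    obtain ⟨⟨b, ⟨hb1, _⟩, rfl⟩, _⟩ := hb
    have h1 := mem_Icc.1 (hS ha.1)
    have h2 := mem_Icc.1 hb1
    omega
  · rw [Finset.disjoint_left]
    intro a ha hb
    simp only [mem_filter, mem_image, mem_sdiff, mem_union, mem_biUnion] at ha hb
    obtain ⟨⟨i, _, b, hbB, rfl⟩, _⟩ := hb
    have h1 := mem_Icc.1 (hB i hbB)
    have h2 := blockShift_add_le (n := n) i h1.2
    have h3 : n - coreSize m n₀ n ≤ blockShift m n₀ n i := Nat.le_add_right _ _
    rcases ha with ⟨h, _⟩ | ⟨⟨c, ⟨hc, _⟩, hcb⟩, _⟩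
    · have := mem_Icc.1 (hS h)
      omega
    · have := mem_Icc.1 hc
      omega

theorem card_assemble {S : Finset ℕ} {B : Fin (branching m n₀) → Finset ℕ}
    (hS : S ⊆ Icc 1 (n - coreSize m n₀ n))
    (hB : ∀ i, B i ⊆ Icc 1 (2 * subSize m n₀ n)) (hBc : ∀ i, (B i).card = subSize m n₀ n) :
    (assemble m n₀ n S B).card = n := by
  have h := card_assemble_filter hS hB fun _ => True
  have hle := coreSize_le m n₀ n
  have h1 := card_sdiff_add_card_eq_card hS
  simp only [filter_true, hBc, sum_const, card_univ, Fintype.card_fin, smul_eq_mul] at h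
  rw [Nat.card_Icc] at h1
  rw [h]
  change _ + coreSize m n₀ n = n
  omega

theorem assemble_subset {S : Finset ℕ} {B : Fin (branching m n₀) → Finset ℕ}
    (hS : S ⊆ Icc 1 (n - coreSize m n₀ n))
    (hB : ∀ i, B i ⊆ Icc 1 (2 * subSize m n₀ n)) :
    assemble m n₀ n S B ⊆ Icc 1 (2 * n) := by
  have hle := coreSize_le m n₀ n
  intro a ha
  simp only [assemble, mem_union, mem_image, mem_sdiff, mem_biUnion] at ha
  rcases ha with (h | ⟨c, ⟨hc, _⟩, rfl⟩) | ⟨i, _, b, hb, rfl⟩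
  · have := mem_Icc.1 (hS h)
    rw [mem_Icc]; omega
  · have := mem_Icc.1 hc
    rw [mem_Icc]; omega
  · have h1 := mem_Icc.1 (hB i hb)
    have h2 := blockShift_add_le (n := n) i h1.2
    rw [mem_Icc]; omega

theorem hardDist_support (m n₀ n : ℕ) : ∀ A ∈ (hardDist m n₀ n).support,
    A ⊆ Icc 1 (2 * n) ∧ A.card = n := by
  induction n using Nat.strong_induction_on with
  | _ n ih =>
    intro A hA
    by_cases h : Recurses m n₀ n
    · rw [hardDist_of_recurses h, PMF.mem_support_bind_iff] at hA
      obtain ⟨j, _, hA⟩ := hA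
      rw [PMF.mem_support_bind_iff] at hA
      obtain ⟨S, hS, hA⟩ := hA
      rw [PMF.mem_support_uniformOfFinset_iff, mem_powersetCard] at hS
      rw [PMF.mem_support_map_iff] at hA
      obtain ⟨B, hB, rfl⟩ := hA
      have hB' := fun i => ih _ (subSize_lt h) _ (mem_support_iid _ _ _ hB i)
      exact ⟨assemble_subset hS.1 fun i => (hB' i).1,
        card_assemble hS.1 (fun i => (hB' i).1) fun i => (hB' i).2⟩
    · rw [hardDist, dif_neg h, PMF.mem_support_map_iff] at hA
      obtain ⟨b, _, rfl⟩ := hA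
      constructor
      · intro a ha
        obtain ⟨i, _, rfl⟩ := mem_image.1 ha
        have := i.2
        have := Bool.toNat_le (b i)
        rw [mem_Icc]; omega
      · rw [card_image_of_injective, card_univ, Fintype.card_fin]
        intro i j hij
        have h1 := Bool.toNat_le (b i)
        have h2 := Bool.toNat_le (b j)
        simp only at hij
        ext; omega

instance (m n₀ n : ℕ) : Finite (hardDist m n₀ n).support :=
  Set.Finite.subset (Finset.finite_toSet (Icc 1 (2 * n)).powerset) fun A hA =>
    mem_coe.2 (mem_powerset.2 (hardDist_support m n₀ n A hA).1)

instance (m n₀ n : ℕ) : Fintype (hardDist m n₀ n).support := Fintype.ofFinite _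

/-! ### The median of an assembled set -/

theorem median_eq {A : Finset ℕ} {a : ℕ} (ha : a ∈ A)
    (h : (A.filter (· < a)).card = A.card / 2 - 1) : median A = a := by
  unfold median
  have hc : Nat.count (fun b => b ∈ A) a = A.card / 2 - 1 := by
    rw [Nat.count_eq_card_filter_range, ← h]
    congr 1
    ext b
    simp [and_comm]
  rw [← hc]
  exact Nat.nth_count ha

theorem median_spec {A : Finset ℕ} (hA : 2 ≤ A.card) :
    median A ∈ A ∧ (A.filter (· < median A)).card = A.card / 2 - 1 := by
  have hlt : ∀ hf : (Set.ofPred fun b => b ∈ A).Finite, A.card / 2 - 1 < hf.toFinset.card := by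
    intro hf
    have : hf.toFinset = A := by ext; rw [Set.Finite.mem_toFinset]; rfl
    rw [this]; omega
  refine ⟨Nat.nth_mem _ hlt, ?_⟩
  have := Nat.count_nth hlt
  rw [Nat.count_eq_card_filter_range] at this
  rw [← this]
  congr 1
  ext b
  rw [mem_filter, mem_filter, mem_range, and_comm]
  rfl

theorem even_subSize (m n₀ n : ℕ) : Even (subSize m n₀ n) := even_two_mul _

/-- Below block `j` lie `n/2 - n' (j + 1/2)` shell elements and `n'` elements of each of the `j`
earlier blocks, together `n/2 - n'/2`. So the `n/2`-th element is the `n'/2`-th one of block `j`.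
Since `n` and `n'` are even, so is the offset of the block, and the last bit survives the shift. -/
theorem medianBit_assemble {S : Finset ℕ} {B : Fin (branching m n₀) → Finset ℕ} (hn : Even n)
    (j : Fin (branching m n₀))
    (hS : S ∈ powersetCard (lowCount m n₀ n j) (Icc 1 (n - coreSize m n₀ n)))
    (hB : ∀ i, B i ⊆ Icc 1 (2 * subSize m n₀ n)) (hBc : ∀ i, (B i).card = subSize m n₀ n)
    (h2 : 2 ≤ subSize m n₀ n) :
    medianBit (assemble m n₀ n S B) = medianBit (B j) := by
  rw [mem_powersetCard] at hS
  have hle := coreSize_le m n₀ n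
  obtain ⟨hmem, hcnt⟩ := median_spec (by rw [hBc]; exact h2 : 2 ≤ (B j).card)
  set a := median (B j) with ha
  have haI := mem_Icc.1 (hB j hmem)
  obtain ⟨r, hr⟩ := even_subSize m n₀ n
  obtain ⟨n2, hn2⟩ := hn
  have hj1 : subSize m n₀ n * (j + 1) ≤ coreSize m n₀ n := by
    unfold coreSize; rw [mul_comm]; exact Nat.mul_le_mul_right _ j.2
  have hmed : median (assemble m n₀ n S B) = blockShift m n₀ n j + a := by
    apply median_eq
    · simp only [assemble, mem_union, mem_biUnion, mem_image]
      exact Or.inr ⟨j, mem_univ _, a, hmem, rfl⟩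
    · rw [card_assemble_filter hS.1 hB, card_assemble hS.1 hB hBc]
      have e1 : S.filter (· < blockShift m n₀ n j + a) = S := by
        refine filter_true_of_mem fun b hb => ?_
        have := mem_Icc.1 (hS.1 hb)
        unfold blockShift; omega
      have e2 : ((Icc 1 (n - coreSize m n₀ n) \ S).filter
          fun i => 2 * n + 1 - i < blockShift m n₀ n j + a) = ∅ := by
        refine filter_false_of_mem fun b hb => ?_
        have := mem_Icc.1 (mem_sdiff.1 hb).1
        have := blockShift_add_le (n := n) j haI.2
        omega
      have e3 : ∀ i, ((B i).filter
          fun c => blockShift m n₀ n i + c < blockShift m n₀ n j + a).card =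
          (if i < j then subSize m n₀ n else 0) + if i = j then subSize m n₀ n / 2 - 1 else 0 := by
        intro i
        rcases lt_trichotomy i j with hij | hij | hij
        · rw [if_pos hij, if_neg hij.ne, filter_true_of_mem, hBc, add_zero]
          intro c hc
          have hc' := mem_Icc.1 (hB i hc)
          have := blockShift_lt (m := m) (n₀ := n₀) (n := n) hij hc'.2
          omega
        · subst hij
          rw [if_neg (lt_irrefl _), if_pos rfl, zero_add, ← hBc i, ← hcnt]
          congr 1
          ext c; simp
        · rw [if_neg hij.not_gt, if_neg hij.ne', filter_false_of_mem]
          · rfl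
          intro c hc
          have hc' := mem_Icc.1 (hB i hc)
          have := blockShift_lt (m := m) (n₀ := n₀) (n := n) hij haI.2
          omega
      rw [e1, e2, card_empty, sum_congr rfl fun i _ => e3 i, sum_add_distrib, sum_ite_eq',
        if_pos (mem_univ _), ← sum_filter, sum_const, hS.2]
      have e4 : (univ.filter fun i => i < j).card = j := by
        rw [Finset.filter_gt_eq_Iio, Fin.card_Iio]
      rw [e4, smul_eq_mul, mul_comm]
      unfold lowCount
      rw [mul_add, mul_one] at hj1
      omega
  unfold medianBit
  rw [hmed]
  have hev : Even (blockShift m n₀ n j) := by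
    unfold blockShift coreSize
    refine Even.add ?_ (by rw [mul_assoc]; exact even_two_mul _)
    have hc : Even (branching m n₀ * subSize m n₀ n) := (even_subSize m n₀ n).mul_left _
    obtain ⟨u, hu⟩ := hc
    exact ⟨n2 - u, by rw [hu]; omega⟩
  rw [Nat.testBit_zero, Nat.testBit_zero]
  obtain ⟨u, hu⟩ := hev
  rw [hu]
  congr 1
  rw [eq_iff_iff]
  omega

end Shape

/-! ### Averages over shell sets, and the last message for independent blocks. -/

theorem subsetAvg_mono {α : Type*} {U : Finset α} {s : ℕ} {c c' : Finset α → ℝ}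
    (h : ∀ S ∈ powersetCard s U, c S ≤ c' S) : subsetAvg U s c ≤ subsetAvg U s c' :=
  div_le_div_of_nonneg_right (sum_le_sum h) (Nat.cast_nonneg _)

theorem subsetAvg_add {α : Type*} (U : Finset α) (s : ℕ) (c c' : Finset α → ℝ) :
    subsetAvg U s (fun S => c S + c' S) = subsetAvg U s c + subsetAvg U s c' := by
  unfold subsetAvg; rw [sum_add_distrib, add_div]

theorem subsetAvg_const {α : Type*} {U : Finset α} {s : ℕ} (hs : s ≤ U.card) (a : ℝ) :
    subsetAvg U s (fun _ => a) = a := by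
  unfold subsetAvg
  have : (0 : ℝ) < (powersetCard s U).card := by
    rw [card_powersetCard]; exact_mod_cast Nat.choose_pos hs
  rw [sum_const, nsmul_eq_mul, mul_div_cancel_left₀ _ this.ne']

theorem subsetAvg_congr {α : Type*} {U : Finset α} {s : ℕ} {c c' : Finset α → ℝ}
    (h : ∀ S ∈ powersetCard s U, c S = c' S) : subsetAvg U s c = subsetAvg U s c' := by
  unfold subsetAvg; rw [sum_congr rfl h]

/-- The influence on the first message remains small when the shell depends slightly on the
block. -/
theorem avg_subsetAvg_le {α : Type*} [DecidableEq α] {k : ℕ} (hk : 0 < k) (U W : Finset α)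
    (s : Fin k → ℕ) (s₀ : ℕ) (hs₀ : s₀ ≤ U.card) (δ δ₁ : ℝ) (c : Fin k → Finset α → ℝ)
    (hc0 : ∀ j S, 0 ≤ c j S) (hc2 : ∀ j S, c j S ≤ 2) (hc : ∀ S, (∑ j, c j S) / k ≤ δ)
    (hTV : ∀ j (c : Finset α → ℝ), (∀ S, 0 ≤ c S) → (∀ S, c S ≤ 1) →
      subsetAvg U (s j) (fun S => c (S \ W)) ≤ subsetAvg U s₀ (fun S => c (S \ W)) + δ₁) :
    (∑ j, subsetAvg U (s j) fun S => c j (S \ W)) / k ≤ δ + 2 * δ₁ := by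
  have hkR : (0 : ℝ) < k := Nat.cast_pos.2 hk
  -- All sizes are replaced by the common `s₀`, after which `hc` applies to each fixed set. The
  -- costs range up to `2` and the closeness hypothesis is for values in `[0, 1]`, whence `2 * δ₁`.
  have h1 : ∀ j, (subsetAvg U (s j) fun S => c j (S \ W)) ≤
      (subsetAvg U s₀ fun S => c j (S \ W)) + 2 * δ₁ := by
    intro j
    have := hTV j (fun S => c j S / 2) (fun S => by have := hc0 j S; positivity)
      (fun S => by have := hc2 j S; linarith)
    simp only [subsetAvg, ← sum_div] at this ⊢
    rw [div_right_comm, div_right_comm (∑ S ∈ powersetCard s₀ U, c j (S \ W))] at this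
    linarith
  rw [div_le_iff₀ hkR]
  calc _ ≤ ∑ j, ((subsetAvg U s₀ fun S => c j (S \ W)) + 2 * δ₁) := sum_le_sum fun j _ => h1 j
    _ = subsetAvg U s₀ (fun S => ∑ j, c j (S \ W)) + k * (2 * δ₁) := by
        rw [sum_add_distrib, sum_const, card_univ, Fintype.card_fin, nsmul_eq_mul]
        congr 1
        unfold subsetAvg
        rw [← sum_div, Finset.sum_comm]
    _ ≤ subsetAvg U s₀ (fun _ => δ * k) + k * (2 * δ₁) := by
        gcongr
        exact subsetAvg_mono fun S _ => (div_le_iff₀ hkR).1 (hc _)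
    _ = _ := by rw [subsetAvg_const hs₀]; ring

/-- A message that ends the protocol gives little information about a fair bit of a block. -/
theorem last_message_block {k : ℕ} {Ω V : Type} [Fintype Ω] [Fintype V] (w : Ω → ℝ)
    (hw : ∀ ω, 0 ≤ w ω) (hw1 : ∑ ω, w ω = 1) (b : Ω → Bool)
    (hb : ∀ c, ∑ ω, w ω * (if c = b ω then 1 else 0) = 1 / 2) (f : (Fin k → Ω) → V)
    (β : V → Bool) (j : Fin k) :
    ∑ ζ : Fin k → Ω, (∏ i, w (ζ i)) * (if β (f ζ) = b (ζ j) then 1 else 0) ≤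
      1 / 2 + influence (fun _ => w) f j := by
  classical
  rw [sum_prod_update (fun _ => w) (fun _ => hw1) j]
  have e1 : ∀ ω, ∑ ζ : Fin k → Ω, (∏ i, w (ζ i)) *
      (if β (f (Function.update ζ j ω)) = b (Function.update ζ j ω j) then (1 : ℝ) else 0) =
      ∑ v, condProb (fun _ => w) f j v ω * (if β v = b ω then 1 else 0) := by
    intro ω
    simp only [Function.update_self, condProb, sum_mul]
    rw [Finset.sum_comm]
    refine sum_congr rfl fun ζ _ => ?_
    simp_rw [mul_assoc]
    rw [← mul_sum]
    congr 1
    simp only [ite_mul, one_mul, zero_mul, sum_ite_eq, mem_univ, if_true]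
  simp_rw [e1]
  -- A message drawn from the averaged law is independent of the block, so it guesses the fair bit
  -- with probability one half.
  have e2 : ∑ ω, w ω * ∑ v, avgProb (fun _ : Fin k => w) f j v * (if β v = b ω then 1 else 0) =
      1 / 2 := by
    simp_rw [mul_sum]
    rw [Finset.sum_comm]
    have : ∀ v, ∑ ω, w ω * (avgProb (fun _ : Fin k => w) f j v * (if β v = b ω then 1 else 0)) =
        avgProb (fun _ : Fin k => w) f j v * (1 / 2) := by
      intro v
      rw [← hb (β v), mul_sum]
      exact sum_congr rfl fun ω _ => by ring
    simp_rw [this]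
    rw [← sum_mul, sum_avgProb _ fun _ => hw1, one_mul]
  rw [← e2]
  unfold influence
  rw [← sum_add_distrib]
  refine sum_le_sum fun ω _ => ?_
  rw [← mul_add, ← sum_add_distrib]
  refine mul_le_mul_of_nonneg_left (sum_le_sum fun v _ => ?_) (hw _)
  have := le_abs_self (condProb (fun _ => w) f j v ω - avgProb (fun _ : Fin k => w) f j v)
  have := abs_nonneg (condProb (fun _ => w) f j v ω - avgProb (fun _ : Fin k => w) f j v)
  split_ifs <;> linarith

/-! ### One level of the distribution and the fairness of the answer. -/

section Level

variable {m n₀ n : ℕ}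

/-- The positions of the shell below the core. -/
def shell (m n₀ n : ℕ) : Finset ℕ := Icc 1 (n - coreSize m n₀ n)

theorem card_shell (m n₀ n : ℕ) : (shell m n₀ n).card = n - coreSize m n₀ n := by
  rw [shell, Nat.card_Icc]; omega

theorem lowCount_le (m n₀ n j : ℕ) : lowCount m n₀ n j ≤ (shell m n₀ n).card := by
  have := coreSize_le m n₀ n
  rw [card_shell]; unfold lowCount; omega

/-- For `j < k` the subtraction in `lowCount` never truncates. The sizes selecting different blocks
differ by at most `γ`, and the size for `j = 0` serves as common reference. -/
theorem lowCount_add {j : ℕ} (hj : j < branching m n₀) :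
    lowCount m n₀ n j + subSize m n₀ n * j = lowCount m n₀ n 0 ∧
      subSize m n₀ n * j ≤ coreSize m n₀ n ∧ n / 2 ≤ lowCount m n₀ n j + coreSize m n₀ n := by
  have h1 := coreSize_le m n₀ n
  have h2 : subSize m n₀ n * (j + 1) ≤ coreSize m n₀ n := by
    unfold coreSize; rw [mul_comm]; exact Nat.mul_le_mul_right _ hj
  rw [mul_add, mul_one] at h2
  unfold lowCount
  rw [mul_zero]
  omega

open Classical in
theorem prob_hardDist (h : Recurses m n₀ n) (T : Set (Finset ℕ)) :
    prob (hardDist m n₀ n) T = (∑ j : Fin (branching m n₀),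
      subsetAvg (shell m n₀ n) (lowCount m n₀ n j) fun S =>
        ∑ ζ : Fin (branching m n₀) → (hardDist m n₀ (subSize m n₀ n)).support,
          (∏ i, (hardDist m n₀ (subSize m n₀ n) (ζ i)).toReal) *
            if assemble m n₀ n S (fun i => ζ i) ∈ T then 1 else 0) / branching m n₀ := by
  rw [hardDist_of_recurses h, prob_bind_uniform, card_range, Finset.sum_range]
  congr 1
  refine sum_congr rfl fun j _ => ?_
  rw [prob_bind_uniform]
  unfold subsetAvg shell
  congr 1
  refine sum_congr rfl fun S _ => ?_
  rw [prob_map, prob_iid]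
  rfl

/-- Subdivision requires `√n ≥ k L³` with `L = log n₀`, so the quotient under the floor is at least
`L / 2 ≥ 1`. -/
theorem two_le_subSize (hL : 2 ≤ Real.logb 2 n₀) (h : Recurses m n₀ n) :
    2 ≤ subSize m n₀ n := by
  have hk : (0 : ℝ) < branching m n₀ := Nat.cast_pos.2 h.1
  have : 1 ≤ ⌊√(n : ℝ) / (2 * branching m n₀ * Real.logb 2 n₀ ^ 2)⌋₊ := by
    apply Nat.le_floor
    rw [Nat.cast_one, le_div_iff₀ (by positivity)]
    refine le_trans ?_ h.2
    have h0 : (0 : ℝ) ≤ branching m n₀ * Real.logb 2 n₀ ^ 2 := by positivity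
    nlinarith
  unfold subSize; omega

theorem coreSize_mul_le (hL : 2 ≤ Real.logb 2 n₀) :
    (coreSize m n₀ n : ℝ) * Real.logb 2 n₀ ^ 2 ≤ √(n : ℝ) := by
  rcases Nat.eq_zero_or_pos (branching m n₀) with h0 | hk
  · simp [coreSize, h0]
  have hk : (0 : ℝ) < branching m n₀ := Nat.cast_pos.2 hk
  have hfl := Nat.floor_le (a := √(n : ℝ) / (2 * branching m n₀ * Real.logb 2 n₀ ^ 2))
    (by positivity)
  rw [le_div_iff₀ (by positivity)] at hfl
  unfold coreSize subSize
  push_cast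
  linarith

/-- The answer is a fair coin. -/
theorem prob_medianBit (hL : 2 ≤ Real.logb 2 n₀) (n : ℕ) (hn : Even n) (h2 : 2 ≤ n) (c : Bool) :
    prob (hardDist m n₀ n) {A | c = medianBit A} = 1 / 2 := by
  classical
  induction n using Nat.strong_induction_on with
  | _ n ih =>
    by_cases h : Recurses m n₀ n
    · have h2' := two_le_subSize hL h
      have ih := ih _ (subSize_lt h) (even_subSize _ _ _) h2'
      obtain ⟨T, hT⟩ : ∃ T : Set (Finset ℕ), T = {A | c = medianBit A} := ⟨_, rfl⟩
      have hmem : ∀ A, A ∈ T ↔ c = medianBit A := fun A => by rw [hT]; rfl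
      rw [← hT] at ih ⊢
      rw [prob_eq_sum_support] at ih
      rw [prob_hardDist h]
      have hj : ∀ j : Fin (branching m n₀),
          (subsetAvg (shell m n₀ n) (lowCount m n₀ n j) fun S =>
          ∑ ζ : Fin (branching m n₀) → (hardDist m n₀ (subSize m n₀ n)).support,
          (∏ i, (hardDist m n₀ (subSize m n₀ n) (ζ i)).toReal) *
            if assemble m n₀ n S (fun i => ζ i) ∈ T then 1 else 0) =
          1 / 2 := by
        intro j
        rw [← subsetAvg_const (lowCount_le m n₀ n j) (1 / 2 : ℝ)]
        refine subsetAvg_congr fun S hS => ?_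
        rw [← ih, ← sum_prod_marginal (k := branching m n₀)
          (fun _ (a : (hardDist m n₀ (subSize m n₀ n)).support) =>
            (hardDist m n₀ (subSize m n₀ n) a).toReal) (fun _ => sum_support _) j]
        refine sum_congr rfl fun ζ _ => ?_
        congr 1
        have := medianBit_assemble (B := fun i => (ζ i : Finset ℕ)) hn j hS
          (fun i => (hardDist_support _ _ _ _ (ζ i).2).1)
          (fun i => (hardDist_support _ _ _ _ (ζ i).2).2) h2'
        refine if_congr ?_ rfl rfl
        rw [hmem, hmem, this]
      have hk : (0 : ℝ) < branching m n₀ := Nat.cast_pos.2 h.1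
      simp_rw [hj]
      rw [sum_const, card_univ, Fintype.card_fin, nsmul_eq_mul, mul_div_cancel_left₀ _ hk.ne']
    · rw [hardDist, dif_neg h, prob_map]
      -- The base pairs are consecutive, so the median lies in the `n/2`-th pair, which has index
      -- `n/2 - 1` counted from zero; its bit is the negation of one coin.
      let i₀ : Fin n := ⟨n / 2 - 1, by omega⟩
      have hmed : ∀ b : Fin n → Bool, medianBit
          (univ.image fun i : Fin n => 2 * (i : ℕ) + 1 + (b i).toNat) = !b i₀ := by
        intro b
        have hinj : Function.Injective fun i : Fin n => 2 * (i : ℕ) + 1 + (b i).toNat := by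
          intro i j hij
          have h1 := Bool.toNat_le (b i)
          have h2 := Bool.toNat_le (b j)
          simp only at hij
          ext; omega
        have : median (univ.image fun i : Fin n => 2 * (i : ℕ) + 1 + (b i).toNat) =
            2 * (i₀ : ℕ) + 1 + (b i₀).toNat := by
          apply median_eq
          · exact mem_image_of_mem (fun i : Fin n => 2 * (i : ℕ) + 1 + (b i).toNat) (mem_univ i₀)
          · rw [filter_image, card_image_of_injective _ hinj, card_image_of_injective _ hinj,
              card_univ, Fintype.card_fin]
            have : (univ.filter fun i : Fin n => 2 * (i : ℕ) + 1 + (b i).toNat <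
                2 * (i₀ : ℕ) + 1 + (b i₀).toNat) = univ.filter fun i => i < i₀ := by
              ext i
              simp only [mem_filter, mem_univ, true_and]
              have h1 := Bool.toNat_le (b i)
              have h2 := Bool.toNat_le (b i₀)
              rw [Fin.lt_def]
              by_cases hi : i = i₀
              · subst hi; omega
              · have := Fin.val_ne_of_ne hi
                omega
            rw [this, Finset.filter_gt_eq_Iio, Fin.card_Iio]
        unfold medianBit
        rw [this, Nat.testBit_zero]
        cases b i₀ <;> simp
        omega
      have hset : ((fun b : Fin n → Bool =>
          univ.image fun i : Fin n => 2 * (i : ℕ) + 1 + (b i).toNat) ⁻¹'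
          {A | c = medianBit A}) = {b | b i₀ = !c} := by
        ext b
        simp only [Set.mem_preimage, Set.mem_ofPred_eq, hmed]
        cases c <;> cases b i₀ <;> simp
      rw [hset]
      have hflip : ∀ a : Bool, prob (PMF.uniformOfFintype (Fin n → Bool)) {b | b i₀ = a} =
          prob (PMF.uniformOfFintype (Fin n → Bool)) {b | b i₀ = !a} := by
        intro a
        let e : (Fin n → Bool) ≃ (Fin n → Bool) :=
          ⟨fun b i => !b i, fun b i => !b i, fun b => by ext; simp, fun b => by ext; simp⟩
        have hcard : Fintype.card {b : Fin n → Bool | b i₀ = a} =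
            Fintype.card {b : Fin n → Bool | b i₀ = !a} :=
          Fintype.card_congr (e.subtypeEquiv fun b => by
            simp only [Set.mem_ofPred_eq, e, Equiv.coe_fn_mk]
            cases a <;> cases b i₀ <;> simp)
        unfold prob
        rw [PMF.toOuterMeasure_uniformOfFintype_apply, PMF.toOuterMeasure_uniformOfFintype_apply,
          hcard]
      have hcompl := prob_compl (PMF.uniformOfFintype (Fin n → Bool)) {b | b i₀ = !c}
      have : ({b : Fin n → Bool | b i₀ = !c})ᶜ = {b | b i₀ = !(!c)} := by
        ext b
        simp only [Set.mem_compl_iff, Set.mem_ofPred_eq]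
        cases c <;> cases b i₀ <;> simp
      rw [this, ← hflip] at hcompl
      linarith

/-! ### Splitting an instance between the players -/

open Classical in
/-- The elements of `A` with property `C`. -/
def part (C : ℕ → Prop) (A : Finset ℕ) : Finset ℕ := A.filter C

theorem mem_part {C : ℕ → Prop} {A : Finset ℕ} {a : ℕ} : a ∈ part C A ↔ a ∈ A ∧ C a := by
  classical
  unfold part; exact mem_filter

theorem part_subset (C : ℕ → Prop) (A : Finset ℕ) : part C A ⊆ A := fun _ h => (mem_part.1 h).1

theorem part_not_not (C : ℕ → Prop) (A : Finset ℕ) : part (fun a => ¬¬C a) A = part C A := by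
  ext a; simp [mem_part]

/-- The probability that `F` finds the answer when the elements of `A` with property `C` are
the first argument and the others the second. -/
def success (m n₀ n : ℕ) (C : ℕ → Prop) (F : Finset ℕ → Finset ℕ → Bool) : ℝ :=
  prob (hardDist m n₀ n) {A | F (part C A) (part (fun a => ¬C a) A) = medianBit A}

/-- The partition induced on block `j`. -/
def blockPart (m n₀ n : ℕ) (C : ℕ → Prop) (j : ℕ) (a : ℕ) : Prop := C (blockShift m n₀ n j + a)

/-- The input of a player put together from the shell and the blocks. -/
def joinPart (m n₀ n : ℕ) (C : ℕ → Prop) (S : Finset ℕ) (B : Fin (branching m n₀) → Finset ℕ) :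
    Finset ℕ :=
  S ∪ (part C (shell m n₀ n) \ S).image (fun i => 2 * n + 1 - i) ∪
    univ.biUnion fun i : Fin (branching m n₀) => (B i).image fun a => blockShift m n₀ n i + a

open Classical in
-- As no shell pair is split, a player's shell elements on both sides of the core are determined by
-- that player's part of `S`.
theorem filter_assemble {C : ℕ → Prop} (hC : ∀ i ∈ shell m n₀ n, (C (2 * n + 1 - i) ↔ C i))
    (S : Finset ℕ) (B : Fin (branching m n₀) → Finset ℕ) :
    part C (assemble m n₀ n S B) = joinPart m n₀ n C (part C S)
      fun i => part (blockPart m n₀ n C i) (B i) := by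
  unfold assemble joinPart part
  rw [filter_union, filter_union, filter_biUnion]
  congr 1
  · congr 1
    rw [filter_image]
    congr 1
    ext a
    simp only [mem_filter, mem_sdiff]
    change (a ∈ shell m n₀ n ∧ _) ∧ _ ↔ _
    constructor
    · rintro ⟨⟨h1, h2⟩, h3⟩
      exact ⟨⟨h1, (hC a h1).1 h3⟩, fun h => h2 h.1⟩
    · rintro ⟨⟨h1, h2⟩, h3⟩
      exact ⟨⟨h1, fun h => h3 ⟨h, h2⟩⟩, (hC a h1).2 h2⟩
  · refine biUnion_congr rfl fun i _ => ?_
    rw [filter_image]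
    rfl

end Level

/-! ### Eliminating a message at one level of the recursion. -/

section Level

variable {m n₀ n : ℕ}

theorem success_eq (C : ℕ → Prop) (F : Finset ℕ → Finset ℕ → Bool) :
    success m n₀ n C F = ∑ ω : (hardDist m n₀ n).support, (hardDist m n₀ n ω).toReal *
      if F (part C ω) (part (fun a => ¬C a) ω) = medianBit ω
        then 1 else 0 := by
  unfold success
  rw [prob_pred]

theorem success_of_recurses (h : Recurses m n₀ n) (hn : Even n) (h2 : 2 ≤ subSize m n₀ n)
    {C : ℕ → Prop} (hC : ∀ i ∈ shell m n₀ n, (C (2 * n + 1 - i) ↔ C i))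
    (F : Finset ℕ → Finset ℕ → Bool) :
    success m n₀ n C F = (∑ j : Fin (branching m n₀),
      subsetAvg (shell m n₀ n) (lowCount m n₀ n j) fun S =>
        ∑ ζ : Fin (branching m n₀) → (hardDist m n₀ (subSize m n₀ n)).support,
          (∏ i, (hardDist m n₀ (subSize m n₀ n) (ζ i)).toReal) *
            if F (joinPart m n₀ n C (part C S)
                fun i => part (blockPart m n₀ n C i) (ζ i))
              (joinPart m n₀ n (fun a => ¬C a) (part (fun a => ¬C a) S)
                fun i => part (fun a => ¬blockPart m n₀ n C i a) (ζ i)) =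
              medianBit (ζ j) then 1 else 0) / branching m n₀ := by
  unfold success
  obtain ⟨T, hT⟩ : ∃ T : Set (Finset ℕ),
    T = {A | F (part C A) (part (fun a => ¬C a) A) = medianBit A} := ⟨_, rfl⟩
  rw [← hT, prob_hardDist h]
  congr 1
  refine sum_congr rfl fun j _ => subsetAvg_congr fun S hS => sum_congr rfl fun ζ _ => ?_
  congr 1
  have hC' : ∀ i ∈ shell m n₀ n, (¬C (2 * n + 1 - i) ↔ ¬C i) := fun i hi => not_congr (hC i hi)
  have hmed := medianBit_assemble (B := fun i => (ζ i : Finset ℕ)) hn j hS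
    (fun i => (hardDist_support _ _ _ _ (ζ i).2).1)
    (fun i => (hardDist_support _ _ _ _ (ζ i).2).2) h2
  have e1 := filter_assemble hC S fun i => (ζ i : Finset ℕ)
  have e2 := filter_assemble (C := fun a => ¬C a) hC' S fun i => (ζ i : Finset ℕ)
  have hiff : assemble m n₀ n S (fun i => (ζ i : Finset ℕ)) ∈ T ↔
      F (joinPart m n₀ n C (part C S) fun i => part (blockPart m n₀ n C i) (ζ i))
        (joinPart m n₀ n (fun a => ¬C a) (part (fun a => ¬C a) S)
          fun i => part (fun a => ¬blockPart m n₀ n C i a) (ζ i)) = medianBit (ζ j) := by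
    rw [hT]
    change F _ _ = medianBit _ ↔ _
    rw [hmed, e1, e2]
    rfl
  by_cases hh : assemble m n₀ n S (fun i => (ζ i : Finset ℕ)) ∈ T
  · rw [if_pos hh, if_pos (hiff.1 hh)]
  · rw [if_neg hh, if_neg (mt hiff.2 hh)]

/-- The hypothesis that the shell of the speaker says little about the block of the median. -/
def ShellClose (m n₀ n : ℕ) (C : ℕ → Prop) (δ₁ : ℝ) : Prop :=
  ∀ j < branching m n₀, ∀ c : Finset ℕ → ℝ, (∀ S, 0 ≤ c S) → (∀ S, c S ≤ 1) →
    subsetAvg (shell m n₀ n) (lowCount m n₀ n j)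
      (fun S => c (S \ part (fun a => ¬C a) (shell m n₀ n))) ≤
    subsetAvg (shell m n₀ n) (lowCount m n₀ n 0)
      (fun S => c (S \ part (fun a => ¬C a) (shell m n₀ n))) + δ₁

theorem part_eq_sdiff {C : ℕ → Prop} {S U : Finset ℕ} (hS : S ⊆ U) :
    part C S = S \ part (fun a => ¬C a) U := by
  ext a
  simp only [mem_part, mem_sdiff, not_and, not_not]
  exact ⟨fun h => ⟨h.1, fun _ => h.2⟩, fun h => ⟨h.1, h.2 (hS h.1)⟩⟩

/-- For a fixed shell set, `eliminate_block` bounds the success by `B j` plus an influence, which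
depends on `S` only through the speaker's part. `ShellClose` makes the law of that part nearly
independent of `j`, and then `avg_influence_le` bounds the average over `j` by `δ`. The partition of
the block is negated because the listener speaks next. -/
theorem eliminate_message {m' t : ℕ} {V : Type} [Fintype V] [Nonempty V] (h : Recurses m n₀ n)
    (hn : Even n) (h2 : 2 ≤ subSize m n₀ n)
    {C : ℕ → Prop} (hC : ∀ i ∈ shell m n₀ n, (C (2 * n + 1 - i) ↔ C i))
    {δ δ₁ : ℝ} (hδ : 0 < δ) (hV : 8 * Real.log (Fintype.card V) ≤ branching m n₀ * δ ^ 2)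
    (hclose : ShellClose m n₀ n C δ₁)
    (msg : Finset ℕ → V) (next : V → Finset ℕ → Finset ℕ → Bool)
    (hnext : ∀ v, Realizable m' (t + 1) (Finset ℕ) (Finset ℕ) (next v))
    (B : Fin (branching m n₀) → ℝ)
    (hB : ∀ (j : Fin (branching m n₀)) (msg' : Finset ℕ → V × Message m')
      (next' : V × Message m' → Finset ℕ → Finset ℕ → Bool),
      (∀ u, Realizable m' t (Finset ℕ) (Finset ℕ) (next' u)) →
      success m n₀ (subSize m n₀ n) (fun a => ¬blockPart m n₀ n C j a)
        (fun y x => next' (msg' y) x y) ≤ B j) :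
    success m n₀ n C (fun x y => next (msg x) y x) ≤
      (∑ j, B j) / branching m n₀ + (δ + 2 * δ₁) := by
  classical
  let Ω := (hardDist m n₀ (subSize m n₀ n)).support
  let w : Ω → ℝ := fun ω => (hardDist m n₀ (subSize m n₀ n) ω).toReal
  have hw : ∀ ω, 0 < w ω := support_toReal_pos _
  have hw1 : ∑ ω, w ω = 1 := sum_support _
  let x : Fin (branching m n₀) → Ω → Finset ℕ := fun i ω =>
    part (blockPart m n₀ n C i) ω
  let y : Fin (branching m n₀) → Ω → Finset ℕ := fun i ω =>
    part (fun a => ¬blockPart m n₀ n C i a) ω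
  let cost : Fin (branching m n₀) → Finset ℕ → ℝ := fun j S =>
    ∑ η : Fin (branching m n₀) → Ω, (∏ i, w (η i)) *
      influence (blockKernel w y η) (fun ζ => msg (joinPart m n₀ n C S fun i => x i (ζ i))) j
  have hp0 : ∀ η i ω, 0 ≤ blockKernel w y η i ω := fun η i ω => fiberKernel_nonneg hw _ _ _
  have hp1 : ∀ η i, ∑ ω, blockKernel w y η i ω = 1 := fun η i => sum_fiberKernel hw _ _
  have hW0 : ∀ η : Fin (branching m n₀) → Ω, 0 ≤ ∏ i, w (η i) :=
    fun η => prod_nonneg fun i _ => (hw _).le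
  have hW1 : ∑ η : Fin (branching m n₀) → Ω, ∏ i, w (η i) = 1 :=
    sum_prod_eq_one (fun _ => w) fun _ => hw1
  have hblock : ∀ j (S : Finset ℕ), ∑ ζ : Fin (branching m n₀) → Ω, (∏ i, w (ζ i)) *
      (if next (msg (joinPart m n₀ n C (part C S) fun i => x i (ζ i)))
          (joinPart m n₀ n (fun a => ¬C a) (part (fun a => ¬C a) S) fun i => y i (ζ i))
          (joinPart m n₀ n C (part C S) fun i => x i (ζ i)) = medianBit (ζ j)
        then 1 else 0) ≤ B j + cost j (part C S) := by
    intro j S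
    refine eliminate_block (m := m') (t := t) w hw hw1 x y (fun ω => medianBit ω)
      (fun X => msg (joinPart m n₀ n C (part C S) X))
      (fun v Y X => next v (joinPart m n₀ n (fun a => ¬C a) (part (fun a => ¬C a) S) Y)
        (joinPart m n₀ n C (part C S) X))
      (fun v => (hnext v).comap _ _) j (B j) fun msg' next' hn' => ?_
    have := hB j msg' next' hn'
    rw [success_eq] at this
    simp only [part_not_not] at this
    exact this
  rw [success_of_recurses h hn h2 hC]
  have hk : (0 : ℝ) < branching m n₀ := Nat.cast_pos.2 h.branching_pos
  calc _ ≤ (∑ j : Fin (branching m n₀), (B j +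
        subsetAvg (shell m n₀ n) (lowCount m n₀ n j) fun S =>
          cost j (S \ part (fun a => ¬C a) (shell m n₀ n)))) / branching m n₀ := by
        gcongr with j
        rw [← subsetAvg_const (lowCount_le m n₀ n j) (B j), ← subsetAvg_add]
        refine subsetAvg_mono fun S hS => ?_
        rw [← part_eq_sdiff (mem_powersetCard.1 hS).1]
        exact hblock j S
    _ = (∑ j, B j) / branching m n₀ + (∑ j : Fin (branching m n₀),
        subsetAvg (shell m n₀ n) (lowCount m n₀ n j) fun S =>
          cost j (S \ part (fun a => ¬C a) (shell m n₀ n))) / branching m n₀ := by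
        rw [sum_add_distrib, add_div]
    _ ≤ _ := by
        gcongr
        refine avg_subsetAvg_le h.branching_pos _ _ _ (lowCount m n₀ n 0) (lowCount_le _ _ _ _)
          δ δ₁ cost ?_ ?_ ?_ fun j c => hclose j j.2 c
        · exact fun j S => sum_nonneg fun η _ => mul_nonneg (hW0 η) (influence_nonneg _ (hp0 η) _ _)
        · intro j S
          calc _ ≤ ∑ η : Fin (branching m n₀) → Ω, (∏ i, w (η i)) * 2 :=
                sum_le_sum fun η _ => mul_le_mul_of_nonneg_left
                  (influence_le_two _ (hp0 η) (hp1 η) _ _) (hW0 η)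
            _ = 2 := by rw [← sum_mul, hW1, one_mul]
        · intro S
          rw [div_le_iff₀ hk, Finset.sum_comm]
          calc _ ≤ ∑ η : Fin (branching m n₀) → Ω, (∏ i, w (η i)) * (δ * branching m n₀) := by
                refine sum_le_sum fun η _ => ?_
                rw [← mul_sum]
                refine mul_le_mul_of_nonneg_left ?_ (hW0 η)
                rw [← div_le_iff₀ hk]
                exact avg_influence_le h.branching_pos _ (hp0 η) (hp1 η) _ δ hδ hV
            _ = δ * branching m n₀ := by rw [← sum_mul, hW1, one_mul]

/-- The last message needs its own argument: no later message is left to carry the sampled value.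
None is needed, since the output is a function of the message and the answer of the block is a fair
coin. -/
theorem eliminate_last_message {V : Type} [Fintype V] [Nonempty V] (hL : 2 ≤ Real.logb 2 n₀)
    (h : Recurses m n₀ n) (hn : Even n)
    {C : ℕ → Prop} (hC : ∀ i ∈ shell m n₀ n, (C (2 * n + 1 - i) ↔ C i))
    {δ δ₁ : ℝ} (hδ : 0 < δ) (hV : 8 * Real.log (Fintype.card V) ≤ branching m n₀ * δ ^ 2)
    (hclose : ShellClose m n₀ n C δ₁)
    (msg : Finset ℕ → V) (β : V → Bool) :
    success m n₀ n C (fun x _ => β (msg x)) ≤ 1 / 2 + (δ + 2 * δ₁) := by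
  classical
  have h2 := two_le_subSize hL h
  let Ω := (hardDist m n₀ (subSize m n₀ n)).support
  let w : Ω → ℝ := fun ω => (hardDist m n₀ (subSize m n₀ n) ω).toReal
  have hw : ∀ ω, 0 < w ω := support_toReal_pos _
  have hw1 : ∑ ω, w ω = 1 := sum_support _
  have hfair : ∀ c, ∑ ω, w ω * (if c = medianBit ω then 1 else 0) = 1 / 2 := by
    intro c
    have := prob_medianBit hL (subSize m n₀ n) (even_subSize _ _ _) h2 c (m := m)
    rw [prob_pred] at this
    rw [← this]
  let cost : Fin (branching m n₀) → Finset ℕ → ℝ := fun j S =>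
    influence (fun _ => w) (fun ζ : Fin (branching m n₀) → Ω => msg (joinPart m n₀ n C S
      fun i => part (blockPart m n₀ n C i) (ζ i))) j
  rw [success_of_recurses h hn h2 hC]
  have hk : (0 : ℝ) < branching m n₀ := Nat.cast_pos.2 h.branching_pos
  calc _ ≤ (∑ j : Fin (branching m n₀), (1 / 2 +
        subsetAvg (shell m n₀ n) (lowCount m n₀ n j) fun S =>
          cost j (S \ part (fun a => ¬C a) (shell m n₀ n)))) / branching m n₀ := by
        gcongr with j
        rw [← subsetAvg_const (lowCount_le m n₀ n j) (1 / 2), ← subsetAvg_add]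
        refine subsetAvg_mono fun S hS => ?_
        rw [← part_eq_sdiff (mem_powersetCard.1 hS).1]
        exact last_message_block w (fun ω => (hw ω).le) hw1 (fun ω => medianBit ω) hfair _ β j
    _ = 1 / 2 + (∑ j : Fin (branching m n₀),
        subsetAvg (shell m n₀ n) (lowCount m n₀ n j) fun S =>
          cost j (S \ part (fun a => ¬C a) (shell m n₀ n))) / branching m n₀ := by
        rw [sum_add_distrib, add_div, sum_const, card_univ, Fintype.card_fin, nsmul_eq_mul,
          mul_div_cancel_left₀ _ hk.ne']
    _ ≤ _ := by
        gcongr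
        exact avg_subsetAvg_le h.branching_pos _ _ _ (lowCount m n₀ n 0) (lowCount_le _ _ _ _)
          δ δ₁ cost (fun j S => influence_nonneg _ (fun _ ω => (hw ω).le) _ _)
          (fun j S => influence_le_two _ (fun _ ω => (hw ω).le) (fun _ => hw1) _ _)
          (fun S => avg_influence_le h.branching_pos _ (fun _ ω => (hw ω).le) (fun _ => hw1) _ δ
            hδ hV)
          fun j c => hclose j j.2 c

/-- The partition respects the pairs of the shell and both players get many of them. -/
def Balanced (m n₀ n : ℕ) (C : ℕ → Prop) : Prop :=
  (∀ i ∈ shell m n₀ n, (C (2 * n + 1 - i) ↔ C i)) ∧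
    (shell m n₀ n).card ≤ 8 * (part C (shell m n₀ n)).card ∧
    (shell m n₀ n).card ≤ 8 * (part (fun a => ¬C a) (shell m n₀ n)).card

theorem balanced_not (C : ℕ → Prop) :
    Balanced m n₀ n (fun a => ¬C a) ↔ Balanced m n₀ n C := by
  unfold Balanced
  simp only [not_iff_not, part_not_not]
  tauto

/-- The size of the shell set moves by at most `γ ≤ √n / L²` with `L = log n₀`, and each unit costs
`64 / √|shell|`. As the shell has at least `n / 2` positions, `√n ≤ 2 √|shell|`, which gives `128 /
L²`. -/
theorem shellClose_of_balanced (hL : 2 ≤ Real.logb 2 n₀) {C : ℕ → Prop} (hn : 8 ≤ n)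
    (hγ : 4 * coreSize m n₀ n ≤ n) (hC : Balanced m n₀ n C) :
    ShellClose m n₀ n C (128 / Real.logb 2 n₀ ^ 2) := by
  classical
  intro j hj c h0 h1
  have hcard := card_shell m n₀ n
  obtain ⟨e1, e2, e3⟩ := lowCount_add (n := n) hj
  have hpos : 0 < (shell m n₀ n).card := by omega
  have h00 : lowCount m n₀ n 0 ≤ n / 2 := Nat.sub_le _ _
  refine (subsetAvg_add_diff (shell m n₀ n) (part (fun a => ¬C a) (shell m n₀ n))
    (part_subset _ _) hC.2.2 hpos c h0 h1 (lowCount m n₀ n j) (subSize m n₀ n * j)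
    ?_ ?_).trans ?_
  -- `8 ≤ n` and `4γ ≤ n` keep all sizes between a quarter and three quarters of the shell.
  · omega
  · rw [e1]; omega
  · rw [e1]
    gcongr
    have hN : (n : ℝ) ≤ 2 * (shell m n₀ n).card := by
      have : n ≤ 2 * (shell m n₀ n).card := by omega
      exact_mod_cast this
    have hNpos : (0 : ℝ) < (shell m n₀ n).card := Nat.cast_pos.2 hpos
    have hsq : √(n : ℝ) ≤ 2 * √((shell m n₀ n).card : ℝ) := by
      rw [show (2 : ℝ) = √4 by rw [show (4 : ℝ) = 2 ^ 2 by norm_num, Real.sqrt_sq (by norm_num)],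
        ← Real.sqrt_mul (by norm_num)]
      exact Real.sqrt_le_sqrt (by linarith)
    have hco := coreSize_mul_le (m := m) (n := n) hL
    have hjR : ((subSize m n₀ n * j : ℕ) : ℝ) ≤ coreSize m n₀ n := by exact_mod_cast e2
    have hθ : 0 < √((shell m n₀ n).card : ℝ) := Real.sqrt_pos.2 hNpos
    have hL2 : 0 < Real.logb 2 n₀ ^ 2 := by positivity
    rw [mul_div_assoc', div_le_div_iff₀ hθ hL2]
    nlinarith [mul_le_mul_of_nonneg_right hjR hL2.le]

end Level

/-! ### Round elimination -/

instance (m : ℕ) : Finite (Message m) := (List.finite_length_le Bool m).to_subtype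

instance (m : ℕ) : Fintype (Message m) := Fintype.ofFinite _

instance (m : ℕ) : Nonempty (Message m) := ⟨⟨[], Nat.zero_le _⟩⟩

theorem card_message_le (m : ℕ) : Fintype.card (Message m) ≤ 2 ^ (m + 1) := by
  let f : Message m → Σ i : Fin (m + 1), List.Vector Bool i := fun l =>
    ⟨⟨l.1.length, Nat.lt_succ_of_le l.2⟩, ⟨l.1, rfl⟩⟩
  have hf : Function.Injective f := by
    intro l l' h
    have := congrArg (fun s : Σ i : Fin (m + 1), List.Vector Bool i => s.2.toList) h
    exact Subtype.ext this
  refine (Fintype.card_le_of_injective f hf).trans ?_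
  rw [Fintype.card_sigma]
  simp only [card_vector, Fintype.card_bool]
  rw [Fin.sum_univ_eq_sum_range (fun i => 2 ^ i), Nat.geomSum_eq le_rfl]
  simp

section Rounds

variable {m n₀ : ℕ}

/-- The instance can be subdivided `t` times. -/
def Deep (m n₀ : ℕ) : ℕ → ℕ → Prop
  | 0, _ => True
  | t + 1, n => Recurses m n₀ n ∧ Deep m n₀ t (subSize m n₀ n)

open Classical in
/-- The advantage over guessing that is lost in eliminating `t` messages. -/
def loss (m n₀ : ℕ) (δ : ℝ) : ℕ → ℕ → (ℕ → Prop) → ℝ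
  | 0, _, _ => 0
  -- An unbalanced level is charged `1`, which makes the bound on the success trivial.
  | t + 1, n, C => δ + (if Balanced m n₀ n C then 0 else 1) +
      (∑ j : Fin (branching m n₀), loss m n₀ δ t (subSize m n₀ n) (blockPart m n₀ n C j)) /
        branching m n₀

theorem loss_nonneg {δ : ℝ} (hδ : 0 ≤ δ) : ∀ (t n : ℕ) (C : ℕ → Prop), 0 ≤ loss m n₀ δ t n C
  | 0, _, _ => le_rfl
  | t + 1, n, C => by
    unfold loss
    have : 0 ≤ ∑ j : Fin (branching m n₀),
        loss m n₀ δ t (subSize m n₀ n) (blockPart m n₀ n C j) :=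
      sum_nonneg fun j _ => loss_nonneg hδ t _ _
    split_ifs <;> positivity

/-- Every elimination exchanges speaker and listener and hence negates `C`; the notion of balance is
symmetric. -/
theorem loss_not (δ : ℝ) : ∀ (t n : ℕ) (C : ℕ → Prop),
    loss m n₀ δ t n (fun a => ¬C a) = loss m n₀ δ t n C
  | 0, _, _ => rfl
  | t + 1, n, C => by
    have hsum : ∑ j : Fin (branching m n₀),
        loss m n₀ δ t (subSize m n₀ n) (blockPart m n₀ n (fun a => ¬C a) j) =
        ∑ j : Fin (branching m n₀), loss m n₀ δ t (subSize m n₀ n) (blockPart m n₀ n C j) :=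
      sum_congr rfl fun j _ => loss_not δ t _ (blockPart m n₀ n C j)
    rw [loss, loss, hsum]
    by_cases h : Balanced m n₀ n C
    · rw [if_pos h, if_pos ((balanced_not C).2 h)]
    · rw [if_neg h, if_neg (mt (balanced_not C).1 h)]

theorem Recurses.cube_le {n : ℕ} (hL : 2 ≤ Real.logb 2 n₀) (h : Recurses m n₀ n) :
    Real.logb 2 n₀ ^ 3 ≤ √(n : ℝ) := by
  have hk : (1 : ℝ) ≤ branching m n₀ := by exact_mod_cast h.1
  exact (le_mul_of_one_le_left (by positivity) hk).trans h.2

theorem Recurses.le_size {n : ℕ} (hL : 2 ≤ Real.logb 2 n₀) (h : Recurses m n₀ n) :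
    8 ≤ n ∧ 4 * coreSize m n₀ n ≤ n ∧ Real.logb 2 n₀ ^ 6 ≤ n := by
  have h3 := h.cube_le hL
  have h6 : Real.logb 2 n₀ ^ 6 ≤ n := by
    have := Real.sq_sqrt (Nat.cast_nonneg (α := ℝ) n)
    rw [← this, show Real.logb 2 n₀ ^ 6 = (Real.logb 2 n₀ ^ 3) ^ 2 by ring]
    gcongr
  have h8 : (64 : ℝ) ≤ n := by
    refine le_trans ?_ h6
    calc (64 : ℝ) = 2 ^ 6 := by norm_num
      _ ≤ _ := by gcongr
  have hco := coreSize_mul_le (m := m) (n := n) hL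
  have hs1 : √(n : ℝ) ≤ n := by
    rw [Real.sqrt_le_left (by positivity)]; nlinarith
  refine ⟨by exact_mod_cast (by linarith : (8 : ℝ) ≤ n), ?_, h6⟩
  have : (4 : ℝ) * coreSize m n₀ n ≤ n := by
    have : (4 : ℝ) ≤ Real.logb 2 n₀ ^ 2 := by nlinarith
    nlinarith [mul_le_mul_of_nonneg_left this (Nat.cast_nonneg (α := ℝ) (coreSize m n₀ n))]
  exact_mod_cast this

/-- A protocol with few messages hardly does better than guessing, for every partition of the
pairs with small loss. -/
theorem success_le_loss {m' T : ℕ} {ε : ℝ} (hL : 2 ≤ Real.logb 2 n₀) (hε : 0 < ε)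
    (hT : 8 * Real.log (((2 ^ (m' + 1)) ^ T : ℕ) : ℝ) ≤ branching m n₀ * ε ^ 2) (t : ℕ) :
    ∀ (n : ℕ) (C : ℕ → Prop) (V : Type) [Fintype V] [Nonempty V] (msg : Finset ℕ → V)
      (next : V → Finset ℕ → Finset ℕ → Bool), Even n → Deep m n₀ (t + 1) n →
      Fintype.card V * (2 ^ (m' + 1)) ^ t ≤ (2 ^ (m' + 1)) ^ T →
      (∀ v, Realizable m' t (Finset ℕ) (Finset ℕ) (next v)) →
      success m n₀ n C (fun x y => next (msg x) y x) ≤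
        1 / 2 + loss m n₀ (ε + 2 * (128 / Real.logb 2 n₀ ^ 2)) (t + 1) n C := by
  have hδ : 0 ≤ ε + 2 * (128 / Real.logb 2 n₀ ^ 2) := by positivity
  induction t with
  | zero =>
    intro n C V _ _ msg next hn hdeep hV hnext
    rw [loss]
    by_cases hbal : Balanced m n₀ n C
    · have hsize := hdeep.1.le_size hL
      choose β hβ using fun v => hnext v
      have hc : 8 * Real.log (Fintype.card V) ≤ branching m n₀ * ε ^ 2 := by
        refine le_trans ?_ hT
        gcongr
        simpa using hV
      have := eliminate_last_message hL hdeep.1 hn hbal.1 hε hc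
        (shellClose_of_balanced hL hsize.1 hsize.2.1 hbal) msg β
      simp only [hβ, if_pos hbal, loss]
      simpa using this
    · rw [if_neg hbal]
      have h1 : success m n₀ n C (fun x y => next (msg x) y x) ≤ 1 := prob_le_one _ _
      simp only [loss, sum_const_zero, zero_div]
      linarith
  | succ t ih =>
    intro n C V _ _ msg next hn hdeep hV hnext
    rw [loss]
    by_cases hbal : Balanced m n₀ n C
    · have hsize := hdeep.1.le_size hL
      have hc : 8 * Real.log (Fintype.card V) ≤ branching m n₀ * ε ^ 2 := by
        refine le_trans ?_ hT
        gcongr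
        exact (Nat.le_mul_of_pos_right _ (by positivity)).trans hV
      have hk : (0 : ℝ) < branching m n₀ := Nat.cast_pos.2 hdeep.1.branching_pos
      have := eliminate_message hdeep.1 hn (two_le_subSize hL hdeep.1) hbal.1 hε hc
        (shellClose_of_balanced hL hsize.1 hsize.2.1 hbal) msg next hnext
        (fun j => 1 / 2 + loss m n₀ (ε + 2 * (128 / Real.logb 2 n₀ ^ 2)) (t + 1)
          (subSize m n₀ n) (blockPart m n₀ n C j)) (by
          intro j msg' next' hn'
          rw [← loss_not]
          -- The new first message ranges over `V × Message m'`. One factor `2 ^ (m' + 1)` moves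
          -- from the messages still to come into the alphabet, so the bound `hV` persists.
          refine ih _ _ _ msg' next' (even_subSize _ _ _) hdeep.2 ?_ hn'
          rw [Fintype.card_prod]
          refine le_trans ?_ hV
          rw [pow_succ' _ t, ← mul_assoc]
          gcongr
          exact card_message_le m')
      refine this.trans (le_of_eq ?_)
      rw [sum_add_distrib, sum_const, card_univ, Fintype.card_fin, nsmul_eq_mul, add_div,
        mul_div_cancel_left₀ _ hk.ne', if_pos hbal]
      ring
    · rw [if_neg hbal]
      have h1 : success m n₀ n C (fun x y => next (msg x) y x) ≤ 1 := prob_le_one _ _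
      have h2 : 0 ≤ ∑ j : Fin (branching m n₀),
          loss m n₀ (ε + 2 * (128 / Real.logb 2 n₀ ^ 2)) (t + 1) (subSize m n₀ n)
            (blockPart m n₀ n C j) := sum_nonneg fun j _ => loss_nonneg hδ _ _ _
      have h3 := div_nonneg h2 (Nat.cast_nonneg (α := ℝ) (branching m n₀))
      linarith

end Rounds

/-! ### The random partition -/

section Pairing

variable {m n₀ : ℕ}

open Classical in
theorem pairing_of_recurses {n : ℕ} (h : Recurses m n₀ n) : pairing m n₀ n =
    (shell m n₀ n).image (fun i => (i, 2 * n + 1 - i)) ∪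
      (Finset.range (branching m n₀)).biUnion fun j =>
        (pairing m n₀ (subSize m n₀ n)).image fun p =>
          (blockShift m n₀ n j + p.1, blockShift m n₀ n j + p.2) := by
  rw [pairing, dif_pos h]
  rfl

theorem mem_pairing {n : ℕ} (h : Recurses m n₀ n) {p : ℕ × ℕ} : p ∈ pairing m n₀ n ↔
    (∃ i ∈ shell m n₀ n, p = (i, 2 * n + 1 - i)) ∨
      ∃ j < branching m n₀, ∃ q ∈ pairing m n₀ (subSize m n₀ n),
        p = (blockShift m n₀ n j + q.1, blockShift m n₀ n j + q.2) := by
  classical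
  rw [pairing_of_recurses h]
  simp only [mem_union, mem_image, mem_biUnion, mem_range, eq_comm]

theorem mem_pairing_range (n : ℕ) : ∀ p ∈ pairing m n₀ n,
    1 ≤ p.1 ∧ p.1 ≤ 2 * n ∧ 1 ≤ p.2 ∧ p.2 ≤ 2 * n := by
  induction n using Nat.strong_induction_on with
  | _ n ih =>
    intro p hp
    by_cases h : Recurses m n₀ n
    · have hle := coreSize_le m n₀ n
      rcases (mem_pairing h).1 hp with ⟨i, hi, rfl⟩ | ⟨j, hj, q, hq, rfl⟩
      · have := mem_Icc.1 hi
        simp only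
        omega
      · have hq' := ih _ (subSize_lt h) q hq
        have h1 := blockShift_add_le (n := n) ⟨j, hj⟩ hq'.2.1
        have h2 := blockShift_add_le (n := n) ⟨j, hj⟩ hq'.2.2.2
        simp only at h1 h2 ⊢
        omega
    · rw [pairing, dif_neg h] at hp
      obtain ⟨i, hi, rfl⟩ := mem_image.1 hp
      have := mem_range.1 hi
      simp only
      omega

/-- The value `a` belongs to the pair `p`. -/
def InPair (a : ℕ) (p : ℕ × ℕ) : Prop := a = p.1 ∨ a = p.2

theorem pairing_disjoint (n : ℕ) : ∀ p ∈ pairing m n₀ n, ∀ q ∈ pairing m n₀ n, ∀ a,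
    InPair a p → InPair a q → p = q := by
  induction n using Nat.strong_induction_on with
  | _ n ih =>
    intro p hp q hq a hap haq
    unfold InPair at hap haq
    by_cases h : Recurses m n₀ n
    · have hle := coreSize_le m n₀ n
      have key : ∀ i ∈ shell m n₀ n, ∀ j < branching m n₀,
          ∀ r ∈ pairing m n₀ (subSize m n₀ n), (a = i ∨ a = 2 * n + 1 - i) →
          (a = blockShift m n₀ n j + r.1 ∨ a = blockShift m n₀ n j + r.2) → False := by
        intro i hi j hj r hr h1 h2
        have hi' := mem_Icc.1 hi
        have hr' := mem_pairing_range _ r hr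
        have h3 := blockShift_add_le (n := n) ⟨j, hj⟩ hr'.2.1
        have h4 := blockShift_add_le (n := n) ⟨j, hj⟩ hr'.2.2.2
        have h5 : n - coreSize m n₀ n ≤ blockShift m n₀ n j := Nat.le_add_right _ _
        simp only at h3 h4
        omega
      rcases (mem_pairing h).1 hp with ⟨i, hi, rfl⟩ | ⟨j, hj, r, hr, rfl⟩
      · rcases (mem_pairing h).1 hq with ⟨i', hi', rfl⟩ | ⟨j', hj', r', hr', rfl⟩
        · have h1 := mem_Icc.1 hi
          have h2 := mem_Icc.1 hi'
          have : i = i' := by simp only at hap haq; omega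
          rw [this]
        · exact (key i hi j' hj' r' hr' hap haq).elim
      · rcases (mem_pairing h).1 hq with ⟨i', hi', rfl⟩ | ⟨j', hj', r', hr', rfl⟩
        · exact (key i' hi' j hj r hr haq hap).elim
        · have h1 := mem_pairing_range _ r hr
          have h2 := mem_pairing_range _ r' hr'
          simp only at hap haq
          have hjj : j = j' := by
            rcases lt_trichotomy j j' with hlt | heq | hlt
            · have h3 := blockShift_lt (m := m) (n₀ := n₀) (n := n) hlt h1.2.1
              have h4 := blockShift_lt (m := m) (n₀ := n₀) (n := n) hlt h1.2.2.2
              omega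
            · exact heq
            · have h3 := blockShift_lt (m := m) (n₀ := n₀) (n := n) hlt h2.2.1
              have h4 := blockShift_lt (m := m) (n₀ := n₀) (n := n) hlt h2.2.2.2
              omega
          subst hjj
          have := ih _ (subSize_lt h) r hr r' hr' (a - blockShift m n₀ n j)
            (by unfold InPair; omega) (by unfold InPair; omega)
          rw [this]
    · rw [pairing, dif_neg h] at hp hq
      obtain ⟨i, hi, rfl⟩ := mem_image.1 hp
      obtain ⟨j, hj, rfl⟩ := mem_image.1 hq
      have : i = j := by simp only at hap haq; omega
      rw [this]

/-- The values in the pairs of `P`. -/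
def covered (P : Finset (ℕ × ℕ)) (a : ℕ) : Prop := ∃ p ∈ P, InPair a p

/-- Nested blocks are addressed by one offset `o` into the whole instance, so that a single random
set of pairs serves all levels. -/
theorem loss_shift (δ : ℝ) (t n : ℕ) (C : ℕ → Prop) (o j : ℕ) :
    loss m n₀ δ t (subSize m n₀ n) (blockPart m n₀ n (fun a => C (o + a)) j) =
      loss m n₀ δ t (subSize m n₀ n) (fun a => C (o + blockShift m n₀ n j + a)) := by
  congr 1
  ext a
  unfold blockPart
  rw [add_assoc]

open Classical in
/-- A random half of the pairs is balanced on a large shell. -/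
theorem unbalanced_le {n o : ℕ} (h : Recurses m n₀ n) (hN : 4 ≤ (shell m n₀ n).card)
    (Q : Finset (ℕ × ℕ))
    (hdis : ∀ p ∈ Q, ∀ q ∈ Q, ∀ a, InPair a p → InPair a q → p = q)
    (hsub : ∀ p ∈ pairing m n₀ n, (o + p.1, o + p.2) ∈ Q) :
    subsetAvg Q (Q.card / 2)
      (fun P => if Balanced m n₀ n (fun a => covered P (o + a)) then 0 else 1) ≤
      16 / (shell m n₀ n).card := by
  let pr : ℕ → ℕ × ℕ := fun i => (o + i, o + (2 * n + 1 - i))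
  have hprQ : ∀ i ∈ shell m n₀ n, pr i ∈ Q := fun i hi =>
    hsub (i, 2 * n + 1 - i) ((mem_pairing h).2 (Or.inl ⟨i, hi, rfl⟩))
  have hinj : Set.InjOn pr (shell m n₀ n) := by
    intro i _ j _ hij
    have := congrArg Prod.fst hij
    simpa [pr] using this
  let W := (shell m n₀ n).image pr
  have hWQ : W ⊆ Q := by
    intro p hp
    obtain ⟨i, hi, rfl⟩ := mem_image.1 hp
    exact hprQ i hi
  have hWc : W.card = (shell m n₀ n).card := card_image_of_injOn hinj
  set w : ℝ := ((shell m n₀ n).card : ℝ) with hw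
  set K : ℝ := (Q.card : ℝ) with hK
  have hwK : w ≤ K := by
    rw [hw, hK, ← hWc]; exact Nat.cast_le.2 (card_le_card hWQ)
  have hw4 : (4 : ℝ) ≤ w := by
    have : ((4 : ℕ) : ℝ) ≤ ((shell m n₀ n).card : ℝ) := Nat.cast_le.2 hN
    rwa [Nat.cast_ofNat] at this
  have hs2 : K ≤ 2 * ((Q.card / 2 : ℕ) : ℝ) + 1 := by
    have : Q.card ≤ 2 * (Q.card / 2) + 1 := by omega
    have : (Q.card : ℝ) ≤ ((2 * (Q.card / 2) + 1 : ℕ) : ℝ) := Nat.cast_le.2 this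
    push_cast at this ⊢
    exact this
  have hs1 : 2 * ((Q.card / 2 : ℕ) : ℝ) ≤ K := by
    have : 2 * (Q.card / 2) ≤ Q.card := by omega
    have : ((2 * (Q.card / 2) : ℕ) : ℝ) ≤ (Q.card : ℝ) := Nat.cast_le.2 this
    push_cast at this ⊢
    exact this
  set s : ℝ := ((Q.card / 2 : ℕ) : ℝ) with hs
  have hKpos : 0 < K := by linarith
  have hmean1 : s * w / K ≤ w / 2 := by
    rw [div_le_div_iff₀ hKpos (by norm_num)]; nlinarith
  have hmean2 : w / 2 - 1 / 2 ≤ s * w / K := by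
    rw [le_div_iff₀ hKpos]; nlinarith
  -- Chebyshev's inequality in pointwise form: an unbalanced `P` misses the mean of `|P ∩ W|` by at
  -- least `w / 4`.
  have hpt : ∀ P ∈ powersetCard (Q.card / 2) Q,
      (if Balanced m n₀ n (fun a => covered P (o + a)) then (0 : ℝ) else 1) ≤
      (16 / w ^ 2) * (((P ∩ W).card : ℝ) - s * W.card / K) ^ 2 := by
    intro P hP
    have hPQ := (mem_powersetCard.1 hP).1
    split_ifs with hb
    · positivity
    have hcov : ∀ i ∈ shell m n₀ n, ∀ a, InPair a (pr i) → (covered P a ↔ pr i ∈ P) := by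
      intro i hi a ha
      constructor
      · rintro ⟨p, hp, hap⟩
        rwa [hdis (pr i) (hprQ i hi) p (hPQ hp) a ha hap]
      · exact fun hp => ⟨_, hp, ha⟩
    have hcount : (part (fun a => covered P (o + a)) (shell m n₀ n)).card = (P ∩ W).card := by
      rw [← card_image_of_injOn (s := part (fun a => covered P (o + a)) (shell m n₀ n)) (f := pr)
        (hinj.mono (by intro a ha; exact (mem_part.1 ha).1))]
      congr 1
      ext p
      simp only [mem_image, mem_part, mem_inter, W]
      constructor
      · rintro ⟨i, ⟨hi, hc⟩, rfl⟩
        exact ⟨(hcov i hi _ (Or.inl rfl)).1 hc, i, hi, rfl⟩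
      · rintro ⟨hp, i, hi, rfl⟩
        exact ⟨i, ⟨hi, (hcov i hi _ (Or.inl rfl)).2 hp⟩, rfl⟩
    have hcount' : (part (fun a => covered P (o + a)) (shell m n₀ n)).card +
        (part (fun a => ¬covered P (o + a)) (shell m n₀ n)).card = (shell m n₀ n).card := by
      unfold part
      rw [← card_filter_add_card_filter_not (s := shell m n₀ n) fun a => covered P (o + a)]
      congr!
    have hresp : ∀ i ∈ shell m n₀ n, (covered P (o + (2 * n + 1 - i)) ↔ covered P (o + i)) :=
      fun i hi => (hcov i hi _ (Or.inr rfl)).trans (hcov i hi _ (Or.inl rfl)).symm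
    -- One player has fewer than `w / 8` of the shell pairs, while the mean lies in `[w/2 - 1/2,
    -- w/2]`; `4 ≤ w` absorbs the `1/2` due to rounding half of `|Q|`.
    have hdev : w / 4 ≤ |((P ∩ W).card : ℝ) - s * w / K| := by
      rw [← hcount]
      have hnb : ¬((shell m n₀ n).card ≤ 8 *
          (part (fun a => covered P (o + a)) (shell m n₀ n)).card ∧
          (shell m n₀ n).card ≤ 8 *
          (part (fun a => ¬covered P (o + a)) (shell m n₀ n)).card) := fun hh => hb ⟨hresp, hh⟩
      rw [not_and_or, not_le, not_le] at hnb
      have hcR : ((part (fun a => covered P (o + a)) (shell m n₀ n)).card : ℝ) +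
        ((part (fun a => ¬covered P (o + a)) (shell m n₀ n)).card : ℝ) = w := by
        rw [hw, ← hcount']; push_cast; ring
      rcases hnb with h1 | h1
      · have h1R : 8 * ((part (fun a => covered P (o + a)) (shell m n₀ n)).card : ℝ) < w := by
          have := (Nat.cast_lt (α := ℝ)).2 h1
          push_cast at this; exact this
        rw [abs_sub_comm]
        refine le_trans ?_ (le_abs_self _)
        linarith
      · have h1R : 8 * ((part (fun a => ¬covered P (o + a)) (shell m n₀ n)).card : ℝ) < w := by
          have := (Nat.cast_lt (α := ℝ)).2 h1
          push_cast at this; exact this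
        refine le_trans ?_ (le_abs_self _)
        linarith
    rw [hWc, ← hw, ← sq_abs (_ - _)]
    calc (1 : ℝ) = (16 / w ^ 2) * (w / 4) ^ 2 := by
          have : w ≠ 0 := by linarith
          field_simp; norm_num
      _ ≤ _ := by gcongr
  have hvar := hypergeometric_variance Q W hWQ (Q.card / 2) (Nat.div_le_self _ _)
  have hC : (0 : ℝ) < (powersetCard (Q.card / 2) Q).card := by
    rw [card_powersetCard]; exact Nat.cast_pos.2 (Nat.choose_pos (Nat.div_le_self _ _))
  unfold subsetAvg
  rw [div_le_iff₀ hC]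
  refine (sum_le_sum hpt).trans ?_
  rw [← mul_sum]
  calc _ ≤ (16 / w ^ 2) * (W.card * (powersetCard (Q.card / 2) Q).card) := by gcongr
    _ = _ := by
      rw [hWc, ← hw]
      have : w ≠ 0 := by linarith
      field_simp

theorem subsetAvg_sum {α ι : Type*} (U : Finset α) (s : ℕ) (t : Finset ι)
    (c : ι → Finset α → ℝ) :
    subsetAvg U s (fun S => ∑ j ∈ t, c j S) = ∑ j ∈ t, subsetAvg U s (c j) := by
  unfold subsetAvg; rw [Finset.sum_comm, sum_div]

theorem subsetAvg_div {α : Type*} (U : Finset α) (s : ℕ) (c : Finset α → ℝ) (a : ℝ) :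
    subsetAvg U s (fun S => c S / a) = subsetAvg U s c / a := by
  unfold subsetAvg; rw [← sum_div, div_right_comm]

/-- The expected loss over the random partition. -/
theorem avg_loss_le {δ : ℝ} (hL : 2 ≤ Real.logb 2 n₀) (Q : Finset (ℕ × ℕ))
    (hdis : ∀ p ∈ Q, ∀ q ∈ Q, ∀ a, InPair a p → InPair a q → p = q) (t : ℕ) :
    ∀ n o : ℕ, Deep m n₀ t n → (∀ p ∈ pairing m n₀ n, (o + p.1, o + p.2) ∈ Q) →
    subsetAvg Q (Q.card / 2) (fun P => loss m n₀ δ t n fun a => covered P (o + a)) ≤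
      t * (δ + 32 / Real.logb 2 n₀ ^ 2) := by
  classical
  induction t with
  | zero =>
    intro n o _ _
    simp only [loss, subsetAvg_const (Nat.div_le_self Q.card 2)]
    simp
  | succ t ih =>
    intro n o hdeep hsub
    have hsize := hdeep.1.le_size hL
    have hk : (0 : ℝ) < branching m n₀ := Nat.cast_pos.2 hdeep.1.branching_pos
    have hN : 4 ≤ (shell m n₀ n).card := by rw [card_shell]; omega
    have hub := unbalanced_le (o := o) hdeep.1 hN Q hdis hsub
    have hw : (16 : ℝ) / (shell m n₀ n).card ≤ 32 / Real.logb 2 n₀ ^ 2 := by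
      have h1 : (n : ℝ) ≤ 2 * (shell m n₀ n).card := by
        have : n ≤ 2 * (shell m n₀ n).card := by rw [card_shell]; omega
        exact_mod_cast this
      have h2 : Real.logb 2 n₀ ^ 2 ≤ Real.logb 2 n₀ ^ 6 :=
        pow_le_pow_right₀ (by linarith) (by norm_num)
      rw [div_le_div_iff₀ (Nat.cast_pos.2 (by omega)) (by positivity)]
      linarith [hsize.2.2]
    have hsum : ∀ j : Fin (branching m n₀), subsetAvg Q (Q.card / 2) (fun P =>
        loss m n₀ δ t (subSize m n₀ n)
          (blockPart m n₀ n (fun a => covered P (o + a)) j)) ≤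
        t * (δ + 32 / Real.logb 2 n₀ ^ 2) := by
      intro j
      simp only [loss_shift]
      refine ih _ _ hdeep.2 fun p hp => ?_
      have := hsub _ ((mem_pairing hdeep.1).2 (Or.inr ⟨j, j.2, p, hp, rfl⟩))
      simpa only [add_assoc] using this
    -- The loss is additive, so linearity suffices: balance at different levels and in different
    -- blocks need not be independent.
    have hunfold : subsetAvg Q (Q.card / 2)
        (fun P => loss m n₀ δ (t + 1) n fun a => covered P (o + a)) =
        δ + subsetAvg Q (Q.card / 2)
          (fun P => if Balanced m n₀ n (fun a => covered P (o + a)) then 0 else 1) +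
        (∑ j : Fin (branching m n₀), subsetAvg Q (Q.card / 2) (fun P =>
          loss m n₀ δ t (subSize m n₀ n)
            (blockPart m n₀ n (fun a => covered P (o + a)) j))) / branching m n₀ := by
      simp only [loss]
      rw [subsetAvg_add, subsetAvg_add, subsetAvg_const (Nat.div_le_self _ _), subsetAvg_div,
        subsetAvg_sum]
    rw [hunfold]
    have hdiv : (∑ j : Fin (branching m n₀), subsetAvg Q (Q.card / 2) (fun P =>
          loss m n₀ δ t (subSize m n₀ n)
            (blockPart m n₀ n (fun a => covered P (o + a)) j))) / branching m n₀ ≤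
        t * (δ + 32 / Real.logb 2 n₀ ^ 2) := by
      rw [div_le_iff₀ hk]
      refine (sum_le_sum fun j _ => hsum j).trans (le_of_eq ?_)
      rw [sum_const, card_univ, Fintype.card_fin, nsmul_eq_mul, mul_comm]
    push_cast
    linarith

end Pairing

/-! ### Protocols and their error -/

theorem success_swap {m n₀ n : ℕ} (C : ℕ → Prop) (F : Finset ℕ → Finset ℕ → Bool) :
    success m n₀ n (fun a => ¬C a) (fun y x => F x y) = success m n₀ n C F := by
  unfold success
  simp only [part_not_not]

theorem Realizable.success_le {m n₀ n t : ℕ} {F : Finset ℕ → Finset ℕ → Bool}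
    (hF : Realizable m t (Finset ℕ) (Finset ℕ) F) {ε : ℝ} (hL : 2 ≤ Real.logb 2 n₀) (hε : 0 < ε)
    (hT : 8 * Real.log (((2 ^ (m + 1)) ^ t : ℕ) : ℝ) ≤ branching m n₀ * ε ^ 2)
    (hn : Even n) (h2 : 2 ≤ n) (hdeep : Deep m n₀ t n) (C : ℕ → Prop) :
    success m n₀ n C F ≤ 1 / 2 + loss m n₀ (ε + 2 * (128 / Real.logb 2 n₀ ^ 2)) t n C := by
  cases t with
  | zero =>
    obtain ⟨b, hb⟩ := hF
    unfold success loss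
    simp only [hb, prob_medianBit hL n hn h2]
    norm_num
  | succ t =>
    obtain ⟨msg, next, hnext, hF⟩ := hF
    obtain rfl : F = fun x y => next (msg x) y x := funext fun x => funext fun y => hF x y
    refine success_le_loss hL hε hT t n C _ msg next hn hdeep ?_ hnext
    rw [pow_succ' _ t]
    exact Nat.mul_le_mul_right _ (card_message_le m)

theorem Protocol.success_le {m n₀ n t : ℕ} {p : Player}
    (π : Protocol (Finset ℕ) (Finset ℕ) m p t) {ε : ℝ} (hL : 2 ≤ Real.logb 2 n₀) (hε : 0 < ε)
    (hT : 8 * Real.log (((2 ^ (m + 1)) ^ t : ℕ) : ℝ) ≤ branching m n₀ * ε ^ 2)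
    (hn : Even n) (h2 : 2 ≤ n) (hdeep : Deep m n₀ t n) (C : ℕ → Prop) :
    success m n₀ n C (fun x y => π.run x y) ≤
      1 / 2 + loss m n₀ (ε + 2 * (128 / Real.logb 2 n₀ ^ 2)) t n C := by
  cases p with
  | alice => exact (π.realizable.1 rfl).success_le hL hε hT hn h2 hdeep C
  | bob =>
    rw [← success_swap, ← loss_not]
    exact (π.realizable.2 rfl).success_le hL hε hT hn h2 hdeep _

/-- The set and the partition are independent, so the partition can be drawn first and the
elimination carried out for each fixed partition. -/
theorem errorProb_eq (n : ℕ) {m t : ℕ} {p : Player}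
    (π : Protocol (Finset ℕ) (Finset ℕ) m p t) :
    errorProb n π = 1 - subsetAvg (pairing m n n) ((pairing m n n).card / 2)
      (fun P => success m n n (covered P) fun x y => π.run x y) := by
  have hA : ∀ A P, aliceInput A P = part (covered P) A := by
    intro A P
    ext a
    simp only [aliceInput, mem_filter, mem_part, covered, InPair]
  have hB : ∀ A P, bobInput A P = part (fun a => ¬covered P a) A := by
    intro A P
    ext a
    simp only [bobInput, mem_sdiff, hA, mem_part]
    tauto
  have hswap : inputDist m n =
      (splitDist m n).bind fun P => (hardDist m n n).map fun A => (A, P) := by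
    unfold inputDist
    simp only [← PMF.bind_pure_comp, Function.comp_def]
    rw [PMF.bind_comm]
  have hP : ∀ P, prob ((hardDist m n n).map fun A => (A, P))
      {ω | π.run (aliceInput ω.1 ω.2) (bobInput ω.1 ω.2) ≠ medianBit ω.1} =
      1 - success m n n (covered P) fun x y => π.run x y := by
    intro P
    rw [prob_map, success, ← prob_compl]
    congr 1
    ext A
    simp only [Set.mem_preimage, Set.mem_ofPred_eq, Set.mem_compl_iff, hA, hB]
  change prob (inputDist m n) _ = _
  rw [hswap, splitDist, prob_bind_uniform]
  simp only [hP]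
  have hC : ((powersetCard ((pairing m n n).card / 2) (pairing m n n)).card : ℝ) ≠ 0 :=
    Nat.cast_ne_zero.2 (card_pos.2 (halves_nonempty _)).ne'
  rw [sum_sub_distrib, sub_div, sum_const, nsmul_eq_mul, mul_one, div_self hC]
  rfl

/-- Per level, `288 = 2 · 128 + 32`: the dependence of the shell on the block, and the probability
of an unbalanced partition. -/
theorem half_sub_le_errorProb {m n t : ℕ} {p : Player}
    (π : Protocol (Finset ℕ) (Finset ℕ) m p t) {ε : ℝ} (hL : 2 ≤ Real.logb 2 n) (hε : 0 < ε)
    (hT : 8 * Real.log (((2 ^ (m + 1)) ^ t : ℕ) : ℝ) ≤ branching m n * ε ^ 2)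
    (hn : Even n) (h2 : 2 ≤ n) (hdeep : Deep m n t n) :
    1 / 2 - t * (ε + 288 / Real.logb 2 n ^ 2) ≤ errorProb n π := by
  have hs := subsetAvg_mono (U := pairing m n n) (s := (pairing m n n).card / 2)
    (fun P _ => π.success_le hL hε hT hn h2 hdeep (covered P))
  rw [subsetAvg_add, subsetAvg_const (Nat.div_le_self _ _)] at hs
  have hl := avg_loss_le (m := m) (δ := ε + 2 * (128 / Real.logb 2 n ^ 2)) hL (pairing m n n)
    (pairing_disjoint n) t n 0 hdeep (fun p hp => by simpa using hp)
  simp only [zero_add] at hl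
  rw [errorProb_eq]
  have : ε + 2 * (128 / Real.logb 2 n ^ 2) + 32 / Real.logb 2 n ^ 2 =
      ε + 288 / Real.logb 2 n ^ 2 := by ring
  rw [this] at hl
  linarith

/-! ### Parameters -/

/-- A size that allows `r` subdivisions. -/
def sizeBound (m : ℕ) (L : ℝ) : ℕ → ℝ
  | 0 => L
  | r + 1 => (m * L ^ 4 * sizeBound m L r) ^ 2

theorem sizeBound_eq (m : ℕ) (L : ℝ) (r : ℕ) :
    sizeBound m L r = m ^ (2 ^ (r + 1) - 2) * L ^ (9 * 2 ^ r - 8) := by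
  induction r with
  | zero => simp [sizeBound]
  | succ r ih =>
    have h1 : 1 ≤ 2 ^ r := Nat.one_le_two_pow
    rw [sizeBound, ih]
    have e1 : 2 ^ (r + 1 + 1) - 2 = 2 + 2 * (2 ^ (r + 1) - 2) := by rw [pow_succ, pow_succ]; omega
    have e2 : 9 * 2 ^ (r + 1) - 8 = 8 + 2 * (9 * 2 ^ r - 8) := by rw [pow_succ]; omega
    rw [e1, e2]
    generalize 2 ^ (r + 1) - 2 = a
    generalize 9 * 2 ^ r - 8 = b
    ring

theorem le_sizeBound {m : ℕ} {L : ℝ} (hm : (1 : ℝ) ≤ m) (hL : 1 ≤ L) :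
    ∀ r, L ≤ sizeBound m L r
  | 0 => le_rfl
  | r + 1 => by
    have ih := le_sizeBound hm hL r
    have h1 : L ≤ m * L ^ 4 * sizeBound m L r := by
      have : 1 ≤ (m : ℝ) * L ^ 4 := one_le_mul_of_one_le_of_one_le hm (one_le_pow₀ hL)
      nlinarith
    rw [sizeBound]
    nlinarith

/-- Up to rounding, `n' = √n / (m L⁴)`, and `sizeBound` inverts this; its initial value `L` is what
`√n ≥ k L³` demands at the last subdivision. The relative slack `τ` pays for rounding. The square
root leaves `τ / 3`, since `(1 + τ/3)² ≤ 1 + τ`. Rounding `k` up and `n'` down costs `δ = 1 / L³ ≤ τ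
/ 60` each, and `τ / 4` is passed on. The condition on `4 ^ r` keeps the slack well above `δ` at all
levels. -/
theorem deep_of_sizeBound_le {m n₀ : ℕ} (hL : 60 ≤ Real.logb 2 n₀) (hm : Real.logb 2 n₀ ≤ m)
    (r : ℕ) : ∀ (n : ℕ) (τ : ℝ), τ ≤ 1 → (4 : ℝ) ^ r ≤ Real.logb 2 n₀ ^ 2 * τ →
      (1 + τ) * sizeBound m (Real.logb 2 n₀) r ≤ n → Deep m n₀ r n := by
  induction r with
  | zero => exact fun _ _ _ _ _ => trivial
  | succ r ih =>
    intro n τ hτ1 hτ hn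
    set L := Real.logb 2 n₀ with hLdef
    have hm1 : (1 : ℝ) ≤ m := by linarith
    have hL0 : (0 : ℝ) < L := by linarith
    have hB := le_sizeBound hm1 (by linarith : 1 ≤ L) r
    set B := sizeBound m L r with hBdef
    have hB0 : 0 < B := by linarith
    have hτL : 4 / L ^ 2 ≤ τ := by
      rw [div_le_iff₀ (by positivity)]
      have : (1 : ℝ) ≤ 4 ^ r := one_le_pow₀ (by norm_num)
      rw [pow_succ] at hτ
      linarith
    have hτ0 : 0 < τ := lt_of_lt_of_le (by positivity) hτL
    have hδ : 1 / L ^ 3 ≤ τ / 60 := by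
      calc 1 / L ^ 3 = 1 / L * (1 / L ^ 2) := by field_simp
        _ ≤ 1 / 60 * (4 / L ^ 2) := by gcongr; norm_num
        _ ≤ 1 / 60 * τ := by gcongr
        _ = τ / 60 := by ring
    have hδ0 : 0 < 1 / L ^ 3 := by positivity
    have hδ1 : 1 / L ^ 3 * L ^ 3 = 1 := by field_simp
    set δ := 1 / L ^ 3 with hδdef
    have hsqrt : (1 + τ / 3) * (m * L ^ 4 * B) ≤ √(n : ℝ) := by
      apply Real.le_sqrt_of_sq_le
      refine le_trans ?_ hn
      rw [sizeBound, ← hBdef, mul_pow]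
      gcongr
      nlinarith
    have hk : (branching m n₀ : ℝ) ≤ m * L ^ 2 * (1 + δ) := by
      have h1 := (Nat.ceil_lt_add_one (a := (m : ℝ) * L ^ 2) (by positivity)).le
      have h2 : 1 ≤ m * L ^ 2 * δ := by
        calc (1 : ℝ) = L * L ^ 2 * δ := by rw [← hδ1]; ring
          _ ≤ _ := by gcongr
      unfold branching
      linarith
    have hk0 : 0 < branching m n₀ := by
      unfold branching; exact Nat.ceil_pos.2 (by positivity)
    have hkR : (0 : ℝ) < branching m n₀ := Nat.cast_pos.2 hk0
    refine ⟨⟨hk0, ?_⟩, ?_⟩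
    · refine le_trans ?_ hsqrt
      calc branching m n₀ * L ^ 3 ≤ m * L ^ 2 * (1 + δ) * L ^ 3 := by gcongr
        _ = (1 + δ) * (m * L ^ 4 * L) := by ring
        _ ≤ (1 + τ / 3) * (m * L ^ 4 * B) := by gcongr; linarith
    -- After the last subdivision nothing is required. Otherwise `B ≥ L ^ 10`, and the loss of up to
    -- two units in rounding `n'` to an even integer is at most `δ * B`.
    · rcases r with _ | r
      · trivial
      refine ih _ (τ / 4) (by linarith) (by rw [pow_succ] at hτ; linarith) ?_
      have hB2 : 2 ≤ δ * B := by
        have h1 := le_sizeBound hm1 (by linarith : 1 ≤ L) r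
        have h2 : L ^ 5 ≤ m * L ^ 4 * sizeBound m L r := by
          calc L ^ 5 = 1 * L ^ 4 * L := by ring
            _ ≤ _ := by gcongr
        have h3 : L ^ 10 ≤ B := by
          rw [hBdef, sizeBound, show L ^ 10 = (L ^ 5) ^ 2 by ring]
          gcongr
        have h4 : δ * L ^ 10 = L ^ 7 := by
          calc δ * L ^ 10 = (δ * L ^ 3) * L ^ 7 := by ring
            _ = _ := by rw [hδ1, one_mul]
        have h5 : L ≤ L ^ 7 := le_self_pow₀ (by linarith) (by norm_num)
        nlinarith
      have hfl : √(n : ℝ) / (branching m n₀ * L ^ 2) - 2 ≤ subSize m n₀ n := by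
        have := (Nat.lt_floor_add_one (√(n : ℝ) / (2 * branching m n₀ * L ^ 2))).le
        unfold subSize
        rw [← hLdef]
        push_cast
        have h2 : √(n : ℝ) / (branching m n₀ * L ^ 2) =
            2 * (√(n : ℝ) / (2 * branching m n₀ * L ^ 2)) := by field_simp
        rw [h2]
        linarith
      have hquot : (1 + τ / 4 + δ) * B ≤ √(n : ℝ) / (branching m n₀ * L ^ 2) := by
        rw [le_div_iff₀ (by positivity)]
        refine le_trans ?_ hsqrt
        calc (1 + τ / 4 + δ) * B * (branching m n₀ * L ^ 2)
            ≤ (1 + τ / 4 + δ) * B * (m * L ^ 2 * (1 + δ) * L ^ 2) := by gcongr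
          _ = (1 + τ / 4 + δ) * (1 + δ) * (m * L ^ 4 * B) := by ring
          _ ≤ _ := by
            gcongr
            nlinarith
      linarith

/-- The ratio of `(t + 1) ^ 4` to `2 ^ t` is largest at `t = 5`, where it is `40.5`. -/
theorem succ_pow_four_le (t : ℕ) : (t + 1) ^ 4 ≤ 41 * 2 ^ t := by
  rcases lt_or_ge t 5 with h | h
  · interval_cases t <;> norm_num
  · induction t, h using Nat.le_induction with
    | base => norm_num
    | succ t ht ih =>
      obtain ⟨u, rfl⟩ := Nat.exists_eq_add_of_le ht
      rw [pow_succ 2]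
      nlinarith [Nat.zero_le (u ^ 4), Nat.zero_le (u ^ 3), Nat.zero_le (u ^ 2)]

/-- Protocols that are too short for the size of the instance err almost half of the time. -/
theorem half_lt_errorProb_add {m n t : ℕ} {p : Player}
    (π : Protocol (Finset ℕ) (Finset ℕ) m p t) {η : ℝ} (hη : 0 < η)
    (hL : 60 ≤ Real.logb 2 n) (hLη : 292 ^ 2 * 41 / η ^ 2 < Real.logb 2 n)
    (hm : Real.logb 2 n ≤ m) (hn : Even n)
    (hle : (m : ℝ) ^ (2 ^ (t + 1) - 2) * Real.logb 2 n ^ (9 * 2 ^ t - 2) ≤ n) :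
    1 / 2 < errorProb n π + η := by
  set L := Real.logb 2 n with hLdef
  have hL0 : (0 : ℝ) < L := by linarith
  have hm1 : (1 : ℝ) ≤ m := by linarith
  have h1t : 1 ≤ 2 ^ t := Nat.one_le_two_pow
  have hn0 : (0 : ℝ) < n := by
    rcases Nat.eq_zero_or_pos n with h | h
    · rw [hLdef, h] at hL; norm_num at hL
    · exact_mod_cast h
  have hnL : (2 : ℝ) ^ L = n := Real.rpow_logb (by norm_num) (by norm_num) hn0
  have h2n : 2 ≤ n := by
    have : (2 : ℝ) ≤ n := by
      rw [← hnL]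
      calc (2 : ℝ) = 2 ^ (1 : ℝ) := by norm_num
        _ ≤ _ := Real.rpow_le_rpow_of_exponent_le (by norm_num) (by linarith)
    exact_mod_cast this
  -- Read off from the exponent of `L` in `hle`. It supplies both the slack `4 ^ t ≤ L²` for the
  -- subdivisions and the bound on `(t + 1) ^ 4` below.
  have htL : (2 : ℝ) ^ t ≤ L := by
    have h1 : ((2 : ℝ)) ^ (9 * 2 ^ t - 2) ≤ n := by
      refine le_trans ?_ hle
      calc (2 : ℝ) ^ (9 * 2 ^ t - 2) ≤ 1 * L ^ (9 * 2 ^ t - 2) := by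
            rw [one_mul]; gcongr; linarith
        _ ≤ _ := by
            gcongr
            exact one_le_pow₀ hm1
    rw [← hnL, ← Real.rpow_natCast, Real.rpow_le_rpow_left_iff (by norm_num)] at h1
    have h2 : 2 ^ t ≤ 9 * 2 ^ t - 2 := by omega
    have h3 : ((2 ^ t : ℕ) : ℝ) ≤ ((9 * 2 ^ t - 2 : ℕ) : ℝ) := Nat.cast_le.2 h2
    push_cast at h3 h1
    linarith
  -- The exponent `9 * 2 ^ t - 2` exceeds that of `sizeBound` by `6`; this pays for the initial
  -- slack `1 + τ = 2`.
  have hdeep : Deep m n t n := by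
    refine deep_of_sizeBound_le hL hm t n 1 le_rfl ?_ ?_
    · rw [mul_one, ← hLdef, show (4 : ℝ) = 2 ^ 2 by norm_num, ← pow_mul, mul_comm, pow_mul]
      gcongr
    · rw [← hLdef]
      refine le_trans ?_ hle
      rw [sizeBound_eq, show 9 * 2 ^ t - 2 = 6 + (9 * 2 ^ t - 8) by omega, pow_add L]
      have h6 : (1 + 1 : ℝ) ≤ L ^ 6 := by
        have := le_self_pow₀ (show 1 ≤ L by linarith) (show 6 ≠ 0 by norm_num)
        linarith
      calc (1 + 1) * ((m : ℝ) ^ (2 ^ (t + 1) - 2) * L ^ (9 * 2 ^ t - 8))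
          ≤ L ^ 6 * ((m : ℝ) ^ (2 ^ (t + 1) - 2) * L ^ (9 * 2 ^ t - 8)) := by gcongr
        _ = _ := mul_left_comm _ _ _
  have hk : (m : ℝ) * L ^ 2 ≤ branching m n := Nat.le_ceil _
  -- The choice `ε = 4 (t + 1) / L`: the largest alphabet has `t (m + 1) ≤ 2 t m` bits, and `16 t m
  -- ≤ 16 m (t + 1)² = m L² ε²`.
  have hT : 8 * Real.log (((2 ^ (m + 1)) ^ t : ℕ) : ℝ) ≤
      branching m n * (4 * (t + 1) / L) ^ 2 := by
    push_cast
    rw [Real.log_pow, Real.log_pow]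
    have hlog : Real.log 2 ≤ 1 := Real.log_two_lt_d9.le.trans (by norm_num)
    calc 8 * ((t : ℝ) * (((m + 1 : ℕ) : ℝ) * Real.log 2)) ≤ 8 * (t * ((m + m) * 1)) := by
          gcongr
          push_cast
          linarith
      _ ≤ m * (16 * (t + 1) ^ 2) := by
          have : (0 : ℝ) ≤ m * (16 * (t + 1 + t ^ 2)) := by positivity
          nlinarith
      _ = m * L ^ 2 * (4 * (t + 1) / L) ^ 2 := by field_simp; ring
      _ ≤ _ := by gcongr
  have hε0 : 0 < 4 * ((t : ℝ) + 1) / L := by positivity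
  have hmain := half_sub_le_errorProb π (by linarith) hε0 hT hn h2n hdeep
  rw [← hLdef] at hmain
  have hX : t * (4 * ((t : ℝ) + 1) / L + 288 / L ^ 2) ≤ 292 * ((t + 1) ^ 2 / L) := by
    have h1 : 288 / L ^ 2 ≤ 288 * ((t : ℝ) + 1) / L := by
      rw [div_le_div_iff₀ (by positivity) hL0]
      have : L * 1 ≤ L * L := by gcongr; linarith
      have h3 : (0 : ℝ) ≤ t * L ^ 2 := by positivity
      nlinarith
    calc t * (4 * ((t : ℝ) + 1) / L + 288 / L ^ 2)
        ≤ (t + 1) * (4 * ((t : ℝ) + 1) / L + 288 * ((t : ℝ) + 1) / L) := by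
          gcongr
          linarith
      _ = _ := by ring
  -- Squares are compared so that `(t + 1) ^ 4 ≤ 41 * 2 ^ t ≤ 41 * L` can be used.
  have hX2 : 292 * (((t : ℝ) + 1) ^ 2 / L) < η := by
    refine lt_of_pow_lt_pow_left₀ 2 hη.le ?_
    have h4 : ((t : ℝ) + 1) ^ 4 ≤ 41 * L := by
      have : (((t + 1) ^ 4 : ℕ) : ℝ) ≤ ((41 * 2 ^ t : ℕ) : ℝ) := Nat.cast_le.2 (succ_pow_four_le t)
      push_cast at this
      linarith
    calc (292 * (((t : ℝ) + 1) ^ 2 / L)) ^ 2 = 292 ^ 2 * ((t + 1) ^ 4 / L ^ 2) := by ring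
      _ ≤ 292 ^ 2 * (41 * L / L ^ 2) := by gcongr
      _ = 292 ^ 2 * 41 / L := by field_simp
      _ < η ^ 2 := by
        rw [div_lt_iff₀ (by positivity)] at hLη ⊢
        linarith
  linarith

/-- Since `L ≤ m`, all factors are powers of `m` with total exponent at most `11 * 2 ^ t ≤ 16 * 2 ^
t = 2 ^ (t + 4)`. -/
theorem logb_logb_sub_le {m n t : ℕ} (hL : 60 ≤ Real.logb 2 n) (hm : Real.logb 2 n ≤ m)
    (h : (n : ℝ) < (m : ℝ) ^ (2 ^ (t + 1) - 2) * Real.logb 2 n ^ (9 * 2 ^ t - 2)) :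
    Real.logb 2 (Real.logb m n) - 4 ≤ t := by
  have hm1 : (1 : ℝ) < m := by linarith
  have h1t : 1 ≤ 2 ^ t := Nat.one_le_two_pow
  have hn1 : (1 : ℝ) < n := by
    by_contra hle
    have := Real.logb_nonpos (b := 2) (by norm_num) (Nat.cast_nonneg n) (not_lt.1 hle)
    linarith
  have hpow : (n : ℝ) < (m : ℝ) ^ (16 * 2 ^ t) := by
    calc (n : ℝ) < (m : ℝ) ^ (2 ^ (t + 1) - 2) * Real.logb 2 n ^ (9 * 2 ^ t - 2) := h
      _ ≤ (m : ℝ) ^ (2 ^ (t + 1) - 2) * (m : ℝ) ^ (9 * 2 ^ t - 2) := by gcongr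
      _ = (m : ℝ) ^ (2 ^ (t + 1) - 2 + (9 * 2 ^ t - 2)) := (pow_add _ _ _).symm
      _ ≤ _ := pow_le_pow_right₀ hm1.le (by rw [pow_succ]; omega)
  have hlog : Real.logb m n ≤ 2 ^ ((4 + t : ℕ) : ℝ) := by
    rw [Real.logb_le_iff_le_rpow hm1 (by linarith), Real.rpow_natCast,
      show (2 : ℝ) ^ (4 + t) = ((16 * 2 ^ t : ℕ) : ℝ) by push_cast; rw [pow_add]; norm_num,
      Real.rpow_natCast]
    exact hpow.le
  have := (Real.logb_le_iff_le_rpow (by norm_num) (Real.logb_pos hm1 hn1)).2 hlog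
  push_cast at this
  linarith

end MedianCC

end

theorem mainTheorem2 :
    ∃ c : ℝ, ∀ ε : ℝ, ε < 1 / 2 → ∃ N : ℕ, ∀ n m t : ℕ, N ≤ n → Even n →
      Real.logb 2 n ≤ m →
      ∀ (first : MedianCC.Player) (π : MedianCC.Protocol (Finset ℕ) (Finset ℕ) m first t),
        MedianCC.errorProb n π ≤ ε →
        (n : ℝ) / Real.logb 2 n ^ (9 * 2 ^ t - 2) < (m : ℝ) ^ (2 ^ (t + 1) - 2) ∧
          Real.logb 2 (Real.logb m n) - c ≤ t := by
  -- The constant is the `4` of `logb_logb_sub_le`; only `N` depends on `ε`, through the gap `1 / 2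
  -- - ε`.
  refine ⟨4, fun ε hε => ?_⟩
  have hη : 0 < 1 / 2 - ε := by linarith
  have htend : Filter.Tendsto (fun n : ℕ => Real.logb 2 (n : ℝ)) Filter.atTop Filter.atTop :=
    (Real.tendsto_logb_atTop (by norm_num)).comp tendsto_natCast_atTop_atTop
  obtain ⟨N, hN⟩ := Filter.eventually_atTop.1
    ((htend.eventually_ge_atTop 60).and
      (htend.eventually_gt_atTop (292 ^ 2 * 41 / (1 / 2 - ε) ^ 2)))
  refine ⟨N, fun n m t hn heven hm first π hπ => ?_⟩
  obtain ⟨hL, hLη⟩ := hN n hn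
  have hlt : (n : ℝ) < (m : ℝ) ^ (2 ^ (t + 1) - 2) * Real.logb 2 n ^ (9 * 2 ^ t - 2) := by
    by_contra hle
    have := MedianCC.half_lt_errorProb_add π hη hL hLη hm heven (not_lt.1 hle)
    linarith
  have hpos : 0 < Real.logb 2 (n : ℝ) := by linarith
  exact ⟨(div_lt_iff₀ (by positivity)).2 hlt, MedianCC.logb_logb_sub_le hL hm hlt⟩
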